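/- Fix $\kappa>0$. Let $p(\kappa)=\mathbb P(|Z|\le\kappa)$ for a standard Gaussian $Z$ and $\alpha_c=\alpha_c(\kappa)=-\log 2/\log p(\kappa)$. For $\beta\in[0,1]$ let $q_\kappa(\beta)=\mathbb P(|Z_1|\le\kappa,\ |Z_2|\le\kappa)$, where $(Z_1,Z_2)$ is jointly Gaussian with means $0$, variances $1$ and covariance $2\beta-1$, and let $F_\alpha(\beta)=H(\beta)+\alpha\log q_\kappa(\beta)$ with $H(\beta)=-\beta\log\beta-(1-\beta)\log(1-\beta)$. Assume that for every $\alpha\in(0,\alpha_c)$ with $F_\alpha''(1/2)<0$ the function $F_\alpha$ has exactly one critical point in $(0,1/2)$. For each $N$ let $X_1,X_2,\dots$ be i.i.d. standard Gaussian vectors in $\mathbb R^N$, and for $t\ge 0$ let $$S_t=\{\sigma\in\{-1,1\}^N:\ |\langle X_i,\sigma\rangle|\le\kappa\sqrt N\ \text{ for all } 1\le i\le t\}.$$ Then for every $\varepsilon>0$ there is $M=M(\varepsilon)$ (which may depend on $\kappa$, but not on $\alpha$) such that for every $\alpha<\alpha_c$ $$\limsup_{N\to\infty}\ \sup_{0\le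 t\le\alpha N}\ \mathbb P\left(\left|\log\frac{|S_t|}{\mathbb E|S_t|}\right|\ge M\log N\right)\le\varepsilon .$$ Here $t$ ranges over integers, the supremum over an empty set is $0$, and $|\log 0|=+\infty$, so the event includes $\{S_t=\emptyset\}$. -/

import Mathlib

open MeasureTheory ProbabilityTheory Filter Topology
open scoped ENNReal RealInnerProductSpace

namespace SymPerceptron

noncomputable section

/-- `p(κ) = Pr[|Z| ≤ κ]` for a standard Gaussian variable `Z`. -/
def p (κ : ℝ) : ℝ := (gaussianReal 0 1).real {z : ℝ | |z| ≤ κ}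

/-- The critical capacity density `α_c(κ) = - log 2 / log p(κ)`. -/
def alphaC (κ : ℝ) : ℝ := -Real.log 2 / Real.log (p κ)

/-- `q_κ(β) = Pr[|Z₁| ≤ κ, |Z₂| ≤ κ]`, where `(Z₁, Z₂)` is jointly Gaussian with means `0`,
variances `1` and covariance `2β - 1`. The matrix is positive semidefinite for `0 ≤ β ≤ 1`;
only those `β` matter. -/
def q (κ β : ℝ) : ℝ :=
  (multivariateGaussian (0 : EuclideanSpace ℝ (Fin 2))
    (!![1, 2 * β - 1; 2 * β - 1, 1] : Matrix (Fin 2) (Fin 2) ℝ)).real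
      {z | |z 0| ≤ κ ∧ |z 1| ≤ κ}

/-- `F_α(β) = H(β) + α log q_κ(β)`, with `H` the Shannon entropy function in natural
logarithms (`Real.binEntropy`). -/
def F (κ α β : ℝ) : ℝ := Real.binEntropy β + α * Real.log (q κ β)

/-- The standing assumption on the critical points: for all densities `0 < α < α_c(κ)`, if
`F_α''(1/2) < 0`, then `F_α` has exactly one critical point in `(0, 1/2)`. -/
def CriticalPointAssumption (κ : ℝ) : Prop :=
  ∀ α : ℝ, 0 < α → α < alphaC κ → iteratedDeriv 2 (F κ α) (1 / 2) < 0 →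
    ∃! β : ℝ, β ∈ Set.Ioo (0 : ℝ) (1 / 2) ∧ HasDerivAt (F κ α) 0 β

/-- The hypercube `Σ_N = {-1, 1}^N`. -/
def cube (N : ℕ) : Set (EuclideanSpace ℝ (Fin N)) := {σ | ∀ j, σ j = -1 ∨ σ j = 1}

/-- `H_κ(x) = {σ ∈ Σ_N : |⟨x, σ⟩| ≤ κ √N}`. -/
def slab (κ : ℝ) {N : ℕ} (x : EuclideanSpace ℝ (Fin N)) : Set (EuclideanSpace ℝ (Fin N)) :=
  {σ ∈ cube N | |⟪x, σ⟫| ≤ κ * √(N : ℝ)}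

/-- The solution space `S_t` of the first `t` constraints `x 0, …, x (t - 1)`;
`S_0 = Σ_N` is the whole cube. -/
def solutions (κ : ℝ) {N : ℕ} (x : ℕ → EuclideanSpace ℝ (Fin N)) (t : ℕ) :
    Set (EuclideanSpace ℝ (Fin N)) :=
  {σ ∈ cube N | ∀ i < t, σ ∈ slab κ (x i)}

/-- The cube is finite, so that `Set.ncard` of a subset is its true cardinality. -/
theorem cube_finite (N : ℕ) : (cube N).Finite := by
  have h : (Set.pi Set.univ (fun _ : Fin N => ({-1, 1} : Set ℝ))).Finite :=
    Set.Finite.pi fun _ => Set.toFinite _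
  refine (h.image (WithLp.toLp 2)).subset ?_
  intro σ hσ
  exact ⟨σ.ofLp, fun j _ => by simpa using hσ j, rfl⟩

theorem solutions_finite (κ : ℝ) {N : ℕ} (x : ℕ → EuclideanSpace ℝ (Fin N)) (t : ℕ) :
    (solutions κ x t).Finite :=
  (cube_finite N).subset fun _ hσ => hσ.1

section Random

variable {Ω : Type*} [MeasurableSpace Ω] {N : ℕ}

/-- The expected number of solutions `E|S_t|` when the constraint vectors are `X i`. -/
def expectedCard (κ : ℝ) (P : Measure Ω) (X : ℕ → Ω → EuclideanSpace ℝ (Fin N)) (t : ℕ) : ℝ :=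
  ∫ ω, ((solutions κ (fun i => X i ω) t).ncard : ℝ) ∂P

/-- The event `|log (|S_t| / E|S_t|)| ≥ r`. It contains the event `S_t = ∅`, on which
`log (|S_t| / E|S_t|) = log 0 = -∞`. -/
def deviationEvent (κ : ℝ) (P : Measure Ω) (X : ℕ → Ω → EuclideanSpace ℝ (Fin N)) (t : ℕ)
    (r : ℝ) : Set Ω :=
  {ω | solutions κ (fun i => X i ω) t = ∅ ∨
    r ≤ |Real.log (((solutions κ (fun i => X i ω) t).ncard : ℝ) / expectedCard κ P X t)|}

end Random

end

end SymPerceptron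

open MeasureTheory ProbabilityTheory Filter Topology
open scoped ENNReal RealInnerProductSpace

namespace SymPerceptron

/-! The upper tail is Markov's inequality, since the mean of |S_t| is 2^N p^t. The lower tail is the
substance. A second moment bound alone would only give positive probability, so the sets S_t are
followed as a Markov chain of random thinnings, and what is controlled is the inverse moment
E[(E|S_t|)/|S_t|].

Let S be the current set, S' the next one, and Y = |S'|/(p|S|), which has conditional mean 1. Its
variance is governed by the mean square overlap of pairs in S, because q(β) - p² ≤ C(2β-1)²
(`exists_q_sub_sq_le_global`). If a step keeps at least a fraction η of S, then 1/Y ≤ 2 - Y +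
(Y-1)²/η, so the inverse moment grows by a factor 1 + O(D), where D bounds the mean square overlap
(`sum_thinKernel_inv_le`). The chain is killed when S becomes too small, when its overlaps are too
large, or when a step keeps less than a fraction η. The three losses are bounded by Markov applied
to the inverse moment, by a first moment count of pairs with large overlap
(`thinLaw_bad_overlap_le`, `sum_large_overlap_le`), and by Gaussian concentration of a smoothed
survivor count (`exists_slab_lower`). `thinLaw_lower_tail` adds them up.

The pair count at agreement β, normalised by the squared mean, is at most exp(N(F(β) - F(1/2))).
Hence D may be taken of order log N / N, and over O(N) steps the inverse moment grows by a power of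
N only: this is the scale M log N.

It remains that F has a strict quadratic maximum at 1/2. The curvature there is negative for every α
below the first moment threshold, with a margin depending on κ only. This is an inequality about the
Gaussian mass of an interval (`capGap_pos`), and it makes the local constants, hence M, uniform in α
(`exists_F_local`). Away from 1/2 the unique critical point excludes a competing maximum
(`exists_F_far`). The failure probability tends to 0, so the M obtained does not even depend on ε.
-/

/-! ### Gaussian mass of a symmetric interval: series and tail bounds -/

/-- The standard Gaussian density. -/
noncomputable def gphi (x : ℝ) : ℝ := (√(2 * Real.pi))⁻¹ * Real.exp (-x ^ 2 / 2)

/-- The mass of `[-κ, κ]` under the standard Gaussian density. -/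
noncomputable def boxMass (κ : ℝ) : ℝ := ∫ x in -κ..κ, gphi x

lemma gphi_pos (x : ℝ) : 0 < gphi x := by unfold gphi; positivity

lemma gphi_neg (x : ℝ) : gphi (-x) = gphi x := by simp [gphi]

lemma hasDerivAt_gphi (x : ℝ) : HasDerivAt gphi (-x * gphi x) x := by
  have h : HasDerivAt (fun x : ℝ => -x ^ 2 / 2) (-x) x := by
    refine HasDerivAt.congr_deriv (((hasDerivAt_pow 2 x).neg).div_const 2) ?_
    push_cast; ring
  refine HasDerivAt.congr_deriv ((h.exp).const_mul ((√(2 * Real.pi))⁻¹)) ?_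
  simp only [gphi]; ring

lemma continuous_gphi : Continuous gphi := by unfold gphi; fun_prop

lemma hasDerivAt_boxMass (κ : ℝ) : HasDerivAt boxMass (2 * gphi κ) κ := by
  have e : boxMass = fun κ => (∫ x in (0 : ℝ)..κ, gphi x) - ∫ x in (0 : ℝ)..(-κ), gphi x := by
    funext κ
    rw [boxMass, intervalIntegral.integral_interval_sub_left] <;>
      exact continuous_gphi.intervalIntegrable _ _
  rw [e]
  have h1 : ∀ y, HasDerivAt (fun κ => ∫ x in (0 : ℝ)..κ, gphi x) (gphi y) y := fun y =>
    intervalIntegral.integral_hasDerivAt_right (continuous_gphi.intervalIntegrable _ _)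
      (continuous_gphi.stronglyMeasurableAtFilter _ _) continuous_gphi.continuousAt
  have h2 := (h1 (-κ)).comp κ (hasDerivAt_neg κ)
  refine HasDerivAt.congr_deriv ((h1 κ).sub h2) ?_
  rw [gphi_neg]; ring

lemma boxMass_zero : boxMass 0 = 0 := by simp [boxMass]

/-- The degree five truncation of the series `∑ vʲ / (2j+1)!!`. -/
noncomputable def dfSeries (v : ℝ) : ℝ :=
  1 + v / 3 + v ^ 2 / 15 + v ^ 3 / 105 + v ^ 4 / 945 + v ^ 5 / 10395

lemma dfSeries_ge_one {v : ℝ} (hv : 0 ≤ v) : 1 ≤ dfSeries v := by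
  unfold dfSeries
  have : 0 ≤ v / 3 + v ^ 2 / 15 + v ^ 3 / 105 + v ^ 4 / 945 + v ^ 5 / 10395 := by positivity
  linarith

lemma dfSeries_mono {v w : ℝ} (hv : 0 ≤ v) (h : v ≤ w) : dfSeries v ≤ dfSeries w := by
  unfold dfSeries; gcongr

/-- Differentiating φ(x) times the truncated series telescopes to φ(x)(1 - x¹²/10395), so the error
has a nonnegative derivative and vanishes at 0. -/
lemma le_boxMass {κ : ℝ} (hκ : 0 ≤ κ) : 2 * gphi κ * κ * dfSeries (κ ^ 2) ≤ boxMass κ := by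
  let f : ℝ → ℝ := fun x => boxMass x - 2 * (gphi x * (x * dfSeries (x ^ 2)))
  have hf : ∀ x, HasDerivAt f (2 * gphi x * (x ^ 12 / 10395)) x := by
    intro x
    have hp : HasDerivAt (fun x : ℝ => x * dfSeries (x ^ 2))
        (1 + x ^ 2 + x ^ 4 / 3 + x ^ 6 / 15 + x ^ 8 / 105 + x ^ 10 / 945) x := by
      have e : (fun x : ℝ => x * dfSeries (x ^ 2)) = fun x => x + x ^ 3 / 3 + x ^ 5 / 15
          + x ^ 7 / 105 + x ^ 9 / 945 + x ^ 11 / 10395 := by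
        funext y; unfold dfSeries; ring
      rw [e]
      refine HasDerivAt.congr_deriv ((((((hasDerivAt_id x).add ((hasDerivAt_pow 3 x).div_const 3)).add
        ((hasDerivAt_pow 5 x).div_const 15)).add ((hasDerivAt_pow 7 x).div_const 105)).add
        ((hasDerivAt_pow 9 x).div_const 945)).add ((hasDerivAt_pow 11 x).div_const 10395)) ?_
      push_cast; ring
    refine HasDerivAt.congr_deriv ((hasDerivAt_boxMass x).sub (((hasDerivAt_gphi x).mul hp).const_mul 2)) ?_
    unfold dfSeries; ring
  have hm : MonotoneOn f (Set.Ici 0) := monotoneOn_of_hasDerivWithinAt_nonneg (convex_Ici 0)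
    (fun x _ => (hf x).continuousAt.continuousWithinAt) (fun x _ => (hf x).hasDerivWithinAt)
    (fun x _ => by have := gphi_pos x; positivity)
  have := hm (Set.mem_Ici.2 le_rfl) (Set.mem_Ici.2 hκ) hκ
  simp only [f, boxMass_zero] at this
  linarith

/-- The extra coefficient is 4/3 of the next series coefficient 1/135135. The derivative of the
error carries the factor 1/3 - 4x²/39, which is nonnegative exactly up to x² = 13/4. -/
lemma boxMass_le {κ : ℝ} (hκ : 0 ≤ κ) (hκ' : κ ^ 2 ≤ 13 / 4) :
    boxMass κ ≤ 2 * gphi κ * κ * (dfSeries (κ ^ 2) + 4 / 405405 * (κ ^ 2) ^ 6) := by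
  let f : ℝ → ℝ := fun x =>
    2 * (gphi x * (x * (dfSeries (x ^ 2) + 4 / 405405 * (x ^ 2) ^ 6))) - boxMass x
  have hf : ∀ x, HasDerivAt f (2 * gphi x * (x ^ 12 / 10395) * (1 / 3 - 4 / 39 * x ^ 2)) x := by
    intro x
    have hp : HasDerivAt (fun x : ℝ => x * (dfSeries (x ^ 2) + 4 / 405405 * (x ^ 2) ^ 6))
        (1 + x ^ 2 + x ^ 4 / 3 + x ^ 6 / 15 + x ^ 8 / 105 + x ^ 10 / 945
          + 4 / 3 * x ^ 12 / 10395) x := by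
      have e : (fun x : ℝ => x * (dfSeries (x ^ 2) + 4 / 405405 * (x ^ 2) ^ 6)) =
          fun x => x + x ^ 3 / 3 + x ^ 5 / 15
          + x ^ 7 / 105 + x ^ 9 / 945 + x ^ 11 / 10395 + x ^ 13 * 4 / 405405 := by
        funext y; unfold dfSeries; ring
      rw [e]
      refine HasDerivAt.congr_deriv (((((((hasDerivAt_id x).add ((hasDerivAt_pow 3 x).div_const 3)).add
        ((hasDerivAt_pow 5 x).div_const 15)).add ((hasDerivAt_pow 7 x).div_const 105)).add
        ((hasDerivAt_pow 9 x).div_const 945)).add ((hasDerivAt_pow 11 x).div_const 10395)).add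
        (((hasDerivAt_pow 13 x).mul_const 4).div_const 405405)) ?_
      push_cast; ring
    refine HasDerivAt.congr_deriv ((((hasDerivAt_gphi x).mul hp).const_mul 2).sub (hasDerivAt_boxMass x)) ?_
    unfold dfSeries; ring
  have hm : MonotoneOn f (Set.Icc 0 κ) := monotoneOn_of_hasDerivWithinAt_nonneg (convex_Icc 0 κ)
    (fun x _ => (hf x).continuousAt.continuousWithinAt) (fun x _ => (hf x).hasDerivWithinAt)
    (fun x hx => by
      rw [interior_Icc] at hx
      have := gphi_pos x
      have h2 : x ^ 2 ≤ 13 / 4 := le_trans (pow_le_pow_left₀ hx.1.le hx.2.le 2) hκ'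
      have h3 : 0 ≤ 1 / 3 - 4 / 39 * x ^ 2 := by linarith
      positivity)
  have := hm (Set.left_mem_Icc.2 hκ) (Set.right_mem_Icc.2 hκ) hκ
  simp only [f, boxMass_zero] at this
  linarith

lemma boxMass_pos {κ : ℝ} (hκ : 0 < κ) : 0 < boxMass κ := by
  have := le_boxMass hκ.le
  have h1 := dfSeries_ge_one (sq_nonneg κ)
  have h2 := gphi_pos κ
  have : 0 < 2 * gphi κ * κ * dfSeries (κ ^ 2) := by positivity
  linarith

lemma boxMass_strictMonoOn : StrictMonoOn boxMass (Set.Ici 0) :=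
  strictMonoOn_of_deriv_pos (convex_Ici 0)
    (fun x _ => (hasDerivAt_boxMass x).continuousAt.continuousWithinAt)
    (fun x _ => by rw [(hasDerivAt_boxMass x).deriv]; have := gphi_pos x; positivity)

lemma boxMass_mono {x y : ℝ} (hx : 0 ≤ x) (h : x ≤ y) : boxMass x ≤ boxMass y :=
  boxMass_strictMonoOn.monotoneOn (Set.mem_Ici.2 hx) (Set.mem_Ici.2 (hx.trans h)) h

lemma gphi_eq : gphi = gaussianPDFReal 0 1 := by
  funext x; simp [gphi, gaussianPDFReal]

lemma integral_gphi : ∫ x, gphi x = 1 := by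
  rw [gphi_eq]; exact integral_gaussianPDFReal_eq_one 0 one_ne_zero

lemma integrable_gphi : Integrable gphi := by
  rw [gphi_eq]; exact integrable_gaussianPDFReal 0 1

lemma tendsto_boxMass : Tendsto boxMass atTop (𝓝 1) := by
  have := intervalIntegral_tendsto_integral integrable_gphi tendsto_neg_atTop_atBot tendsto_id
  rwa [integral_gphi] at this

lemma boxMass_lt_one {κ : ℝ} (hκ : 0 ≤ κ) : boxMass κ < 1 := by
  have h1 : boxMass κ < boxMass (κ + 1) :=
    boxMass_strictMonoOn (Set.mem_Ici.2 hκ) (Set.mem_Ici.2 (by linarith)) (by linarith)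
  refine h1.trans_le (ge_of_tendsto tendsto_boxMass ?_)
  filter_upwards [eventually_ge_atTop (κ + 1)] with y hy
  exact boxMass_mono (by linarith) hy

lemma tendsto_mul_gphi : Tendsto (fun x => x * gphi x / (1 + x ^ 2)) atTop (𝓝 0) := by
  have hb : ∀ x, gphi x ≤ 1 := by
    intro x
    unfold gphi
    have h1 : Real.exp (-x ^ 2 / 2) ≤ 1 := Real.exp_le_one_iff.2 (by nlinarith [sq_nonneg x])
    have h2 : (√(2 * Real.pi))⁻¹ ≤ 1 := inv_le_one_of_one_le₀
      (Real.one_le_sqrt.2 (by nlinarith [Real.pi_gt_three]))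
    exact mul_le_one₀ h2 (Real.exp_pos _).le h1
  refine squeeze_zero' ?_ ?_ tendsto_inv_atTop_zero
  · filter_upwards [eventually_ge_atTop 0] with x hx
    have := (gphi_pos x).le
    positivity
  · filter_upwards [eventually_gt_atTop 0] with x hx
    rw [div_le_iff₀ (by positivity), inv_mul_eq_div, le_div_iff₀ hx]
    nlinarith [hb x, gphi_pos x, sq_nonneg x]

/-- The lower Mills ratio bound. -/
lemma mills_le {κ : ℝ} : 2 * gphi κ * κ / (1 + κ ^ 2) ≤ 1 - boxMass κ := by
  let f : ℝ → ℝ := fun x => 1 - boxMass x - 2 * (x * gphi x / (1 + x ^ 2))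
  have hf : ∀ x, HasDerivAt f (-(4 * gphi x / (1 + x ^ 2) ^ 2)) x := by
    intro x
    have hx : (1 + x ^ 2) ≠ 0 := by positivity
    have h2 : HasDerivAt (fun x : ℝ => 1 + x ^ 2) (2 * x) x := by
      refine HasDerivAt.congr_deriv ((hasDerivAt_pow 2 x).const_add 1) ?_; norm_num
    refine HasDerivAt.congr_deriv (((hasDerivAt_boxMass x).const_sub 1).sub
      ((((hasDerivAt_id x).mul (hasDerivAt_gphi x)).div h2 hx).const_mul 2)) ?_
    simp only [id, Pi.mul_apply]; field_simp; ring
  have hm : Antitone f := antitone_of_hasDerivAt_nonpos hf fun x => by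
    have := gphi_pos x
    have : 0 ≤ 4 * gphi x / (1 + x ^ 2) ^ 2 := by positivity
    exact neg_nonpos.2 this
  have ht : Tendsto f atTop (𝓝 0) := by
    have := (tendsto_boxMass.const_sub 1).sub (tendsto_mul_gphi.const_mul 2)
    simpa [f] using this
  have := hm.le_of_tendsto ht κ
  simp only [f] at this
  have e : 2 * gphi κ * κ / (1 + κ ^ 2) = 2 * (κ * gphi κ / (1 + κ ^ 2)) := by ring
  linarith

/-! ### The curvature inequality at the first moment threshold -/

/-- Homogenised in a = v and b = 189/100 - v (Bernstein form on the interval), the polynomial has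
only positive coefficients. The constant 7213/10000 is just below 1/(2 log 2). -/
lemma dfSeries_quadratic_pos {v : ℝ} (h0 : 0 ≤ v) (h1 : v ≤ 189 / 100) :
    0 < 7213 / 10000 * dfSeries v ^ 2 - (v - 1) * dfSeries v - 1 := by
  have key : ∀ a b : ℝ, 0 ≤ a → 0 ≤ b → a + b = 189 / 100 →
      0 < 7213 / 10000 * dfSeries a ^ 2 - (a - 1) * dfSeries a - 1 := by
    intro a b ha hb hab
    have e : 7213 / 10000 * dfSeries a ^ 2 - (a - 1) * dfSeries a - 1 =
      72130000000000000000/58159148805327867842601*(a^0*b^10)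
      + 686183800000000000000/58159148805327867842601*(a^1*b^9)
      + 321947852600000000000/6462127645036429760289*(a^2*b^8)
      + 2375189525320000000000/19386382935109289280867*(a^3*b^7)
      + 535301923358308000000/2769483276444184182981*(a^4*b^6)
      + 2058898270155351440000/10154772013628675337597*(a^5*b^5)
      + 4305399977470455364400/30464316040886026012791*(a^6*b^4)
      + 13452530029842982166384/213250212286202182089537*(a^7*b^3)
      + 29080079657334043951033/1777085102385018184079475*(a^8*b^2)
      + 1512585359467779077515477/799688296073258182835763750*(a^9*b^1)
      + 11797214690182197415071253/1759314251361168002238680250000*(a^10*b^0) := by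
      obtain rfl : b = 189 / 100 - a := by linarith
      unfold dfSeries; ring
    rw [e]
    rcases ha.eq_or_lt with rfl | ha
    · have : 0 < b := by linarith
      positivity
    · positivity
  exact key v (189 / 100 - v) h0 (by linarith) (by ring)

/-- The same certificate on [19/10, 81/25], of length 67/50. Here 7214/10000 is just above 1/(2 log
2), and the upper series bound replaces the lower one. -/
lemma dfSeries_quadratic_neg {v : ℝ} (h0 : 19 / 10 ≤ v) (h1 : v ≤ 81 / 25) :
    7214 / 10000 * (dfSeries v + 4 / 405405 * v ^ 6) ^ 2
      - (v - 1) * (dfSeries v + 4 / 405405 * v ^ 6) - 1 < 0 := by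
  have key : ∀ a b : ℝ, 0 ≤ a → 0 ≤ b → a + b = 67 / 50 →
      0 < -(7214 / 10000 * (dfSeries (19 / 10 + a) + 4 / 405405 * (19 / 10 + a) ^ 6) ^ 2
      - (19 / 10 + a - 1) * (dfSeries (19 / 10 + a) + 4 / 405405 * (19 / 10 + a) ^ 6) - 1) := by
    intro a b ha hb hab
    have e : -(7214 / 10000 * (dfSeries (19 / 10 + a) + 4 / 405405 * (19 / 10 + a) ^ 6) ^ 2
      - (19 / 10 + a - 1) * (dfSeries (19 / 10 + a) + 4 / 405405 * (19 / 10 + a) ^ 6) - 1) =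
      1430141416772232679993390625/107588492115163002746182751813442*(a^0*b^12)
      + 5245759235707321771961815625/232875524058794378238490804791*(a^1*b^11)
      + 8956331757295232834126201481875/35862830705054334248727583937814*(a^2*b^10)
      + 7517808856621979640935154020000/5977138450842389041454597322969*(a^3*b^9)
      + 22651227242145945933118218989500/5977138450842389041454597322969*(a^4*b^8)
      + 15107494602897968587339141984640/1992379483614129680484865774323*(a^5*b^7)
      + 2339895666184722034375465371272/221375498179347742276096197147*(a^6*b^6)
      + 4963509397555692515696860930112/474376067527173733448777565315*(a^7*b^5)
      + 8131278692574288558898926221248/1106877490896738711380480985735*(a^8*b^4)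
      + 6602242385607137034773436389888/1844795818161231185634134976225*(a^9*b^3)
      + 53018926514375815651847290861696/46119895454030779640853374405625*(a^10*b^2)
      + 2398602450082946120708082538496/10980927489054947533536517715625*(a^11*b^1)
      + 48402631532729503220805382144/2614506545013082746080123265625*(a^12*b^0) := by
      obtain rfl : b = 67 / 50 - a := by linarith
      unfold dfSeries; ring
    rw [e]
    rcases ha.eq_or_lt with rfl | ha
    · have : 0 < b := by linarith
      positivity
    · positivity
  have := key (v - 19 / 10) (81 / 25 - v) (by linarith) (by linarith) (by ring)
  rw [show (19 / 10 + (v - 19 / 10) : ℝ) = v by ring] at this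
  linarith

/-- The ratio `g` with `boxMass κ = 2 κ φ(κ) g`. -/
noncomputable def massRatio (κ : ℝ) : ℝ := boxMass κ / (2 * gphi κ * κ)

lemma massRatio_mul {κ : ℝ} (hκ : 0 < κ) : boxMass κ = 2 * gphi κ * κ * massRatio κ := by
  have := gphi_pos κ
  unfold massRatio; field_simp

lemma dfSeries_le_massRatio {κ : ℝ} (hκ : 0 < κ) : dfSeries (κ ^ 2) ≤ massRatio κ := by
  have := gphi_pos κ
  rw [massRatio, le_div_iff₀ (by positivity)]
  linarith [le_boxMass hκ.le]

lemma massRatio_le {κ : ℝ} (hκ : 0 < κ) (h : κ ^ 2 ≤ 13 / 4) :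
    massRatio κ ≤ dfSeries (κ ^ 2) + 4 / 405405 * (κ ^ 2) ^ 6 := by
  have := gphi_pos κ
  rw [massRatio, div_le_iff₀ (by positivity)]
  linarith [boxMass_le hκ.le h]

/-- The gap whose positivity says that the second moment curvature condition holds
up to the first moment threshold. -/
noncomputable def capGap (κ : ℝ) : ℝ :=
  -Real.log (boxMass κ) - Real.log 2 * (2 * gphi κ * κ / boxMass κ) ^ 2

/-- Written with the ratio g, the gap is -log p - (log 2)/g² and p'/p = 1/(κg). The sign of the
derivative is therefore that of a quadratic in g with coefficients in κ², to which the polynomial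
certificates apply. -/
lemma hasDerivAt_capGap {κ : ℝ} (hκ : 0 < κ) :
    HasDerivAt capGap ((2 * Real.log 2 * (1 + (κ ^ 2 - 1) * massRatio κ) - massRatio κ ^ 2) /
      (κ * massRatio κ ^ 3)) κ := by
  have hp := boxMass_pos hκ
  have hg := gphi_pos κ
  have hr : 0 < massRatio κ := by unfold massRatio; positivity
  have h1 := (hasDerivAt_boxMass κ).log hp.ne'
  have h2 := ((((hasDerivAt_gphi κ).const_mul 2).mul (hasDerivAt_id κ)).div
    (hasDerivAt_boxMass κ) hp.ne')
  refine HasDerivAt.congr_deriv (h1.neg.sub ((h2.pow 2).const_mul (Real.log 2))) ?_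
  simp only [id, Pi.mul_apply, Pi.div_apply, Nat.cast_ofNat, Nat.add_one_sub_one, pow_one]
  rw [massRatio_mul hκ]
  have hr' := hr.ne'
  generalize massRatio κ = g at hr' ⊢
  field_simp
  ring

lemma log_two_bounds : 0.6931471803 < Real.log 2 ∧ Real.log 2 < 0.6931471808 :=
  ⟨Real.log_two_gt_d9, Real.log_two_lt_d9⟩

lemma capGap_antitoneOn : AntitoneOn capGap (Set.Ioc 0 (√(189 / 100))) := by
  refine antitoneOn_of_hasDerivWithinAt_nonpos (convex_Ioc _ _)
    (fun x hx => (hasDerivAt_capGap hx.1).continuousAt.continuousWithinAt)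
    (fun x hx => (hasDerivAt_capGap (interior_subset hx).1).hasDerivWithinAt) fun x hx => ?_
  obtain ⟨hx0, hx1⟩ := interior_subset hx
  have hv : x ^ 2 ≤ 189 / 100 := (Real.le_sqrt hx0.le (by norm_num)).1 hx1
  have hv0 := sq_nonneg x
  have hG := dfSeries_le_massRatio hx0
  have hG1 := dfSeries_ge_one hv0
  have hQ := dfSeries_quadratic_pos hv0 hv
  set g := massRatio x
  set G := dfSeries (x ^ 2)
  -- The quadratic increases from G to g: its difference quotient 0.7213(g + G) - (x² - 1) is
  -- nonnegative because g, G ≥ 1 and x² ≤ 1.89.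
  have hQ' : 0 < 7213 / 10000 * g ^ 2 - (x ^ 2 - 1) * g - 1 := by
    have : 0 ≤ (g - G) * (7213 / 10000 * (g + G) - (x ^ 2 - 1)) :=
      mul_nonneg (by linarith) (by linarith)
    nlinarith
  obtain ⟨hl, hl'⟩ := log_two_bounds
  have hg : 0 < g := by linarith
  refine div_nonpos_of_nonpos_of_nonneg ?_ (by positivity)
  have h3 : Real.log 2 * (1 + (x ^ 2 - 1) * g) ≤ Real.log 2 * (7213 / 10000 * g ^ 2) :=
    mul_le_mul_of_nonneg_left (by linarith) (by linarith)
  nlinarith [sq_nonneg g]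

lemma capGap_monotoneOn : MonotoneOn capGap (Set.Icc (√(19 / 10)) (9 / 5)) := by
  have hpos : ∀ x ∈ Set.Icc (√(19 / 10)) (9 / 5 : ℝ), 0 < x := fun x hx =>
    lt_of_lt_of_le (by positivity) hx.1
  refine monotoneOn_of_hasDerivWithinAt_nonneg (convex_Icc _ _)
    (fun x hx => (hasDerivAt_capGap (hpos x hx)).continuousAt.continuousWithinAt)
    (fun x hx => (hasDerivAt_capGap (hpos x (interior_subset hx))).hasDerivWithinAt)
    fun x hx => ?_
  have hx0 := hpos x (interior_subset hx)
  obtain ⟨hx1, hx2⟩ := interior_subset hx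
  have hv : 19 / 10 ≤ x ^ 2 := (Real.sqrt_le_left hx0.le).1 hx1
  have hv2 : x ^ 2 ≤ 81 / 25 := by nlinarith
  have hv0 := sq_nonneg x
  have hG := dfSeries_le_massRatio hx0
  have hU := massRatio_le hx0 (by linarith)
  have hQ := dfSeries_quadratic_neg hv hv2
  have hG1 : 1 + x ^ 2 / 3 + (x ^ 2) ^ 2 / 15 ≤ dfSeries (x ^ 2) := by
    unfold dfSeries
    have : 0 ≤ (x ^ 2) ^ 3 / 105 + (x ^ 2) ^ 4 / 945 + (x ^ 2) ^ 5 / 10395 := by positivity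
    linarith
  set g := massRatio x
  set G := dfSeries (x ^ 2)
  set U := G + 4 / 405405 * (x ^ 2) ^ 6
  have hQ' : 7214 / 10000 * g ^ 2 - (x ^ 2 - 1) * g - 1 < 0 := by
    have : 0 ≤ (U - g) * (7214 / 10000 * (U + g) - (x ^ 2 - 1)) :=
      mul_nonneg (by linarith) (by nlinarith)
    nlinarith
  obtain ⟨hl, hl'⟩ := log_two_bounds
  have hg : 0 < g := by nlinarith
  refine div_nonneg ?_ (by positivity)
  have h3 : Real.log 2 * (7214 / 10000 * g ^ 2) ≤ Real.log 2 * (1 + (x ^ 2 - 1) * g) :=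
    mul_le_mul_of_nonneg_left (by linarith) (by linarith)
  nlinarith [sq_nonneg g]

lemma gphi_sq (κ : ℝ) : gphi κ ^ 2 = Real.exp (-κ ^ 2) / (2 * Real.pi) := by
  have hpi := Real.pi_pos
  rw [gphi, mul_pow, inv_pow, Real.sq_sqrt (by positivity), ← Real.exp_nat_mul]
  rw [show ((2 : ℕ) : ℝ) * (-κ ^ 2 / 2) = -κ ^ 2 by push_cast; ring]
  field_simp

/-- Bounds the first term of the gap where it is nearly minimal. Squaring removes the square roots
and leaves a comparison of exponentials with π. -/
lemma boxMass_middle_le : Real.log (boxMass (√(19 / 10))) ≤ -(1827 / 10000) := by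
  have hk : 0 < √(19 / 10 : ℝ) := by positivity
  have hs : √(19 / 10 : ℝ) ^ 2 = 19 / 10 := Real.sq_sqrt (by norm_num)
  have hp := boxMass_pos hk
  have h1 := boxMass_le hk.le (by rw [hs]; norm_num)
  rw [hs] at h1
  have h2 : dfSeries (19 / 10) + 4 / 405405 * (19 / 10) ^ 6 ≤ 1.9561 := by
    norm_num [dfSeries]
  have hg := gphi_pos (√(19 / 10))
  have h3 : boxMass (√(19 / 10)) ^ 2 ≤ (2 * gphi (√(19 / 10)) * √(19 / 10) * 1.9561) ^ 2 := by
    refine pow_le_pow_left₀ hp.le (h1.trans ?_) 2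
    gcongr
  have h4 : (2 * gphi (√(19 / 10)) * √(19 / 10) * 1.9561) ^ 2
      = 4 * 1.9 * 1.9561 ^ 2 / (2 * Real.pi) * Real.exp (-1.9) := by
    rw [mul_pow, mul_pow, mul_pow, gphi_sq, hs]
    norm_num; ring
  have h5 : (4.63 : ℝ) ≤ Real.exp 1.5346 := by
    refine le_trans ?_ (Real.sum_le_exp_of_nonneg (by norm_num) 10)
    norm_num [Finset.sum_range_succ, Nat.factorial]
  have hpi := Real.pi_gt_d6
  have h6 : boxMass (√(19 / 10)) ^ 2 ≤ Real.exp (-0.3654) := by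
    refine h3.trans ?_
    rw [h4, show (-0.3654 : ℝ) = 1.5346 + -1.9 by norm_num, Real.exp_add]
    refine mul_le_mul_of_nonneg_right (le_trans ?_ h5) (Real.exp_pos _).le
    rw [div_le_iff₀ (by positivity)]
    nlinarith
  have h7 := Real.log_le_log (by positivity) h6
  rw [Real.log_exp, Real.log_pow] at h7
  push_cast at h7
  linarith

/-- The two terms are estimated separately, the mass at the right endpoint and the ratio g at the
left one. The window is narrow because the margin is only about 4·10⁻⁵. -/
lemma capGap_middle_pos {κ : ℝ} (h1 : √(189 / 100) ≤ κ) (h2 : κ ≤ √(19 / 10)) :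
    0 < capGap κ := by
  have hk : 0 < κ := lt_of_lt_of_le (by positivity) h1
  have hp := boxMass_pos hk
  have hv : 189 / 100 ≤ κ ^ 2 := (Real.sqrt_le_left hk.le).1 h1
  have hl : Real.log (boxMass κ) ≤ -(1827 / 10000) :=
    (Real.log_le_log hp (boxMass_mono hk.le h2)).trans boxMass_middle_le
  have hG : 1.948 ≤ massRatio κ := by
    refine le_trans ?_ ((dfSeries_mono (by norm_num) hv).trans (dfSeries_le_massRatio hk))
    norm_num [dfSeries]
  have hg := gphi_pos κ
  have e : 2 * gphi κ * κ / boxMass κ = 1 / massRatio κ := by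
    rw [massRatio]; field_simp
  have h3 : (1 / massRatio κ) ^ 2 ≤ (1 / 1.948) ^ 2 := by gcongr
  obtain ⟨hl1, hl2⟩ := log_two_bounds
  rw [capGap, e]
  have : Real.log 2 * (1 / massRatio κ) ^ 2 ≤ 0.6931471808 * (1 / 1.948) ^ 2 := by
    gcongr
  norm_num at this ⊢
  norm_num at hl
  linarith

/-- Here -log p ≥ 1 - p, and the Mills bound reduces the claim to 2 log 2 · φ(κ)(κ + κ³) < p². The
left side decreases for κ ≥ 9/5, so only the values at 9/5 matter. -/
lemma capGap_large_pos {κ : ℝ} (h : 9 / 5 ≤ κ) : 0 < capGap κ := by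
  have hk : 0 < κ := by linarith
  have hp := boxMass_pos hk
  have hg := gphi_pos κ
  let f : ℝ → ℝ := fun x => gphi x * (x + x ^ 3)
  have hf : ∀ x, HasDerivAt f (gphi x * (1 + 2 * x ^ 2 - x ^ 4)) x := by
    intro x
    refine HasDerivAt.congr_deriv
      ((hasDerivAt_gphi x).mul ((hasDerivAt_id x).add (hasDerivAt_pow 3 x))) ?_
    norm_num; ring
  have hanti : AntitoneOn f (Set.Ici (9 / 5)) := by
    refine antitoneOn_of_hasDerivWithinAt_nonpos (convex_Ici _)
      (fun x _ => (hf x).continuousAt.continuousWithinAt)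
      (fun x _ => (hf x).hasDerivWithinAt) fun x hx => ?_
    have hx' : 9 / 5 ≤ x := interior_subset hx
    have : 3.24 ≤ x ^ 2 := by nlinarith
    exact mul_nonpos_of_nonneg_of_nonpos (gphi_pos x).le (by nlinarith)
  have hfk := hanti (Set.mem_Ici.2 le_rfl) (Set.mem_Ici.2 h) h
  have hpi1 := Real.pi_gt_d6
  have hpi2 := Real.pi_lt_d6
  have he1 : Real.exp 3.24 ≤ 25.54 := by
    rw [show (3.24 : ℝ) = 1 + 1 + 1 + 0.24 by norm_num, Real.exp_add, Real.exp_add, Real.exp_add]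
    have a := Real.exp_one_lt_d9
    have b : Real.exp 0.24 ≤ 1.2713 := by
      have := Real.exp_bound' (x := 0.24) (by norm_num) (by norm_num) (n := 5) (by norm_num)
      refine this.trans ?_
      norm_num [Finset.sum_range_succ, Nat.factorial]
    calc _ ≤ 2.7182818286 * 2.7182818286 * 2.7182818286 * (1.2713 : ℝ) := by gcongr
      _ ≤ _ := by norm_num
  have he2 : 25.53 ≤ Real.exp 3.24 := by
    refine le_trans ?_ (Real.sum_le_exp_of_nonneg (by norm_num) 14)
    norm_num [Finset.sum_range_succ, Nat.factorial]
  have hs : gphi (9 / 5) ^ 2 = 1 / (Real.exp 3.24 * (2 * Real.pi)) := by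
    rw [gphi_sq, show (-(9 / 5) ^ 2 : ℝ) = -3.24 by norm_num, Real.exp_neg]; field_simp
  have hg1 : 0.0789 ≤ gphi (9 / 5) := by
    refine le_of_sq_le_sq ?_ (gphi_pos _).le
    rw [hs, le_div_iff₀ (by positivity)]
    nlinarith
  have hg2 : gphi (9 / 5) ≤ 0.079 := by
    refine le_of_sq_le_sq ?_ (by norm_num)
    rw [hs, div_le_iff₀ (by positivity)]
    nlinarith
  have hp1 : 0.924 ≤ boxMass κ := by
    refine le_trans ?_ (boxMass_mono (by norm_num) h)
    refine le_trans ?_ (le_boxMass (by norm_num))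
    have : 3.254 ≤ dfSeries ((9 / 5) ^ 2) := by norm_num [dfSeries]
    nlinarith
  have hm := mills_le (κ := κ)
  have hl := Real.log_le_sub_one_of_pos hp
  obtain ⟨hl1, hl2⟩ := log_two_bounds
  have key : Real.log 2 * (2 * gphi κ * κ / boxMass κ) ^ 2 < 2 * gphi κ * κ / (1 + κ ^ 2) := by
    rw [div_pow, ← mul_div_assoc, div_lt_div_iff₀ (by positivity) (by positivity)]
    have h1 : gphi κ * (κ + κ ^ 3) ≤ 0.603 := by
      refine hfk.trans ?_
      simp only [f]
      nlinarith
    have h2 : 0.853 ≤ boxMass κ ^ 2 := by nlinarith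
    have h3 : Real.log 2 * (2 * (gphi κ * (κ + κ ^ 3))) < boxMass κ ^ 2 := by
      have : 0 < gphi κ * (κ + κ ^ 3) := by positivity
      nlinarith
    have h4 : 0 < 2 * gphi κ * κ := by positivity
    calc _ = 2 * gphi κ * κ * (Real.log 2 * (2 * (gphi κ * (κ + κ ^ 3)))) := by ring
      _ < _ := mul_lt_mul_of_pos_left h3 h4
  rw [capGap]
  linarith

/-- The gap decreases up to κ² = 1.89 and increases from κ² = 1.9 to κ = 9/5, so on these ranges it
is minimised at the edges of the middle window. -/
theorem capGap_pos {κ : ℝ} (hκ : 0 < κ) : 0 < capGap κ := by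
  have hab : √(189 / 100 : ℝ) ≤ √(19 / 10) := Real.sqrt_le_sqrt (by norm_num)
  have hb2 : √(19 / 10 : ℝ) ≤ 9 / 5 := (Real.sqrt_le_left (by norm_num)).2 (by norm_num)
  rcases le_total κ (√(189 / 100)) with h | h
  · exact (capGap_middle_pos le_rfl hab).trans_le
      (capGap_antitoneOn ⟨hκ, h⟩ ⟨by positivity, le_rfl⟩ h)
  rcases le_total κ (√(19 / 10)) with h' | h'
  · exact capGap_middle_pos h h'
  rcases le_total κ (9 / 5) with h'' | h''
  · exact (capGap_middle_pos hab le_rfl).trans_le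
      (capGap_monotoneOn ⟨le_rfl, hb2⟩ ⟨h', h''⟩ h')
  · exact capGap_large_pos h''

/-! ### One- and two-dimensional projections of the standard Gaussian -/

section Projections

variable {E : Type*} [NormedAddCommGroup E] [InnerProductSpace ℝ E] [FiniteDimensional ℝ E]
  [MeasurableSpace E] [BorelSpace E]

lemma map_inner_stdGaussian {u : E} (hu : ‖u‖ = 1) :
    (stdGaussian E).map (fun x => ⟪u, x⟫) = gaussianReal 0 1 := by
  apply Measure.ext_of_charFun
  ext t
  rw [charFun_apply_real, integral_map (by fun_prop) (by fun_prop), charFun_gaussianReal]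
  have := charFun_stdGaussian (E := E) (t • u)
  rw [charFun_apply] at this
  simp only [real_inner_smul_right, norm_smul, hu, mul_one, Real.norm_eq_abs] at this
  simp only [real_inner_comm] at this ⊢
  push_cast at this
  rw [this]
  congr 1
  rw [← Complex.ofReal_pow, sq_abs]; push_cast; ring

/-- The characteristic functions agree. The matrix is the Gram matrix of u and w, whose quadratic
form ‖au + bw‖² yields both positive semidefiniteness and the exponent. This lets q be computed with
vertices of the cube as well as with plane vectors. -/
lemma map_inner_pair_stdGaussian {u w : E} {ρ : ℝ} (hu : ‖u‖ = 1) (hw : ‖w‖ = 1)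
    (h : ⟪u, w⟫ = ρ) :
    (stdGaussian E).map (fun x => (!₂[⟪u, x⟫, ⟪w, x⟫] : EuclideanSpace ℝ (Fin 2))) =
      multivariateGaussian 0 !![1, ρ; ρ, 1] := by
  have hquad : ∀ a b : ℝ, ‖a • u + b • w‖ ^ 2 = a ^ 2 + 2 * ρ * a * b + b ^ 2 := by
    intro a b
    rw [norm_add_sq_real, norm_smul, norm_smul, hu, hw, real_inner_smul_left,
      real_inner_smul_right, h, mul_one, mul_one, Real.norm_eq_abs, Real.norm_eq_abs, sq_abs,
      sq_abs]
    ring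
  have hpsd : (!![1, ρ; ρ, 1] : Matrix (Fin 2) (Fin 2) ℝ).PosSemidef := by
    refine Matrix.PosSemidef.of_dotProduct_mulVec_nonneg ?_ fun x => ?_
    · ext i j; fin_cases i <;> fin_cases j <;> simp
    · have := hquad (x 0) (x 1)
      have h0 := sq_nonneg ‖x 0 • u + x 1 • w‖
      simp [Matrix.mulVec, dotProduct, Fin.sum_univ_two]
      nlinarith
  have hmeas : Measurable (fun x : E => (!₂[⟪u, x⟫, ⟪w, x⟫] : EuclideanSpace ℝ (Fin 2))) := by
    refine (WithLp.measurable_toLp 2 _).comp ?_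
    refine measurable_pi_lambda _ fun i => ?_
    fin_cases i <;> simp <;> fun_prop
  have : IsProbabilityMeasure ((stdGaussian E).map
      (fun x => (!₂[⟪u, x⟫, ⟪w, x⟫] : EuclideanSpace ℝ (Fin 2)))) :=
    Measure.isProbabilityMeasure_map hmeas.aemeasurable
  apply Measure.ext_of_charFun
  ext t
  rw [charFun_multivariateGaussian hpsd, charFun_apply,
    integral_map hmeas.aemeasurable (by fun_prop)]
  have e := charFun_stdGaussian (E := E) (t 0 • u + t 1 • w)
  rw [charFun_apply] at e
  have e2 : ∀ x : E, ⟪(!₂[⟪u, x⟫, ⟪w, x⟫] : EuclideanSpace ℝ (Fin 2)), t⟫ =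
      ⟪x, t 0 • u + t 1 • w⟫ := by
    intro x
    rw [PiLp.inner_apply, Fin.sum_univ_two, inner_add_right, real_inner_smul_right,
      real_inner_smul_right, real_inner_comm u x, real_inner_comm w x]
    simp
  simp only [e2]
  rw [e]
  congr 1
  rw [← Complex.ofReal_pow, hquad]
  simp [Matrix.mulVec, dotProduct, Fin.sum_univ_two]
  ring

lemma measurableSet_abs_inner_le (u : E) (κ : ℝ) : MeasurableSet {x : E | |⟪u, x⟫| ≤ κ} :=
  measurableSet_le (by fun_prop) (by fun_prop)

lemma p_eq_stdGaussian (κ : ℝ) {u : E} (hu : ‖u‖ = 1) :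
    p κ = (stdGaussian E).real {x | |⟪u, x⟫| ≤ κ} := by
  rw [p, ← map_inner_stdGaussian hu, map_measureReal_apply (by fun_prop)
    (measurableSet_le (by fun_prop) (by fun_prop))]
  rfl

lemma q_eq_stdGaussian (κ : ℝ) {β : ℝ} {u w : E} (hu : ‖u‖ = 1) (hw : ‖w‖ = 1)
    (h : ⟪u, w⟫ = 2 * β - 1) :
    q κ β = (stdGaussian E).real ({x | |⟪u, x⟫| ≤ κ} ∩ {x | |⟪w, x⟫| ≤ κ}) := by
  have hmeas : Measurable (fun x : E => (!₂[⟪u, x⟫, ⟪w, x⟫] : EuclideanSpace ℝ (Fin 2))) := by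
    refine (WithLp.measurable_toLp 2 _).comp ?_
    refine measurable_pi_lambda _ fun i => ?_
    fin_cases i <;> simp <;> fun_prop
  rw [q, ← map_inner_pair_stdGaussian hu hw h, map_measureReal_apply hmeas]
  · congr 1
  · exact MeasurableSet.inter (s₁ := {z : EuclideanSpace ℝ (Fin 2) | |z 0| ≤ κ})
      (s₂ := {z : EuclideanSpace ℝ (Fin 2) | |z 1| ≤ κ})
      (measurableSet_le (by fun_prop) (by fun_prop)) (measurableSet_le (by fun_prop) (by fun_prop))

end Projections

lemma p_eq_boxMass {κ : ℝ} (hκ : 0 ≤ κ) : p κ = boxMass κ := by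
  rw [p, Measure.real, gaussianReal_apply_eq_integral 0 one_ne_zero,
    ENNReal.toReal_ofReal (integral_nonneg fun x => gaussianPDFReal_nonneg _ _ _), boxMass,
    intervalIntegral.integral_of_le (by linarith), ← integral_Icc_eq_integral_Ioc, gphi_eq]
  congr 2
  ext x
  simp [abs_le]

/-- A unit vector of the plane at angle cosine `ρ` from the first axis. -/
noncomputable def tilted (ρ : ℝ) : EuclideanSpace ℝ (Fin 2) := !₂[ρ, √(1 - ρ ^ 2)]

lemma norm_tilted {ρ : ℝ} (h : |ρ| ≤ 1) : ‖tilted ρ‖ = 1 := by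
  have : 0 ≤ 1 - ρ ^ 2 := by have := (sq_le_one_iff_abs_le_one ρ).2 h; linarith
  rw [EuclideanSpace.norm_eq, Fin.sum_univ_two]
  simp [tilted, Real.sq_sqrt this]

lemma inner_tilted_one (ρ : ℝ) : ⟪tilted 1, tilted ρ⟫ = ρ := by
  simp [tilted, PiLp.inner_apply, Fin.sum_univ_two]

lemma q_tilted (κ : ℝ) {ρ : ℝ} (h : |ρ| ≤ 1) :
    q κ ((1 + ρ) / 2) = (stdGaussian (EuclideanSpace ℝ (Fin 2))).real
      ({x | |⟪tilted 1, x⟫| ≤ κ} ∩ {x | |⟪tilted ρ, x⟫| ≤ κ}) :=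
  q_eq_stdGaussian κ (norm_tilted (by simp)) (norm_tilted h) (by rw [inner_tilted_one]; ring)

/-- Replacing the second vector by its negative flips the correlation and leaves its symmetric slab
unchanged. -/
lemma q_one_sub (κ : ℝ) {β : ℝ} (h0 : 0 ≤ β) (h1 : β ≤ 1) : q κ (1 - β) = q κ β := by
  have hρ : |2 * β - 1| ≤ 1 := abs_le.2 ⟨by linarith, by linarith⟩
  have e1 := q_tilted κ hρ
  have e2 := q_eq_stdGaussian κ (β := 1 - β) (u := tilted 1) (w := -tilted (2 * β - 1))
    (norm_tilted (by simp)) (by rw [norm_neg, norm_tilted hρ])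
    (by rw [inner_neg_right, inner_tilted_one]; ring)
  rw [show (1 + (2 * β - 1)) / 2 = β by ring] at e1
  rw [e1, e2]
  simp only [inner_neg_left, abs_neg]

lemma q_le_p (κ : ℝ) {β : ℝ} (h0 : 0 ≤ β) (h1 : β ≤ 1) : q κ β ≤ p κ := by
  have hρ : |2 * β - 1| ≤ 1 := abs_le.2 ⟨by linarith, by linarith⟩
  have e1 := q_tilted κ hρ
  rw [show (1 + (2 * β - 1)) / 2 = β by ring] at e1
  rw [e1, p_eq_stdGaussian κ (u := tilted 1) (norm_tilted (by simp))]
  exact measureReal_mono Set.inter_subset_left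

lemma q_one (κ : ℝ) : q κ 1 = p κ := by
  have e1 := q_tilted κ (ρ := 1) (by simp)
  rw [show (1 + 1 : ℝ) / 2 = 1 by norm_num] at e1
  rw [e1, p_eq_stdGaussian κ (u := tilted 1) (norm_tilted (by simp)), Set.inter_self]

lemma q_zero (κ : ℝ) : q κ 0 = p κ := by
  rw [← q_one, ← q_one_sub κ le_rfl zero_le_one, sub_zero]

/-! ### The correlated box probability and its derivative in the correlation -/

/-- An antiderivative of the Gaussian density. -/
noncomputable def gcdf (y : ℝ) : ℝ := ∫ x in (0 : ℝ)..y, gphi x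

lemma hasDerivAt_gcdf (y : ℝ) : HasDerivAt gcdf (gphi y) y :=
  intervalIntegral.integral_hasDerivAt_right (continuous_gphi.intervalIntegrable _ _)
    (continuous_gphi.stronglyMeasurableAtFilter _ _) continuous_gphi.continuousAt

lemma continuous_gcdf : Continuous gcdf :=
  continuous_iff_continuousAt.2 fun y => (hasDerivAt_gcdf y).continuousAt

lemma gaussianReal_Icc {a b : ℝ} (h : a ≤ b) :
    gaussianReal 0 1 (Set.Icc a b) = ENNReal.ofReal (gcdf b - gcdf a) := by
  rw [gaussianReal_apply_eq_integral 0 one_ne_zero, integral_Icc_eq_integral_Ioc,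
    ← intervalIntegral.integral_of_le h, ← gphi_eq, gcdf, gcdf,
    intervalIntegral.integral_interval_sub_left] <;>
      exact continuous_gphi.intervalIntegrable _ _

/-- The correlated box probability as an explicit integral. -/
noncomputable def boxCorr (κ ρ : ℝ) : ℝ :=
  ∫ x in -κ..κ, gphi x *
    (gcdf ((κ - ρ * x) / √(1 - ρ ^ 2)) - gcdf ((-κ - ρ * x) / √(1 - ρ ^ 2)))

lemma gcdf_mono {a b : ℝ} (h : a ≤ b) : gcdf a ≤ gcdf b :=
  monotone_of_hasDerivAt_nonneg hasDerivAt_gcdf (fun x => (gphi_pos x).le) h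

/-- Fubini, with the second coordinate written as ρx + sy for independent x, y and s² = 1 - ρ². For
fixed x the constraint on y is an interval, and |ρ| < 1 is what permits dividing by s. -/
lemma q_eq_boxCorr {κ ρ : ℝ} (hκ : 0 ≤ κ) (h : |ρ| < 1) : q κ ((1 + ρ) / 2) = boxCorr κ ρ := by
  have hs : 0 < √(1 - ρ ^ 2) := Real.sqrt_pos.2 (by
    have := (sq_lt_one_iff_abs_lt_one ρ).2 h; linarith)
  rw [q_tilted κ h.le]
  set s := √(1 - ρ ^ 2) with hsdef
  have hms : MeasurableSet ({x : EuclideanSpace ℝ (Fin 2) | |⟪tilted 1, x⟫| ≤ κ} ∩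
      {x | |⟪tilted ρ, x⟫| ≤ κ}) :=
    (measurableSet_abs_inner_le _ _).inter (measurableSet_abs_inner_le _ _)
  have hmp := (measurePreserving_finTwoArrow (gaussianReal 0 1)).symm
  have hset : MeasurableSet {z : ℝ × ℝ | |z.1| ≤ κ ∧ |ρ * z.1 + s * z.2| ≤ κ} :=
    MeasurableSet.inter (s₁ := {z : ℝ × ℝ | |z.1| ≤ κ})
      (s₂ := {z : ℝ × ℝ | |ρ * z.1 + s * z.2| ≤ κ})
      (measurableSet_le (by fun_prop) (by fun_prop)) (measurableSet_le (by fun_prop) (by fun_prop))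
  have e : stdGaussian (EuclideanSpace ℝ (Fin 2)) ({x | |⟪tilted 1, x⟫| ≤ κ} ∩
      {x | |⟪tilted ρ, x⟫| ≤ κ}) =
      ((gaussianReal 0 1).prod (gaussianReal 0 1))
        {z : ℝ × ℝ | |z.1| ≤ κ ∧ |ρ * z.1 + s * z.2| ≤ κ} := by
    rw [← map_pi_eq_stdGaussian, Measure.map_apply (by fun_prop) hms, ← hmp.map_eq,
      Measure.map_apply hmp.measurable ((WithLp.measurable_toLp 2 _) hms)]
    congr 1
    ext z
    simp [tilted, PiLp.inner_apply, Fin.sum_univ_two, MeasurableEquiv.finTwoArrow, ← hsdef,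
      mul_comm]
  have hpos : ∀ x, 0 ≤ gcdf ((κ - ρ * x) / s) - gcdf ((-κ - ρ * x) / s) := fun x =>
    sub_nonneg.2 (gcdf_mono (by gcongr; linarith))
  have hcont' : Continuous fun x => gcdf ((κ - ρ * x) / s) - gcdf ((-κ - ρ * x) / s) :=
    (continuous_gcdf.comp (by fun_prop)).sub (continuous_gcdf.comp (by fun_prop))
  have hcont : Continuous fun x => gphi x * (gcdf ((κ - ρ * x) / s) - gcdf ((-κ - ρ * x) / s)) :=
    continuous_gphi.mul hcont'
  have hslice : ∀ x : ℝ, gaussianReal 0 1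
      (Prod.mk x ⁻¹' {z : ℝ × ℝ | |z.1| ≤ κ ∧ |ρ * z.1 + s * z.2| ≤ κ}) =
      Set.indicator (Set.Icc (-κ) κ)
        (fun x => ENNReal.ofReal (gcdf ((κ - ρ * x) / s) - gcdf ((-κ - ρ * x) / s))) x := by
    intro x
    by_cases hx : x ∈ Set.Icc (-κ) κ
    · rw [Set.indicator_of_mem hx, ← gaussianReal_Icc (by gcongr; linarith)]
      congr 1
      ext y
      simp only [Set.mem_preimage, Set.mem_ofPred_eq, Set.mem_Icc, abs_le, div_le_iff₀ hs,
        le_div_iff₀ hs]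
      constructor
      · rintro ⟨-, h1, h2⟩; constructor <;> linarith
      · rintro ⟨h1, h2⟩; exact ⟨hx, by linarith, by linarith⟩
    · rw [Set.indicator_of_notMem hx]
      convert measure_empty (μ := gaussianReal 0 1)
      ext y
      simp only [Set.mem_preimage, Set.mem_ofPred_eq, abs_le, Set.mem_empty_iff_false, iff_false]
      exact fun h => hx h.1
  rw [Measure.real, e, Measure.prod_apply hset]
  simp only [hslice]
  rw [lintegral_indicator measurableSet_Icc, gaussianReal_of_var_ne_zero 0 one_ne_zero,
    restrict_withDensity measurableSet_Icc, lintegral_withDensity_eq_lintegral_mul₀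
      (measurable_gaussianPDF 0 1).aemeasurable
      hcont'.measurable.ennreal_ofReal.aemeasurable]
  rw [boxCorr, intervalIntegral.integral_of_le (by linarith), ← integral_Icc_eq_integral_Ioc,
    integral_eq_lintegral_of_nonneg_ae
      (Eventually.of_forall fun x => mul_nonneg (gphi_pos x).le (hpos x))
      hcont.aestronglyMeasurable]
  congr 1
  refine lintegral_congr fun x => ?_
  rw [Pi.mul_apply, gaussianPDF, ← gphi_eq, ← ENNReal.ofReal_mul (gphi_pos x).le]

lemma q_half {κ : ℝ} (hκ : 0 ≤ κ) : q κ (1 / 2) = p κ ^ 2 := by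
  have := q_eq_boxCorr (ρ := 0) hκ (by simp)
  rw [show (1 + 0 : ℝ) / 2 = 1 / 2 by norm_num] at this
  rw [this, p_eq_boxMass hκ, boxCorr]
  have e : gcdf κ - gcdf (-κ) = boxMass κ := by
    rw [gcdf, gcdf, boxMass, intervalIntegral.integral_interval_sub_left] <;>
      exact continuous_gphi.intervalIntegrable _ _
  simp [e]
  rw [← boxMass, sq]

/-- The derivative in the correlation of the correlated box probability (Plackett's identity). -/
noncomputable def boxCorrDeriv (κ ρ : ℝ) : ℝ :=
  (Real.exp (-κ ^ 2 / (1 + ρ)) - Real.exp (-κ ^ 2 / (1 - ρ))) / (Real.pi * √(1 - ρ ^ 2))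

lemma one_sub_sq_pos {ρ : ℝ} (h : |ρ| < 1) : 0 < 1 - ρ ^ 2 := by
  have := (sq_lt_one_iff_abs_lt_one ρ).2 h; linarith

lemma gphi_le_one (x : ℝ) : gphi x ≤ 1 := by
  unfold gphi
  have h1 : Real.exp (-x ^ 2 / 2) ≤ 1 := Real.exp_le_one_iff.2 (by nlinarith [sq_nonneg x])
  have h2 : (√(2 * Real.pi))⁻¹ ≤ 1 := inv_le_one_of_one_le₀
    (Real.one_le_sqrt.2 (by nlinarith [Real.pi_gt_three]))
  exact mul_le_one₀ h2 (Real.exp_pos _).le h1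

lemma gphi_mul (a b : ℝ) :
    gphi a * gphi b = (2 * Real.pi)⁻¹ * Real.exp (-(a ^ 2 + b ^ 2) / 2) := by
  have hpi := Real.pi_pos
  rw [gphi, gphi, mul_mul_mul_comm, ← Real.exp_add, ← mul_inv, Real.mul_self_sqrt (by positivity)]
  congr 2; ring

lemma hasDerivAt_affine_div_sqrt {ρ : ℝ} (h : |ρ| < 1) (c x : ℝ) :
    HasDerivAt (fun ρ => (c - ρ * x) / √(1 - ρ ^ 2)) ((c * ρ - x) / √(1 - ρ ^ 2) ^ 3) ρ := by
  have hp := one_sub_sq_pos h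
  have hs : 0 < √(1 - ρ ^ 2) := Real.sqrt_pos.2 hp
  have h1 : HasDerivAt (fun ρ : ℝ => 1 - ρ ^ 2) (-(2 * ρ)) ρ := by
    refine HasDerivAt.congr_deriv ((hasDerivAt_pow 2 ρ).const_sub 1) ?_
    norm_num
  have h2 := h1.sqrt hp.ne'
  have h3 : HasDerivAt (fun ρ : ℝ => c - ρ * x) (-x) ρ := by
    refine HasDerivAt.congr_deriv (((hasDerivAt_id ρ).mul_const x).const_sub c) ?_
    simp
  refine HasDerivAt.congr_deriv (h3.div h2 hs.ne') ?_
  have hsq : √(1 - ρ ^ 2) ^ 2 = 1 - ρ ^ 2 := Real.sq_sqrt hp.le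
  field_simp
  rw [hsq]; ring

/-- Both sides are s times the bivariate density with correlation ρ at (x, c), which is symmetric in
its arguments. -/
lemma gphi_rotate {ρ s : ℝ} (hs : 0 < s) (hsq : s ^ 2 = 1 - ρ ^ 2) (c x : ℝ) :
    gphi x * gphi ((c - ρ * x) / s) = gphi c * gphi ((x - ρ * c) / s) := by
  rw [gphi_mul, gphi_mul]
  congr 2
  rw [div_pow, div_pow, hsq]
  have : 1 - ρ ^ 2 ≠ 0 := by rw [← hsq]; positivity
  field_simp
  ring

/-- Once `gphi_rotate` exchanges the roles of x and c, the integrand is an exact derivative in x.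
Only corner values of the density remain. -/
lemma integral_rotated {ρ s : ℝ} (hs : 0 < s) (hsq : s ^ 2 = 1 - ρ ^ 2) (c a b : ℝ) :
    ∫ x in a..b, gphi x * (gphi ((c - ρ * x) / s) * ((c * ρ - x) / s ^ 3)) =
      gphi c * (gphi ((b - ρ * c) / s) - gphi ((a - ρ * c) / s)) / s := by
  have hd : ∀ x : ℝ, HasDerivAt (fun x => gphi c * gphi ((x - ρ * c) / s) / s)
      (gphi x * (gphi ((c - ρ * x) / s) * ((c * ρ - x) / s ^ 3))) x := by
    intro x
    have h1 : HasDerivAt (fun x : ℝ => (x - ρ * c) / s) (1 / s) x :=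
      ((hasDerivAt_id x).sub_const _).div_const _
    have h2 : HasDerivAt (fun x => gphi ((x - ρ * c) / s))
        (-((x - ρ * c) / s) * gphi ((x - ρ * c) / s) * (1 / s)) x :=
      (hasDerivAt_gphi _).comp x h1
    refine HasDerivAt.congr_deriv ((h2.const_mul (gphi c)).div_const s) ?_
    rw [← mul_assoc (gphi x), gphi_rotate hs hsq]
    generalize gphi ((x - ρ * c) / s) = y
    field_simp
    ring
  rw [intervalIntegral.integral_eq_sub_of_hasDerivAt (fun x _ => hd x)]
  · ring
  · refine Continuous.intervalIntegrable ?_ _ _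
    exact continuous_gphi.mul ((continuous_gphi.comp (by fun_prop)).mul (by fun_prop))

/-- Differentiation under the integral, dominated on |y| < r < 1, where the square root stays away
from 0. The four corner densities pair up into the two exponentials. -/
lemma hasDerivAt_boxCorr {κ ρ : ℝ} (hκ : 0 < κ) (h : |ρ| < 1) :
    HasDerivAt (boxCorr κ) (boxCorrDeriv κ ρ) ρ := by
  let F' : ℝ → ℝ → ℝ := fun ρ x => gphi x *
    (gphi ((κ - ρ * x) / √(1 - ρ ^ 2)) * ((κ * ρ - x) / √(1 - ρ ^ 2) ^ 3)
      - gphi ((-κ - ρ * x) / √(1 - ρ ^ 2)) * ((-κ * ρ - x) / √(1 - ρ ^ 2) ^ 3))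
  obtain ⟨r, hr, hr1⟩ := exists_between h
  have hr0 : 0 < r := (abs_nonneg ρ).trans_lt hr
  have hs : {y : ℝ | |y| < r} ∈ 𝓝 ρ :=
    (isOpen_lt continuous_abs continuous_const).mem_nhds hr
  have hcF : ∀ y, Continuous fun x => gphi x *
      (gcdf ((κ - y * x) / √(1 - y ^ 2)) - gcdf ((-κ - y * x) / √(1 - y ^ 2))) := fun y =>
    continuous_gphi.mul ((continuous_gcdf.comp (by fun_prop)).sub
      (continuous_gcdf.comp (by fun_prop)))
  have hcF' : Continuous (F' ρ) :=
    continuous_gphi.mul (((continuous_gphi.comp (by fun_prop)).mul (by fun_prop)).sub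
      ((continuous_gphi.comp (by fun_prop)).mul (by fun_prop)))
  have hr2 : 0 < 1 - r ^ 2 := by nlinarith
  have key := intervalIntegral.hasDerivAt_integral_of_dominated_loc_of_deriv_le
    (F := fun y x => gphi x *
      (gcdf ((κ - y * x) / √(1 - y ^ 2)) - gcdf ((-κ - y * x) / √(1 - y ^ 2))))
    (F' := F') (x₀ := ρ) (a := -κ) (b := κ) (μ := volume)
    (bound := fun _ => 4 * κ / √(1 - r ^ 2) ^ 3) hs
    (Eventually.of_forall fun y => (hcF y).aestronglyMeasurable)
    ((hcF ρ).intervalIntegrable _ _) hcF'.aestronglyMeasurable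
    (Eventually.of_forall fun x hx y hy => ?_) (continuous_const.intervalIntegrable _ _)
    (Eventually.of_forall fun x hx y hy => ?_)
  · refine HasDerivAt.congr_deriv key.2 ?_
    have hp := one_sub_sq_pos h
    have hs' : 0 < √(1 - ρ ^ 2) := Real.sqrt_pos.2 hp
    have hsq : √(1 - ρ ^ 2) ^ 2 = 1 - ρ ^ 2 := Real.sq_sqrt hp.le
    have hb := abs_lt.1 h
    simp only [F', mul_sub]
    rw [intervalIntegral.integral_sub, integral_rotated hs' hsq, integral_rotated hs' hsq]
    · rw [show (-κ - ρ * κ) / √(1 - ρ ^ 2) = -((κ + ρ * κ) / √(1 - ρ ^ 2)) by ring,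
        show (-κ - ρ * -κ) / √(1 - ρ ^ 2) = -((κ - ρ * κ) / √(1 - ρ ^ 2)) by ring,
        show (κ - ρ * -κ) / √(1 - ρ ^ 2) = ((κ + ρ * κ) / √(1 - ρ ^ 2)) by ring,
        gphi_neg, gphi_neg, gphi_neg, mul_sub, mul_sub, gphi_mul, gphi_mul, div_pow, div_pow, hsq,
        boxCorrDeriv]
      have e1 : -(κ ^ 2 + (κ - ρ * κ) ^ 2 / (1 - ρ ^ 2)) / 2 = -κ ^ 2 / (1 + ρ) := by
        have : 1 + ρ ≠ 0 := by linarith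
        field_simp
        ring
      have e2 : -(κ ^ 2 + (κ + ρ * κ) ^ 2 / (1 - ρ ^ 2)) / 2 = -κ ^ 2 / (1 - ρ) := by
        have : 1 - ρ ≠ 0 := by linarith
        field_simp
        ring
      rw [e1, e2]
      have := Real.pi_pos
      field_simp
      ring
    all_goals
      refine Continuous.intervalIntegrable ?_ _ _
      exact continuous_gphi.mul ((continuous_gphi.comp (by fun_prop)).mul (by fun_prop))
  · have hx' : |x| ≤ κ := by
      rw [Set.uIoc_of_le (by linarith)] at hx
      exact abs_le.2 ⟨hx.1.le, hx.2⟩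
    have hy' : |y| < r := hy
    have hyr : y ^ 2 ≤ r ^ 2 := by
      rw [← sq_abs y]; exact pow_le_pow_left₀ (abs_nonneg _) hy'.le 2
    have hss : √(1 - r ^ 2) ≤ √(1 - y ^ 2) := Real.sqrt_le_sqrt (by linarith)
    have hsr : 0 < √(1 - r ^ 2) := Real.sqrt_pos.2 hr2
    have hsy := hsr.trans_le hss
    have hb : ∀ c z : ℝ, |c| = κ → ‖gphi z * ((c * y - x) / √(1 - y ^ 2) ^ 3)‖ ≤
        2 * κ / √(1 - r ^ 2) ^ 3 := by
      intro c z hc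
      rw [norm_mul, norm_div, Real.norm_of_nonneg (gphi_pos z).le,
        Real.norm_of_nonneg (pow_nonneg hsy.le 3)]
      have h1 : ‖c * y - x‖ ≤ 2 * κ := by
        refine (norm_sub_le _ _).trans ?_
        rw [norm_mul, Real.norm_eq_abs, Real.norm_eq_abs, Real.norm_eq_abs, hc]
        nlinarith
      calc _ ≤ 1 * (2 * κ / √(1 - r ^ 2) ^ 3) := by
            refine mul_le_mul (gphi_le_one z) ?_ (by positivity) zero_le_one
            gcongr
        _ = _ := one_mul _
    have h1 := hb κ ((κ - y * x) / √(1 - y ^ 2)) (abs_of_pos hκ)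
    have h2 := hb (-κ) ((-κ - y * x) / √(1 - y ^ 2)) (by rw [abs_neg, abs_of_pos hκ])
    rw [norm_mul, Real.norm_of_nonneg (gphi_pos x).le]
    calc _ ≤ 1 * (2 * κ / √(1 - r ^ 2) ^ 3 + 2 * κ / √(1 - r ^ 2) ^ 3) :=
          mul_le_mul (gphi_le_one x) ((norm_sub_le _ _).trans (add_le_add h1 h2))
            (norm_nonneg _) zero_le_one
      _ = _ := by ring
  · have hy' : |y| < 1 := lt_trans hy hr1
    exact (((hasDerivAt_gcdf _).comp y (hasDerivAt_affine_div_sqrt hy' κ x)).sub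
      ((hasDerivAt_gcdf _).comp y (hasDerivAt_affine_div_sqrt hy' (-κ) x))).const_mul _

/-- The curvature `q''(0)` in the correlation is `4 κ² φ(κ)²`. -/
lemma hasDerivAt_boxCorrDeriv_zero (κ : ℝ) :
    HasDerivAt (boxCorrDeriv κ) (4 * κ ^ 2 * gphi κ ^ 2) 0 := by
  have hpi := Real.pi_pos
  have h1 : HasDerivAt (fun ρ : ℝ => Real.exp (-κ ^ 2 / (1 + ρ)))
      (Real.exp (-κ ^ 2) * κ ^ 2) 0 := by
    have a : HasDerivAt (fun ρ : ℝ => 1 + ρ) 1 0 := (hasDerivAt_id 0).const_add 1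
    have b := (((hasDerivAt_const (0 : ℝ) (-κ ^ 2)).div a (by norm_num)).exp)
    refine HasDerivAt.congr_deriv b ?_
    simp
  have h2 : HasDerivAt (fun ρ : ℝ => Real.exp (-κ ^ 2 / (1 - ρ)))
      (-(Real.exp (-κ ^ 2) * κ ^ 2)) 0 := by
    have a : HasDerivAt (fun ρ : ℝ => 1 - ρ) (-1) 0 := (hasDerivAt_id 0).const_sub 1
    have b := (((hasDerivAt_const (0 : ℝ) (-κ ^ 2)).div a (by norm_num)).exp)
    refine HasDerivAt.congr_deriv b ?_
    simp
  have h3 : HasDerivAt (fun ρ : ℝ => Real.pi * √(1 - ρ ^ 2)) 0 0 := by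
    have a : HasDerivAt (fun ρ : ℝ => 1 - ρ ^ 2) 0 0 := by
      refine HasDerivAt.congr_deriv ((hasDerivAt_pow 2 (0 : ℝ)).const_sub 1) ?_
      norm_num
    refine HasDerivAt.congr_deriv ((a.sqrt (by norm_num)).const_mul Real.pi) ?_
    simp
  refine HasDerivAt.congr_deriv ((h1.sub h2).div h3 (by simp [hpi.ne'])) ?_
  rw [gphi_sq]
  simp
  field_simp
  ring

/-! ### Bounds on q around independence -/

lemma p_pos {κ : ℝ} (hκ : 0 < κ) : 0 < p κ := by
  rw [p_eq_boxMass hκ.le]; exact boxMass_pos hκ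

lemma p_lt_one {κ : ℝ} (hκ : 0 < κ) : p κ < 1 := by
  rw [p_eq_boxMass hκ.le]; exact boxMass_lt_one hκ.le

lemma boxCorr_zero {κ : ℝ} (hκ : 0 < κ) : boxCorr κ 0 = p κ ^ 2 := by
  rw [← q_eq_boxCorr hκ.le (by simp), ← q_half hκ.le]; norm_num

lemma boxCorrDeriv_nonneg (κ : ℝ) {ρ : ℝ} (h0 : 0 ≤ ρ) (h1 : ρ < 1) : 0 ≤ boxCorrDeriv κ ρ := by
  unfold boxCorrDeriv
  refine div_nonneg (sub_nonneg.2 (Real.exp_le_exp.2 ?_)) (by positivity)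
  rw [neg_div, neg_div, neg_le_neg_iff]
  exact div_le_div_of_nonneg_left (sq_nonneg κ) (by linarith) (by linarith)

lemma sq_le_q_of_half_le {κ β : ℝ} (hκ : 0 < κ) (h0 : 1 / 2 ≤ β) (h1 : β ≤ 1) :
    p κ ^ 2 ≤ q κ β := by
  rcases h1.eq_or_lt with rfl | h1
  · rw [q_one]; nlinarith [p_pos hκ, p_lt_one hκ]
  have hm : MonotoneOn (boxCorr κ) (Set.Ico 0 1) := by
    have habs : ∀ x ∈ Set.Ico (0 : ℝ) 1, |x| < 1 := fun x hx => by
      rw [abs_of_nonneg hx.1]; exact hx.2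
    exact monotoneOn_of_hasDerivWithinAt_nonneg (convex_Ico _ _)
      (fun x hx => (hasDerivAt_boxCorr hκ (habs x hx)).continuousAt.continuousWithinAt)
      (fun x hx => (hasDerivAt_boxCorr hκ (habs x (interior_subset hx))).hasDerivWithinAt)
      (fun x hx => boxCorrDeriv_nonneg κ (interior_subset hx).1 (interior_subset hx).2)
  have := hm (Set.left_mem_Ico.2 one_pos) (⟨by linarith, by linarith⟩ : 2 * β - 1 ∈ Set.Ico 0 1)
    (by linarith)
  rw [boxCorr_zero hκ, ← q_eq_boxCorr hκ.le (abs_lt.2 ⟨by linarith, by linarith⟩)] at this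
  rwa [show (1 + (2 * β - 1)) / 2 = β by ring] at this

/-- Correlation of either sign can only help, since the derivative in ρ is nonnegative for ρ ≥ 0 and
q is symmetric. It makes (q/p²)^t increasing in t, so that t may be replaced by αN. -/
lemma sq_le_q {κ β : ℝ} (hκ : 0 < κ) (h0 : 0 ≤ β) (h1 : β ≤ 1) : p κ ^ 2 ≤ q κ β := by
  rcases le_total (1 / 2) β with h | h
  · exact sq_le_q_of_half_le hκ h h1
  · rw [← q_one_sub κ h0 h1]; exact sq_le_q_of_half_le hκ (by linarith) (by linarith)

lemma q_pos {κ β : ℝ} (hκ : 0 < κ) (h0 : 0 ≤ β) (h1 : β ≤ 1) : 0 < q κ β :=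
  lt_of_lt_of_le (by have := p_pos hκ; positivity) (sq_le_q hκ h0 h1)

/-- Near zero correlation the box probability is quadratically close to its value there, with
any constant above half of the curvature. -/
lemma exists_q_sub_sq_le {κ : ℝ} (hκ : 0 < κ) {η : ℝ} (hη : 0 < η) :
    ∃ δ, 0 < δ ∧ δ < 1 ∧ ∀ β, |2 * β - 1| ≤ δ →
      q κ β - p κ ^ 2 ≤ (2 * κ ^ 2 * gphi κ ^ 2 + η) * (2 * β - 1) ^ 2 := by
  have h0 : boxCorrDeriv κ 0 = 0 := by simp [boxCorrDeriv]
  have h1 := (hasDerivAt_boxCorrDeriv_zero κ).isLittleO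
  have h2 := h1.def (c := 2 * η) (by positivity)
  obtain ⟨r, hr, hball⟩ := Metric.eventually_nhds_iff.1 h2
  refine ⟨min (r / 2) (1 / 2), by positivity, (min_le_right _ _).trans_lt (by norm_num), ?_⟩
  set δ := min (r / 2) (1 / 2) with hδ
  have hδr : δ < r := (min_le_left _ _).trans_lt (by linarith)
  have hδ1 : δ < 1 := (min_le_right _ _).trans_lt (by norm_num)
  have hd : ∀ x, 0 ≤ x → x ≤ δ → boxCorrDeriv κ x ≤ (4 * κ ^ 2 * gphi κ ^ 2 + 2 * η) * x := by
    intro x hx hxδ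
    have := hball (y := x) (by rw [Real.dist_eq, sub_zero, abs_of_nonneg hx]; linarith)
    rw [h0, sub_zero, sub_zero, smul_eq_mul, Real.norm_eq_abs, Real.norm_eq_abs,
      abs_of_nonneg hx] at this
    linarith [le_abs_self (boxCorrDeriv κ x - x * (4 * κ ^ 2 * gphi κ ^ 2))]
  have hpos : ∀ x, 0 ≤ x → x ≤ δ →
      boxCorr κ x - p κ ^ 2 ≤ (2 * κ ^ 2 * gphi κ ^ 2 + η) * x ^ 2 := by
    intro x hx hxδ
    let f : ℝ → ℝ := fun y => (2 * κ ^ 2 * gphi κ ^ 2 + η) * y ^ 2 - boxCorr κ y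
    have hf : ∀ y ∈ Set.Icc 0 δ, HasDerivAt f
        ((2 * κ ^ 2 * gphi κ ^ 2 + η) * (2 * y) - boxCorrDeriv κ y) y := by
      intro y hy
      refine HasDerivAt.congr_deriv (((hasDerivAt_pow 2 y).const_mul _).sub
        (hasDerivAt_boxCorr hκ (by rw [abs_of_nonneg hy.1]; linarith [hy.2]))) ?_
      norm_num
    have hm : MonotoneOn f (Set.Icc 0 δ) := monotoneOn_of_hasDerivWithinAt_nonneg (convex_Icc _ _)
      (fun y hy => (hf y hy).continuousAt.continuousWithinAt)
      (fun y hy => (hf y (interior_subset hy)).hasDerivWithinAt)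
      (fun y hy => by
        have := hd y (interior_subset hy).1 (interior_subset hy).2
        linarith)
    have := hm ⟨le_rfl, hx.trans hxδ⟩ ⟨hx, hxδ⟩ hx
    simp only [f, boxCorr_zero hκ] at this
    linarith
  intro β hβ
  have hb := abs_le.1 hβ
  rcases le_total 0 (2 * β - 1) with h | h
  · have := hpos _ h hb.2
    rwa [← q_eq_boxCorr hκ.le (by linarith), show (1 + (2 * β - 1)) / 2 = β by ring] at this
  · have := hpos (-(2 * β - 1)) (by linarith) (by linarith)
    rw [← q_eq_boxCorr hκ.le (by rw [abs_neg]; linarith),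
      show (1 + -(2 * β - 1)) / 2 = 1 - β by ring,
      q_one_sub κ (by linarith) (by linarith)] at this
    linarith [neg_sq (2 * β - 1)]

/-- The variance of one thinning step needs only some constant here, valid for all overlaps. Away
from 0 the bound q ≤ 1 is absorbed by 1/δ². -/
lemma exists_q_sub_sq_le_global {κ : ℝ} (hκ : 0 < κ) :
    ∃ C, 0 < C ∧ ∀ β, 0 ≤ β → β ≤ 1 → q κ β - p κ ^ 2 ≤ C * (2 * β - 1) ^ 2 := by
  obtain ⟨δ, hδ, -, h⟩ := exists_q_sub_sq_le hκ one_pos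
  refine ⟨(2 * κ ^ 2 * gphi κ ^ 2 + 1) + 1 / δ ^ 2, by positivity, fun β h0 h1 => ?_⟩
  rcases le_total |2 * β - 1| δ with hle | hle
  · refine (h β hle).trans (mul_le_mul_of_nonneg_right ?_ (sq_nonneg _))
    have : 0 < 1 / δ ^ 2 := by positivity
    linarith
  · have h2 : δ ^ 2 ≤ (2 * β - 1) ^ 2 := by
      rw [← sq_abs (2 * β - 1)]; exact pow_le_pow_left₀ hδ.le hle 2
    have h3 : 1 ≤ 1 / δ ^ 2 * (2 * β - 1) ^ 2 := by
      rw [div_mul_eq_mul_div, one_mul, one_le_div (by positivity)]; exact h2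
    have h4 : 0 ≤ (2 * κ ^ 2 * gphi κ ^ 2 + 1) * (2 * β - 1) ^ 2 := by positivity
    have := q_le_p κ h0 h1
    have := p_lt_one hκ
    nlinarith [sq_nonneg (p κ)]

/-! ### The function F: strict maximum at 1/2 -/

/-- The derivative of the entropy is minus the series of log((1+x)/(1-x)) at x = 2β - 1. For x ≥ 0
all terms are nonnegative, and keeping the first one suffices. -/
lemma binEntropy_le_sub_sq {β : ℝ} (h0 : 0 ≤ β) (h1 : β ≤ 1) :
    Real.binEntropy β ≤ Real.log 2 - (2 * β - 1) ^ 2 / 2 := by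
  have key : ∀ β : ℝ, 1 / 2 ≤ β → β ≤ 1 →
      Real.binEntropy β ≤ Real.log 2 - (2 * β - 1) ^ 2 / 2 := by
    intro β h0 h1
    let f : ℝ → ℝ := fun x => Real.log 2 - (2 * x - 1) ^ 2 / 2 - Real.binEntropy x
    have hm : MonotoneOn f (Set.Icc (1 / 2) 1) := by
      refine monotoneOn_of_hasDerivWithinAt_nonneg (convex_Icc _ _)
        (f' := fun x => -(2 * (2 * x - 1)) - (Real.log (1 - x) - Real.log x))
        (by
          have := Real.binEntropy_continuous
          exact Continuous.continuousOn (by fun_prop)) (fun x hx => ?_) (fun x hx => ?_)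
      all_goals
        rw [interior_Icc] at hx
        obtain ⟨hx1, hx2⟩ := hx
      · refine HasDerivAt.hasDerivWithinAt (HasDerivAt.congr_deriv
          ((((((hasDerivAt_id x).const_mul 2).sub_const 1).pow 2).div_const 2).const_sub
            (Real.log 2) |>.sub (Real.hasDerivAt_binEntropy (by linarith) (by linarith))) ?_)
        simp
      · have hs := Real.hasSum_log_sub_log_of_abs_lt_one (x := 2 * x - 1)
          (abs_lt.2 ⟨by linarith, by linarith⟩)
        have h3 := hs.summable.sum_le_tsum (Finset.range 1) (fun k _ => by
          have : 0 ≤ 2 * x - 1 := by linarith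
          positivity)
        rw [hs.tsum_eq] at h3
        rw [show 1 + (2 * x - 1) = 2 * x by ring, show 1 - (2 * x - 1) = 2 * (1 - x) by ring,
          Real.log_mul (by norm_num) (by linarith), Real.log_mul (by norm_num) (by linarith)] at h3
        simp at h3
        linarith
    have := hm ⟨le_rfl, by norm_num⟩ ⟨h0, h1⟩ h0
    have e : Real.binEntropy (1 / 2) = Real.log 2 := by
      rw [one_div, Real.binEntropy_two_inv]
    simp only [f, e] at this
    norm_num at this
    linarith
  rcases le_total (1 / 2) β with h | h
  · exact key β h h1
  · have := key (1 - β) (by linarith) (by linarith)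
    rw [Real.binEntropy_one_sub] at this
    nlinarith

lemma F_half {κ : ℝ} (hκ : 0 < κ) (α : ℝ) :
    F κ α (1 / 2) = Real.log 2 + α * (2 * Real.log (p κ)) := by
  rw [F, q_half hκ.le, Real.log_pow, one_div, Real.binEntropy_two_inv]; norm_num

lemma F_zero (κ α : ℝ) : F κ α 0 = α * Real.log (p κ) := by
  rw [F, q_zero, Real.binEntropy_zero, zero_add]

lemma F_one_sub (κ α : ℝ) {β : ℝ} (h0 : 0 ≤ β) (h1 : β ≤ 1) : F κ α (1 - β) = F κ α β := by
  rw [F, F, q_one_sub κ h0 h1, Real.binEntropy_one_sub]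

lemma log_p_neg {κ : ℝ} (hκ : 0 < κ) : Real.log (p κ) < 0 :=
  Real.log_neg (p_pos hκ) (p_lt_one hκ)

lemma alphaC_pos {κ : ℝ} (hκ : 0 < κ) : 0 < alphaC κ :=
  div_pos_of_neg_of_neg (neg_neg_of_pos (Real.log_pos (by norm_num))) (log_p_neg hκ)

/-- This is the first moment condition log 2 + α log p > 0. It rules out the endpoint as a competing
maximum. -/
lemma F_zero_lt_half {κ α : ℝ} (hκ : 0 < κ) (h : α < alphaC κ) : F κ α 0 < F κ α (1 / 2) := by
  rw [F_zero, F_half hκ]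
  have := log_p_neg hκ
  rw [alphaC, lt_div_iff_of_neg this] at h
  linarith

/-- The quadratic coefficient of the energy at zero overlap, at the first moment threshold. -/
lemma alphaC_mul_curvature_lt {κ : ℝ} (hκ : 0 < κ) :
    alphaC κ * (4 * κ ^ 2 * gphi κ ^ 2 / p κ ^ 2) < 1 := by
  have h := capGap_pos hκ
  have hl := log_p_neg hκ
  rw [capGap, ← p_eq_boxMass hκ.le] at h
  rw [alphaC, div_mul_eq_mul_div, div_lt_one_of_neg hl]
  have e : 4 * κ ^ 2 * gphi κ ^ 2 / p κ ^ 2 = (2 * gphi κ * κ / p κ) ^ 2 := by ring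
  rw [e]
  linarith

lemma hasDerivAt_F {κ : ℝ} (hκ : 0 < κ) (α : ℝ) {β : ℝ} (h0 : 0 < β) (h1 : β < 1) :
    HasDerivAt (F κ α) (Real.log (1 - β) - Real.log β +
      α * (2 * boxCorrDeriv κ (2 * β - 1) / boxCorr κ (2 * β - 1))) β := by
  have habs : ∀ x : ℝ, 0 < x → x < 1 → |2 * x - 1| < 1 := fun x h0 h1 =>
    abs_lt.2 ⟨by linarith, by linarith⟩
  have hq : ∀ x : ℝ, 0 < x → x < 1 → q κ x = boxCorr κ (2 * x - 1) := fun x h0 h1 => by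
    rw [← q_eq_boxCorr hκ.le (habs x h0 h1)]; congr 1; ring
  have he : F κ α =ᶠ[𝓝 β] fun x => Real.binEntropy x + α * Real.log (boxCorr κ (2 * x - 1)) := by
    filter_upwards [Ioo_mem_nhds h0 h1] with x hx
    rw [F, hq x hx.1 hx.2]
  have hpos : 0 < boxCorr κ (2 * β - 1) := by
    rw [← hq β h0 h1]; exact q_pos hκ h0.le h1.le
  have hd : HasDerivAt (fun x : ℝ => boxCorr κ (2 * x - 1))
      (boxCorrDeriv κ (2 * β - 1) * 2) β := by
    have h3 : HasDerivAt (fun x : ℝ => 2 * x - 1) 2 β := by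
      simpa using ((hasDerivAt_id β).const_mul 2).sub_const 1
    exact (hasDerivAt_boxCorr hκ (habs β h0 h1)).comp β h3
  refine HasDerivAt.congr_of_eventuallyEq ?_ he
  refine HasDerivAt.congr_deriv ((Real.hasDerivAt_binEntropy h0.ne' h1.ne).add
    ((hd.log hpos.ne').const_mul α)) ?_
  ring

lemma iteratedDeriv_two_F {κ : ℝ} (hκ : 0 < κ) (α : ℝ) :
    iteratedDeriv 2 (F κ α) (1 / 2) = -4 + 4 * (α * (4 * κ ^ 2 * gphi κ ^ 2 / p κ ^ 2)) := by
  have he : deriv (F κ α) =ᶠ[𝓝 (1 / 2)] fun β => Real.log (1 - β) - Real.log β +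
      α * (2 * boxCorrDeriv κ (2 * β - 1) / boxCorr κ (2 * β - 1)) := by
    filter_upwards [Ioo_mem_nhds (show (0 : ℝ) < 1 / 2 by norm_num)
      (show (1 / 2 : ℝ) < 1 by norm_num)] with x hx
    exact (hasDerivAt_F hκ α hx.1 hx.2).deriv
  have hp := p_pos hκ
  have h3 : HasDerivAt (fun x : ℝ => 2 * x - 1) 2 (1 / 2) := by
    simpa using ((hasDerivAt_id (1 / 2 : ℝ)).const_mul 2).sub_const 1
  have hz : (2 * (1 / 2) - 1 : ℝ) = 0 := by norm_num
  have h4 : HasDerivAt (fun x : ℝ => boxCorrDeriv κ (2 * x - 1))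
      (4 * κ ^ 2 * gphi κ ^ 2 * 2) (1 / 2) := by
    refine HasDerivAt.comp (1 / 2 : ℝ) (h₂ := boxCorrDeriv κ) ?_ h3
    rw [hz]; exact hasDerivAt_boxCorrDeriv_zero κ
  have h5 : HasDerivAt (fun x : ℝ => boxCorr κ (2 * x - 1))
      (boxCorrDeriv κ 0 * 2) (1 / 2) := by
    refine HasDerivAt.comp (1 / 2 : ℝ) (h₂ := boxCorr κ) ?_ h3
    rw [hz]; exact hasDerivAt_boxCorr hκ (by simp)
  have h6 : HasDerivAt (fun x : ℝ => Real.log (1 - x)) (-1 / (1 - 1 / 2)) (1 / 2) :=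
    ((hasDerivAt_id (1 / 2 : ℝ)).const_sub 1).log (by norm_num)
  have h7 : HasDerivAt Real.log (1 / 2)⁻¹ (1 / 2 : ℝ) := Real.hasDerivAt_log (by norm_num)
  have hne : boxCorr κ (2 * (1 / 2) - 1) ≠ 0 := by rw [hz, boxCorr_zero hκ]; positivity
  have h8 := (h6.sub h7).add (((h4.const_mul 2).div h5 hne).const_mul α)
  rw [iteratedDeriv_succ, iteratedDeriv_one, he.deriv_eq]
  refine (HasDerivAt.deriv h8).trans ?_
  have h0 : boxCorrDeriv κ 0 = 0 := by simp [boxCorrDeriv]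
  rw [hz, boxCorr_zero hκ, h0]
  field_simp
  ring

/-- Thus the premise of the critical point assumption is automatic below the threshold. -/
lemma iteratedDeriv_two_F_neg {κ α : ℝ} (hκ : 0 < κ) (hα : α < alphaC κ) :
    iteratedDeriv 2 (F κ α) (1 / 2) < 0 := by
  rw [iteratedDeriv_two_F hκ]
  have h := alphaC_mul_curvature_lt hκ
  have : α * (4 * κ ^ 2 * gphi κ ^ 2 / p κ ^ 2) ≤ alphaC κ * (4 * κ ^ 2 * gphi κ ^ 2 / p κ ^ 2) := by
    gcongr
  linarith

/-- The quantifier order is the point: c and δ precede α. The excess of the energy is bounded by its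
value at `alphaC κ`, where the curvature is still strictly dominated by the entropy. -/
lemma exists_F_local {κ : ℝ} (hκ : 0 < κ) :
    ∃ c δ, 0 < c ∧ 0 < δ ∧ δ < 1 ∧ ∀ α, 0 ≤ α → α < alphaC κ → ∀ β, |2 * β - 1| ≤ δ →
      F κ α β - F κ α (1 / 2) ≤ -c * (2 * β - 1) ^ 2 := by
  have hp := p_pos hκ
  have hc := alphaC_pos hκ
  have hlt := alphaC_mul_curvature_lt hκ
  set gap := 1 - alphaC κ * (4 * κ ^ 2 * gphi κ ^ 2 / p κ ^ 2) with hgap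
  have hgap0 : 0 < gap := by linarith
  -- After multiplication by `alphaC κ / p κ ^ 2` this error costs gap/4. The energy coefficient is
  -- then (1 - gap)/2 + gap/4 = 1/2 - gap/4, against 1/2 from the entropy.
  obtain ⟨δ, hδ0, hδ1, hδ⟩ := exists_q_sub_sq_le hκ
    (η := gap * p κ ^ 2 / (4 * alphaC κ)) (by positivity)
  refine ⟨gap / 4, δ, by positivity, hδ0, hδ1, fun α hα0 hα β hβ => ?_⟩
  have hb := abs_le.1 hβ
  have hβ0 : 0 ≤ β := by linarith
  have hβ1 : β ≤ 1 := by linarith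
  have hq := q_pos hκ hβ0 hβ1
  have hq2 := sq_le_q hκ hβ0 hβ1
  have hH := binEntropy_le_sub_sq hβ0 hβ1
  have h1 : Real.log (q κ β) - 2 * Real.log (p κ) ≤ (q κ β - p κ ^ 2) / p κ ^ 2 := by
    have := Real.log_le_sub_one_of_pos (x := q κ β / p κ ^ 2) (by positivity)
    rw [Real.log_div hq.ne' (by positivity), Real.log_pow] at this
    rw [sub_div, div_self (by positivity)]
    exact_mod_cast this
  have h2 : α * (Real.log (q κ β) - 2 * Real.log (p κ)) ≤
      alphaC κ * ((q κ β - p κ ^ 2) / p κ ^ 2) := by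
    refine (mul_le_mul_of_nonneg_left h1 hα0).trans ?_
    exact mul_le_mul_of_nonneg_right hα.le (div_nonneg (by linarith) (by positivity))
  have h3 : alphaC κ * ((q κ β - p κ ^ 2) / p κ ^ 2) ≤ (1 / 2 - gap / 4) * (2 * β - 1) ^ 2 := by
    have : alphaC κ * ((q κ β - p κ ^ 2) / p κ ^ 2) ≤ alphaC κ *
        (((2 * κ ^ 2 * gphi κ ^ 2 + gap * p κ ^ 2 / (4 * alphaC κ)) * (2 * β - 1) ^ 2) / p κ ^ 2) := by
      have := hδ β hβ
      gcongr
    refine this.trans (le_of_eq ?_)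
    have e : alphaC κ * (((2 * κ ^ 2 * gphi κ ^ 2 + gap * p κ ^ 2 / (4 * alphaC κ)) *
        (2 * β - 1) ^ 2) / p κ ^ 2) =
        (alphaC κ * (4 * κ ^ 2 * gphi κ ^ 2 / p κ ^ 2) / 2 + gap / 4) * (2 * β - 1) ^ 2 := by
      field_simp
      ring
    rw [e, hgap]; ring
  rw [F_half hκ, F]
  nlinarith

/-- The unique critical point forces `F` to stay strictly below its value at `1/2` away
from `1/2`. -/
lemma exists_F_far {κ α : ℝ} (hκ : 0 < κ) (hF : CriticalPointAssumption κ) (hα0 : 0 < α)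
    (hα : α < alphaC κ) {c δ : ℝ} (hc : 0 < c) (hδ0 : 0 < δ)
    (hloc : ∀ β, |2 * β - 1| ≤ δ → F κ α β - F κ α (1 / 2) ≤ -c * (2 * β - 1) ^ 2) :
    ∃ c', 0 < c' ∧ ∀ β, 0 ≤ β → β ≤ 1 → δ ≤ |2 * β - 1| → F κ α β - F κ α (1 / 2) ≤ -c' := by
  obtain ⟨z, ⟨⟨hz0, hz1⟩, hz⟩, huniq⟩ := hF α hα0 hα (iteratedDeriv_two_F_neg hκ hα)
  set F' : ℝ → ℝ := fun β => Real.log (1 - β) - Real.log β +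
      α * (2 * boxCorrDeriv κ (2 * β - 1) / boxCorr κ (2 * β - 1)) with hF'
  have hd : ∀ x, 0 < x → x < 1 → HasDerivAt (F κ α) (F' x) x := fun x h0 h1 =>
    hasDerivAt_F hκ α h0 h1
  have hne : ∀ x, 0 < x → x < 1 / 2 → x ≠ z → F' x ≠ 0 := by
    intro x h0 h1 hxz h
    have hdx := hd x h0 (by linarith)
    rw [h] at hdx
    exact hxz (huniq x ⟨⟨h0, h1⟩, hdx⟩)
  have hcont : ∀ s ⊆ Set.Ioo (0 : ℝ) 1, ContinuousOn (F κ α) s := fun s hs x hx =>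
    (hd x (hs hx).1 (hs hx).2).continuousAt.continuousWithinAt
  have hstrict : ∀ x, 0 < |2 * x - 1| → |2 * x - 1| ≤ δ → F κ α x < F κ α (1 / 2) := by
    intro x h0 h1
    have := hloc x h1
    have h3 : 0 < c * (2 * x - 1) ^ 2 := by
      have := abs_pos.1 h0
      positivity
    linarith
  have hmonoR : StrictMonoOn (F κ α) (Set.Icc z (1 / 2)) := by
    rcases hasDerivWithinAt_forall_lt_or_forall_gt_of_forall_ne (s := Set.Ioo z (1 / 2))
      (f := F κ α) (f' := F') (m := 0) (convex_Ioo _ _)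
      (fun x hx => (hd x (by linarith [hx.1]) (by linarith [hx.2])).hasDerivWithinAt)
      (fun x hx => hne x (by linarith [hx.1]) hx.2 hx.1.ne') with h | h
    -- The derivative has constant sign on (z, 1/2). A decreasing F would exceed F(1/2) just left of
    -- 1/2, against the local bound.
    · exfalso
      have hanti : StrictAntiOn (F κ α) (Set.Icc z (1 / 2)) := by
        refine strictAntiOn_of_hasDerivWithinAt_neg (f' := F') (convex_Icc _ _)
          (hcont _ fun x hx => ⟨by linarith [hx.1], by linarith [hx.2]⟩) (fun x hx => ?_)
          (fun x hx => ?_)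
        all_goals rw [interior_Icc] at hx
        · exact (hd x (by linarith [hx.1]) (by linarith [hx.2])).hasDerivWithinAt
        · exact h x hx
      have hy1 : max z (1 / 2 - δ / 2) < 1 / 2 := max_lt hz1 (by linarith)
      have h1 := hanti ⟨le_max_left _ _, hy1.le⟩ (Set.right_mem_Icc.2 hz1.le) hy1
      have hy2 : 1 / 2 - δ / 2 ≤ max z (1 / 2 - δ / 2) := le_max_right _ _
      have h2 := hstrict (max z (1 / 2 - δ / 2)) (abs_pos.2 (by linarith))
        (abs_le.2 ⟨by linarith, by linarith⟩)
      linarith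
    · refine strictMonoOn_of_hasDerivWithinAt_pos (f' := F') (convex_Icc _ _)
        (hcont _ fun x hx => ⟨by linarith [hx.1], by linarith [hx.2]⟩) (fun x hx => ?_)
        (fun x hx => ?_)
      all_goals rw [interior_Icc] at hx
      · exact (hd x (by linarith [hx.1]) (by linarith [hx.2])).hasDerivWithinAt
      · exact h x hx
  have hleft : ∀ x, 0 < x → x < z → F κ α x ≤ max (F κ α 0) (F κ α z) := by
    intro x hx0 hxz
    rcases hasDerivWithinAt_forall_lt_or_forall_gt_of_forall_ne (s := Set.Ioo 0 z)
      (f := F κ α) (f' := F') (m := 0) (convex_Ioo _ _)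
      (fun x hx => (hd x hx.1 (by linarith [hx.2])).hasDerivWithinAt)
      (fun x hx => hne x hx.1 (by linarith [hx.2]) hx.2.ne) with h | h
    · have hanti : AntitoneOn (F κ α) (Set.Ioo 0 z) := by
        refine antitoneOn_of_hasDerivWithinAt_nonpos (f' := F') (convex_Ioo _ _)
          (hcont _ fun x hx => ⟨hx.1, by linarith [hx.2]⟩) (fun x hx => ?_)
          (fun x hx => ?_)
        all_goals rw [interior_Ioo] at hx
        · exact (hd x hx.1 (by linarith [hx.2])).hasDerivWithinAt
        · exact (h x hx).le
      refine le_max_of_le_left ?_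
      -- Continuity of F at 0 is not needed: as q ≤ p, F lies below this continuous function, whose
      -- value at 0 is F(0).
      have ht : Tendsto (fun y => Real.binEntropy y + α * Real.log (p κ)) (𝓝[>] 0)
          (𝓝 (F κ α 0)) := by
        have := (Real.binEntropy_continuous.tendsto 0).add_const (α * Real.log (p κ))
        rw [Real.binEntropy_zero, zero_add] at this
        rw [F_zero]
        exact this.mono_left nhdsWithin_le_nhds
      refine ge_of_tendsto ht ?_
      filter_upwards [Ioo_mem_nhdsGT hx0] with y hy
      refine (hanti ⟨hy.1, hy.2.trans hxz⟩ ⟨hx0, hxz⟩ hy.2.le).trans ?_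
      have hy1 : y ≤ 1 := by linarith [hy.2]
      rw [F]
      gcongr
      · exact q_pos hκ hy.1.le hy1
      · exact q_le_p κ hy.1.le hy1
    · refine le_max_of_le_right ?_
      have hmono : MonotoneOn (F κ α) (Set.Ioc 0 z) := by
        refine monotoneOn_of_hasDerivWithinAt_nonneg (f' := F') (convex_Ioc _ _)
          (hcont _ fun x hx => ⟨hx.1, by linarith [hx.2]⟩) (fun x hx => ?_)
          (fun x hx => ?_)
        all_goals rw [interior_Ioc] at hx
        · exact (hd x hx.1 (by linarith [hx.2])).hasDerivWithinAt
        · exact (h x hx).le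
      exact hmono ⟨hx0, hxz.le⟩ ⟨hz0, le_rfl⟩ hxz.le
  set b := 1 / 2 - δ / 2 with hb
  have hbl : F κ α b < F κ α (1 / 2) := by
    have e : |2 * b - 1| = δ := by
      rw [show 2 * b - 1 = -δ by rw [hb]; ring, abs_neg, abs_of_pos hδ0]
    exact hstrict b (by rw [e]; exact hδ0) e.le
  have hzl : F κ α z < F κ α (1 / 2) :=
    hmonoR (Set.left_mem_Icc.2 hz1.le) (Set.right_mem_Icc.2 hz1.le) hz1
  set m := max (max (F κ α 0) (F κ α z)) (F κ α b) with hm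
  have hmlt : m < F κ α (1 / 2) := max_lt (max_lt (F_zero_lt_half hκ hα) hzl) hbl
  have hall : ∀ x, 0 ≤ x → x ≤ b → F κ α x ≤ m := by
    intro x hx0 hxb
    rcases hx0.eq_or_lt with rfl | hx0
    · exact le_max_of_le_left (le_max_left _ _)
    rcases lt_or_ge x z with h | h
    · exact le_max_of_le_left (hleft x hx0 h)
    · exact le_max_of_le_right (hmonoR.monotoneOn ⟨h, by linarith⟩ ⟨h.trans hxb, by linarith⟩ hxb)
  refine ⟨F κ α (1 / 2) - m, by linarith, fun β h0 h1 hβ => ?_⟩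
  rcases le_total β (1 / 2) with h | h
  · rw [abs_of_nonpos (by linarith)] at hβ
    linarith [hall β h0 (by linarith)]
  · rw [abs_of_nonneg (by linarith)] at hβ
    have := hall (1 - β) (by linarith) (by linarith)
    rw [F_one_sub κ α h0 h1] at this
    linarith

/-! ### Gaussian concentration by rotation -/

/-- Jensen's inequality for the exponential, integrated form. -/
lemma exp_integral_le {α : Type*} [MeasurableSpace α] {μ : Measure α} [IsProbabilityMeasure μ]
    {h : α → ℝ} (hi : Integrable h μ) (he : Integrable (fun x => Real.exp (h x)) μ) :
    Real.exp (∫ x, h x ∂μ) ≤ ∫ x, Real.exp (h x) ∂μ := by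
  set m := ∫ x, h x ∂μ
  have hi' : Integrable (fun x => h x - m) μ := hi.sub (integrable_const m)
  have h1 : ∫ x, Real.exp m * (1 + (h x - m)) ∂μ ≤ ∫ x, Real.exp (h x) ∂μ := by
    refine integral_mono (((integrable_const _).add hi').const_mul _) he
      fun x => ?_
    have := Real.add_one_le_exp (h x - m)
    calc Real.exp m * (1 + (h x - m)) ≤ Real.exp m * Real.exp (h x - m) := by gcongr; linarith
      _ = _ := by rw [← Real.exp_add]; congr 1; ring
  have h2 : ∫ x, Real.exp m * (1 + (h x - m)) ∂μ = Real.exp m := by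
    rw [integral_const_mul, integral_add (integrable_const _) hi',
      integral_sub hi (integrable_const _)]
    simp [m]
  linarith

/-- Jensen for the uniform law on [0, a]. The integral is not an average, whence the factor a in the
exponent. -/
lemma exp_intervalIntegral_le {h : ℝ → ℝ} (hc : Continuous h) {a : ℝ} (ha : 0 < a) :
    Real.exp (∫ θ in (0 : ℝ)..a, h θ) ≤ a⁻¹ * ∫ θ in (0 : ℝ)..a, Real.exp (a * h θ) := by
  set m := ∫ θ in (0 : ℝ)..a, h θ
  have h1 : ∫ θ in (0 : ℝ)..a, Real.exp m * (1 + (a * h θ - m)) ≤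
      ∫ θ in (0 : ℝ)..a, Real.exp (a * h θ) := by
    refine intervalIntegral.integral_mono_on ha.le
      (Continuous.intervalIntegrable (by fun_prop) _ _)
      (Continuous.intervalIntegrable (by fun_prop) _ _) fun x _ => ?_
    have := Real.add_one_le_exp (a * h x - m)
    calc Real.exp m * (1 + (a * h x - m)) ≤ Real.exp m * Real.exp (a * h x - m) := by
          gcongr; linarith
      _ = _ := by rw [← Real.exp_add]; congr 1; ring
  have h2 : ∫ θ in (0 : ℝ)..a, Real.exp m * (1 + (a * h θ - m)) = Real.exp m * a := by
    rw [intervalIntegral.integral_const_mul, intervalIntegral.integral_add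
      (Continuous.intervalIntegrable (by fun_prop) _ _)
      (Continuous.intervalIntegrable (by fun_prop) _ _), intervalIntegral.integral_sub
      (Continuous.intervalIntegrable (by fun_prop) _ _)
      (Continuous.intervalIntegrable (by fun_prop) _ _), intervalIntegral.integral_const_mul]
    simp [m]
  rw [inv_mul_eq_div, le_div_iff₀ ha]
  linarith

section Rotation

variable {E : Type*} [NormedAddCommGroup E] [InnerProductSpace ℝ E]

/-- The integrand of the rotation interpolation. -/
noncomputable def rotTerm (g : E → E) (θ : ℝ) (z : E × E) : ℝ :=
  ⟪g (ContinuousLinearMap.rotation θ z).1, (ContinuousLinearMap.rotation θ z).2⟫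

lemma continuous_rotTerm {g : E → E} (hg : Continuous g) :
    Continuous fun w : (E × E) × ℝ => rotTerm g w.2 w.1 := by
  simp only [rotTerm, ContinuousLinearMap.rotation_apply]
  fun_prop

lemma continuous_rotTerm_angle {g : E → E} (hg : Continuous g) (z : E × E) :
    Continuous fun θ => rotTerm g θ z := by
  simp only [rotTerm, ContinuousLinearMap.rotation_apply]
  fun_prop

/-- The quarter circle θ ↦ cos θ · z.1 + sin θ · z.2 joins the two points, and its velocity is the
second component of the rotated pair. -/
lemma sub_eq_integral_rotation {f : E → ℝ} {g : E → E}
    (hf : ∀ x, HasFDerivAt f (innerSL ℝ (g x)) x) (hg : Continuous g) (z : E × E) :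
    f z.2 - f z.1 = ∫ θ in (0 : ℝ)..(Real.pi / 2), rotTerm g θ z := by
  have hd : ∀ θ : ℝ, HasDerivAt (fun θ => f (ContinuousLinearMap.rotation θ z).1)
      (rotTerm g θ z) θ := by
    intro θ
    have h1 : HasDerivAt (fun θ : ℝ => (ContinuousLinearMap.rotation θ z).1)
        (ContinuousLinearMap.rotation θ z).2 θ := by
      simp only [ContinuousLinearMap.rotation_apply]
      exact ((Real.hasDerivAt_cos θ).smul_const z.1).add ((Real.hasDerivAt_sin θ).smul_const z.2)
    exact (hf _).comp_hasDerivAt θ h1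
  rw [intervalIntegral.integral_eq_sub_of_hasDerivAt (fun θ _ => hd θ)]
  · simp [ContinuousLinearMap.rotation_apply]
  · exact (continuous_rotTerm_angle hg z).intervalIntegrable _ _

lemma measurable_exp_inner [MeasurableSpace E] [BorelSpace E] [SecondCountableTopology E]
    {g : E → E} (hg : Continuous g) (a c : ℝ) : Measurable fun w : E × E =>
    ENNReal.ofReal (Real.exp (a * (c * ⟪g w.1, w.2⟫))) := by
  have : Continuous fun w : E × E => Real.exp (a * (c * ⟪g w.1, w.2⟫)) := by fun_prop
  exact this.measurable.ennreal_ofReal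

end Rotation

section MaureyPisier

variable {E : Type*} [NormedAddCommGroup E] [InnerProductSpace ℝ E] [FiniteDimensional ℝ E]
  [MeasurableSpace E] [BorelSpace E] [SecondCountableTopology E]

lemma lintegral_exp_inner_stdGaussian (v : E) :
    ∫⁻ y, ENNReal.ofReal (Real.exp ⟪v, y⟫) ∂(stdGaussian E) =
      ENNReal.ofReal (Real.exp (‖v‖ ^ 2 / 2)) := by
  rcases eq_or_ne v 0 with rfl | hv
  · simp
  have hn : ‖v‖ ≠ 0 := norm_ne_zero_iff.2 hv
  have hu : ‖(‖v‖⁻¹ • v)‖ = 1 := by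
    rw [norm_smul, norm_inv, norm_norm, inv_mul_cancel₀ hn]
  have e : ∀ y, ⟪v, y⟫ = ‖v‖ * ⟪‖v‖⁻¹ • v, y⟫ := by
    intro y
    rw [real_inner_smul_left, mul_inv_cancel_left₀ hn]
  have hmap := lintegral_map (μ := stdGaussian E)
    (f := fun z : ℝ => ENNReal.ofReal (Real.exp (‖v‖ * z)))
    (g := fun x => ⟪‖v‖⁻¹ • v, x⟫) (by fun_prop) (by fun_prop)
  simp only [e]
  rw [← hmap, map_inner_stdGaussian hu, ← ofReal_integral_eq_lintegral_ofReal
    (integrable_exp_mul_gaussianReal _) (Eventually.of_forall fun x => (Real.exp_pos _).le)]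
  have := congrFun (mgf_id_gaussianReal (μ := 0) (v := 1)) ‖v‖
  rw [mgf] at this
  simp only [id] at this
  rw [this]
  simp

variable {f : E → ℝ} {g : E → E}

/-- Each rotated pair is again a pair of independent standard Gaussians. The position and velocity
on the arc are thus independent, whatever the angle. -/
lemma lintegral_rotTerm (hg : Continuous g) (a c θ : ℝ) :
    ∫⁻ z, ENNReal.ofReal (Real.exp (a * (c * rotTerm g θ z)))
      ∂((stdGaussian E).prod (stdGaussian E)) =
    ∫⁻ w : E × E, ENNReal.ofReal (Real.exp (a * (c * ⟪g w.1, w.2⟫)))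
      ∂((stdGaussian E).prod (stdGaussian E)) := by
  have e := IsGaussian.map_rotation_eq_self (μ := stdGaussian E) integral_id_stdGaussian θ
  have h1 := lintegral_map (μ := (stdGaussian E).prod (stdGaussian E))
    (measurable_exp_inner hg a c) (ContinuousLinearMap.rotation (E := E) θ).continuous.measurable
  rw [e] at h1
  exact h1.symm

/-- The Maurey-Pisier exponential bound for functions with bounded gradient. -/
lemma lintegral_exp_sub_le (hf : ∀ x, HasFDerivAt f (innerSL ℝ (g x)) x) (hg : Continuous g)
    {b : ℝ} (hb : ∀ x, ‖g x‖ ≤ b) (c : ℝ) :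
    ∫⁻ z, ENNReal.ofReal (Real.exp (c * (f z.2 - f z.1)))
      ∂((stdGaussian E).prod (stdGaussian E)) ≤
      ENNReal.ofReal (Real.exp ((c * (Real.pi / 2) * b) ^ 2 / 2)) := by
  set a := Real.pi / 2 with ha
  have ha0 : 0 < a := by have := Real.pi_pos; positivity
  set γ := stdGaussian E
  have hH := continuous_rotTerm hg
  have hHz : ∀ z, Continuous fun θ => rotTerm g θ z := continuous_rotTerm_angle hg
  -- Jensen over the angle moves the exponential inside, after which every angle contributes the
  -- same Gaussian integral.
  have hpoint : ∀ z : E × E, ENNReal.ofReal (Real.exp (c * (f z.2 - f z.1))) ≤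
      ENNReal.ofReal a⁻¹ *
        ∫⁻ θ in Set.Ioc 0 a, ENNReal.ofReal (Real.exp (a * (c * rotTerm g θ z))) := by
    intro z
    rw [sub_eq_integral_rotation hf hg z, ← intervalIntegral.integral_const_mul]
    have hcz : Continuous fun θ => c * rotTerm g θ z := continuous_const.mul (hHz z)
    refine (ENNReal.ofReal_le_ofReal (exp_intervalIntegral_le hcz ha0)).trans ?_
    rw [ENNReal.ofReal_mul (by positivity), intervalIntegral.integral_of_le ha0.le,
      ofReal_integral_eq_lintegral_ofReal]
    · have : Continuous fun θ => Real.exp (a * (c * rotTerm g θ z)) := by fun_prop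
      exact (this.intervalIntegrable 0 a).1
    · exact Eventually.of_forall fun x => (Real.exp_pos _).le
  have hrot : ∀ θ, ∫⁻ z, ENNReal.ofReal (Real.exp (a * (c * rotTerm g θ z))) ∂(γ.prod γ) ≤
      ENNReal.ofReal (Real.exp ((c * a * b) ^ 2 / 2)) := by
    intro θ
    have hm : Measurable fun w : E × E =>
        ENNReal.ofReal (Real.exp (a * (c * ⟪g w.1, w.2⟫))) :=
      measurable_exp_inner hg a c
    rw [lintegral_rotTerm hg, lintegral_prod _ hm.aemeasurable]
    calc _ ≤ ∫⁻ x, ENNReal.ofReal (Real.exp ((c * a * b) ^ 2 / 2)) ∂γ := by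
          refine lintegral_mono fun x => ?_
          have h2 := lintegral_exp_inner_stdGaussian ((a * c) • g x)
          simp only [real_inner_smul_left, mul_assoc] at h2
          refine h2.le.trans (ENNReal.ofReal_le_ofReal (Real.exp_le_exp.2 ?_))
          rw [norm_smul, mul_pow, mul_pow, Real.norm_eq_abs, sq_abs]
          have := pow_le_pow_left₀ (norm_nonneg _) (hb x) 2
          have h3 : 0 ≤ (a * c) ^ 2 := sq_nonneg _
          nlinarith
      _ = _ := by simp
  calc _ ≤ ∫⁻ z, (ENNReal.ofReal a⁻¹ *
        ∫⁻ θ in Set.Ioc 0 a, ENNReal.ofReal (Real.exp (a * (c * rotTerm g θ z)))) ∂(γ.prod γ) :=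
        lintegral_mono hpoint
    _ = ENNReal.ofReal a⁻¹ * ∫⁻ θ in Set.Ioc 0 a,
        ∫⁻ z, ENNReal.ofReal (Real.exp (a * (c * rotTerm g θ z))) ∂(γ.prod γ) := by
        have hm2 : Measurable (Function.uncurry fun (z : E × E) (θ : ℝ) =>
            ENNReal.ofReal (Real.exp (a * (c * rotTerm g θ z)))) :=
          (Real.continuous_exp.comp (continuous_const.mul
            (continuous_const.mul hH))).measurable.ennreal_ofReal
        rw [lintegral_const_mul' _ _ ENNReal.ofReal_ne_top, lintegral_lintegral_swap
          hm2.aemeasurable]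
    _ ≤ ENNReal.ofReal a⁻¹ * ∫⁻ θ in Set.Ioc 0 a,
        ENNReal.ofReal (Real.exp ((c * a * b) ^ 2 / 2)) := by
        gcongr with θ
        exact hrot θ
    _ = _ := by
        rw [setLIntegral_const, Real.volume_Ioc, sub_zero, mul_comm (ENNReal.ofReal (Real.exp _)),
          ← mul_assoc, ← ENNReal.ofReal_mul (by positivity), inv_mul_cancel₀ ha0.ne',
          ENNReal.ofReal_one, one_mul]

/-- Lower deviations of a `[0,1]`-valued function with small gradient. -/
lemma measure_le_half_mean_le (hf : ∀ x, HasFDerivAt f (innerSL ℝ (g x)) x) (hg : Continuous g)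
    {b : ℝ} (hb : ∀ x, ‖g x‖ ≤ b) (hf0 : ∀ x, 0 ≤ f x) (hf1 : ∀ x, f x ≤ 1) {c : ℝ} (hc : 0 ≤ c) :
    stdGaussian E {x | f x ≤ (∫ y, f y ∂(stdGaussian E)) / 2} ≤
      ENNReal.ofReal (Real.exp ((c * (Real.pi / 2) * b) ^ 2 / 2 -
        c * ((∫ y, f y ∂(stdGaussian E)) / 2))) := by
  set γ := stdGaussian E
  set e0 := ∫ y, f y ∂γ
  have hfc : Continuous f := continuous_iff_continuousAt.2 fun x => (hf x).continuousAt
  have hint : Integrable f γ := Integrable.of_bound hfc.aestronglyMeasurable 1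
    (Eventually.of_forall fun x => by
      rw [Real.norm_of_nonneg (hf0 x)]; exact hf1 x)
  have hbd : ∀ x, Integrable (fun y => Real.exp (c * (f y - f x))) γ := fun x =>
    Integrable.of_bound (by fun_prop) (Real.exp c) (Eventually.of_forall fun y => by
      rw [Real.norm_of_nonneg (Real.exp_pos _).le, Real.exp_le_exp]
      nlinarith [hf0 x, hf1 y])
  -- Jensen in the second copy only replaces f(y) by its mean. Markov at level exp(c e0/2) then
  -- gives the deviation bound.
  have hJ : ∀ x, ENNReal.ofReal (Real.exp (c * (e0 - f x))) ≤
      ∫⁻ y, ENNReal.ofReal (Real.exp (c * (f y - f x))) ∂γ := by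
    intro x
    rw [← ofReal_integral_eq_lintegral_ofReal (hbd x)
      (Eventually.of_forall fun x => (Real.exp_pos _).le)]
    refine ENNReal.ofReal_le_ofReal ?_
    refine le_trans (le_of_eq ?_) (exp_integral_le ((hint.sub (integrable_const (f x))).const_mul c)
      (hbd x))
    congr 1
    rw [integral_const_mul, integral_sub hint (integrable_const _)]
    simp [e0]
  have hm : Measurable fun z : E × E => ENNReal.ofReal (Real.exp (c * (f z.2 - f z.1))) := by
    have : Continuous fun z : E × E => Real.exp (c * (f z.2 - f z.1)) := by fun_prop
    exact this.measurable.ennreal_ofReal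
  have h1 : ∫⁻ x, ENNReal.ofReal (Real.exp (c * (e0 - f x))) ∂γ ≤
      ENNReal.ofReal (Real.exp ((c * (Real.pi / 2) * b) ^ 2 / 2)) := by
    refine le_trans (lintegral_mono hJ) ?_
    have := lintegral_exp_sub_le hf hg hb c
    rwa [lintegral_prod _ hm.aemeasurable] at this
  have h2 : ENNReal.ofReal (Real.exp (c * (e0 / 2))) * γ {x | f x ≤ e0 / 2} ≤
      ENNReal.ofReal (Real.exp ((c * (Real.pi / 2) * b) ^ 2 / 2)) := by
    refine le_trans ?_ h1
    have hm2 : Measurable fun x => ENNReal.ofReal (Real.exp (c * (e0 - f x))) := by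
      have : Continuous fun x => Real.exp (c * (e0 - f x)) := by fun_prop
      exact this.measurable.ennreal_ofReal
    refine le_trans ?_ (mul_meas_ge_le_lintegral hm2 (ENNReal.ofReal (Real.exp (c * (e0 / 2)))))
    gcongr with x
    intro hx
    have hx' : f x ≤ e0 / 2 := hx
    refine ENNReal.ofReal_le_ofReal (Real.exp_le_exp.2 ?_)
    exact mul_le_mul_of_nonneg_left (by linarith) hc
  rw [Real.exp_sub, ENNReal.ofReal_div_of_pos (Real.exp_pos _), ENNReal.le_div_iff_mul_le
    (Or.inl (by simp [Real.exp_pos])) (Or.inl ENNReal.ofReal_ne_top), mul_comm]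
  exact h2

end MaureyPisier

/-! ### A slab keeps a positive fraction of a spread-out family -/

/-- A smooth minorant of the indicator of [-κ, κ]: the concentration bound requires a gradient, and
a lower bound on the count needs only a minorant. -/
lemma exists_cutoff {κ : ℝ} (hκ : 0 < κ) : ∃ (ψ ψ' : ℝ → ℝ) (L : ℝ), 0 < L ∧
    (∀ x, HasDerivAt ψ (ψ' x) x) ∧ Continuous ψ' ∧ (∀ x, |ψ' x| ≤ L) ∧ (∀ x, 0 ≤ ψ x) ∧
    (∀ x, ψ x ≤ 1) ∧ (∀ x, κ < |x| → ψ x = 0) ∧ 0 < ∫ x, ψ x ∂(gaussianReal 0 1) := by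
  let f : ContDiffBump (0 : ℝ) := ⟨κ / 2, κ, by positivity, by linarith⟩
  have hc : Continuous (deriv f) := (f.contDiff (n := 1)).continuous_deriv le_rfl
  obtain ⟨L, hL⟩ := f.hasCompactSupport.deriv.exists_bound_of_continuous hc
  refine ⟨f, deriv f, max L 1, by positivity, fun x => ?_, hc,
    fun x => (hL x).trans (le_max_left _ _), fun x => f.nonneg, fun x => f.le_one,
    fun x hx => f.zero_of_le_dist (by rw [Real.dist_eq, sub_zero]; exact hx.le), ?_⟩
  · exact ((f.contDiff (n := 1)).differentiable one_ne_zero x).hasDerivAt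
  · have hint : Integrable f (gaussianReal 0 1) :=
      Integrable.of_bound f.continuous.aestronglyMeasurable 1 (Eventually.of_forall fun x => by
        rw [Real.norm_of_nonneg f.nonneg]; exact f.le_one)
    have h1 : ∫ x, Set.indicator {z : ℝ | |z| ≤ κ / 2} (fun _ => (1 : ℝ)) x ∂(gaussianReal 0 1) ≤
        ∫ x, f x ∂(gaussianReal 0 1) := by
      refine integral_mono ((integrable_const _).indicator
        (measurableSet_le (by fun_prop) (by fun_prop))) hint fun x => ?_
      by_cases hx : x ∈ {z : ℝ | |z| ≤ κ / 2}
      · rw [Set.indicator_of_mem hx, f.one_of_mem_closedBall]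
        rw [Metric.mem_closedBall, Real.dist_eq, sub_zero]; exact hx
      · rw [Set.indicator_of_notMem hx]; exact f.nonneg
    rw [integral_indicator_const _ (measurableSet_le (by fun_prop) (by fun_prop)), smul_eq_mul,
      mul_one] at h1
    exact (p_pos (half_pos hκ)).trans_le h1

/-- If the overlaps of a family of unit vectors are small in mean square, then all but an
exponentially small proportion of slabs contain a positive fraction of the family. -/
lemma exists_slab_lower {κ : ℝ} (hκ : 0 < κ) : ∃ η b : ℝ, 0 < η ∧ η ≤ 1 / 2 ∧ 0 < b ∧
    ∀ (N : ℕ) {ι : Type} (S : Finset ι) (u : ι → EuclideanSpace ℝ (Fin N)) (D : ℝ),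
      S.Nonempty → (∀ i ∈ S, ‖u i‖ = 1) → 0 < D →
      ∑ i ∈ S, ∑ j ∈ S, ⟪u i, u j⟫ ^ 2 ≤ D * (S.card : ℝ) ^ 2 →
      (stdGaussian (EuclideanSpace ℝ (Fin N)))
        {x | ((S.filter fun i => |⟪u i, x⟫| ≤ κ).card : ℝ) < η * S.card} ≤
        ENNReal.ofReal (Real.exp (2 - b / √(√D))) := by
  obtain ⟨ψ, ψ', L, hL, hd, hc, hb, h0, h1, hz, hpos⟩ := exists_cutoff hκ
  set e0 := ∫ x, ψ x ∂(gaussianReal 0 1)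
  -- Half the mean of the smoothed fraction is the natural η. The cap 1/2 serves the inverse moment
  -- step.
  refine ⟨min (1 / 2) (e0 / 2), e0 / (2 * L), by positivity, min_le_left _ _, by positivity,
    fun N ι S u D hS hu hD hov => ?_⟩
  have hn : 0 < (S.card : ℝ) := by exact_mod_cast hS.card_pos
  have hψ : Continuous ψ := continuous_iff_continuousAt.2 fun x => (hd x).continuousAt
  let f : EuclideanSpace ℝ (Fin N) → ℝ := fun x => (S.card : ℝ)⁻¹ * ∑ i ∈ S, ψ ⟪u i, x⟫
  let g : EuclideanSpace ℝ (Fin N) → EuclideanSpace ℝ (Fin N) := fun x =>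
    (S.card : ℝ)⁻¹ • ∑ i ∈ S, ψ' ⟪u i, x⟫ • u i
  have hf : ∀ x, HasFDerivAt f (innerSL ℝ (g x)) x := by
    intro x
    have h2 : ∀ i ∈ S, HasFDerivAt (fun x => ψ ⟪u i, x⟫) (ψ' ⟪u i, x⟫ • innerSL ℝ (u i)) x :=
      fun i _ => (hd _).comp_hasFDerivAt x (innerSL ℝ (u i)).hasFDerivAt
    refine ((HasFDerivAt.fun_sum h2).const_mul (S.card : ℝ)⁻¹).congr_fderiv ?_
    simp only [g, map_smul, map_sum]
  have hg : Continuous g := by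
    have hs : Continuous fun x : EuclideanSpace ℝ (Fin N) => ∑ i ∈ S, ψ' ⟪u i, x⟫ • u i :=
      continuous_finsetSum _ fun i _ => (hc.comp (by fun_prop)).smul continuous_const
    exact hs.const_smul (S.card : ℝ)⁻¹
  -- Expanding ‖g‖² leaves the average of |⟨u_i, u_j⟩|, at most √D by Cauchy–Schwarz. Hence the
  -- fourth root of D.
  have hgb : ∀ x, ‖g x‖ ≤ L * √(√D) := by
    intro x
    refine le_of_sq_le_sq ?_ (by positivity)
    rw [mul_pow, Real.sq_sqrt (Real.sqrt_nonneg _), norm_smul, mul_pow, norm_inv, Real.norm_natCast,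
      ← real_inner_self_eq_norm_sq, sum_inner, inv_pow, inv_mul_le_iff₀ (by positivity)]
    have h3 : ∑ i ∈ S, ∑ j ∈ S, |⟪u i, u j⟫| ≤ √D * (S.card : ℝ) ^ 2 := by
      refine le_of_sq_le_sq ?_ (by positivity)
      have := sq_sum_le_card_mul_sum_sq (s := S ×ˢ S) (f := fun k => |⟪u k.1, u k.2⟫|)
      rw [Finset.sum_product, Finset.sum_product, Finset.card_product] at this
      simp only [sq_abs] at this
      refine this.trans ?_
      rw [mul_pow, Real.sq_sqrt hD.le]
      push_cast
      calc _ ≤ (S.card : ℝ) * S.card * (D * (S.card : ℝ) ^ 2) := by gcongr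
        _ = _ := by ring
    calc _ ≤ ∑ i ∈ S, ∑ j ∈ S, L ^ 2 * |⟪u i, u j⟫| := by
          refine Finset.sum_le_sum fun i _ => ?_
          rw [inner_sum]
          refine Finset.sum_le_sum fun j _ => ?_
          rw [real_inner_smul_left, real_inner_smul_right]
          refine (le_abs_self _).trans ?_
          rw [abs_mul, abs_mul, ← mul_assoc, sq]
          have := hb ⟪u i, x⟫
          have := hb ⟪u j, x⟫
          gcongr
      _ = L ^ 2 * ∑ i ∈ S, ∑ j ∈ S, |⟪u i, u j⟫| := by simp only [Finset.mul_sum]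
      _ ≤ L ^ 2 * (√D * (S.card : ℝ) ^ 2) := by gcongr
      _ = _ := by ring
  have hmean : ∫ x, f x ∂(stdGaussian (EuclideanSpace ℝ (Fin N))) = e0 := by
    have h4 : ∀ i ∈ S, ∫ x, ψ ⟪u i, x⟫ ∂(stdGaussian (EuclideanSpace ℝ (Fin N))) = e0 := by
      intro i hi
      simp only [e0]
      rw [← map_inner_stdGaussian (hu i hi), integral_map (by fun_prop) hψ.aestronglyMeasurable]
    simp only [f]
    rw [integral_const_mul, integral_finsetSum]
    · rw [Finset.sum_congr rfl h4, Finset.sum_const, nsmul_eq_mul, inv_mul_cancel_left₀ hn.ne']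
    · intro i _
      exact Integrable.of_bound (hψ.comp (by fun_prop)).aestronglyMeasurable 1
        (Eventually.of_forall fun x => by rw [Real.norm_of_nonneg (h0 _)]; exact h1 _)
  have hf0 : ∀ x, 0 ≤ f x := fun x => mul_nonneg (by positivity) (Finset.sum_nonneg fun i _ => h0 _)
  have hfle : ∀ x, f x ≤ (S.card : ℝ)⁻¹ * ((S.filter fun i => |⟪u i, x⟫| ≤ κ).card : ℝ) := by
    intro x
    simp only [f]
    gcongr
    rw [← Finset.sum_filter_add_sum_filter_not S (fun i => |⟪u i, x⟫| ≤ κ)]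
    have h5 : ∑ i ∈ S with ¬ |⟪u i, x⟫| ≤ κ, ψ ⟪u i, x⟫ = 0 :=
      Finset.sum_eq_zero fun i hi => hz _ (not_le.1 (Finset.mem_filter.1 hi).2)
    rw [h5, add_zero]
    refine (Finset.sum_le_sum fun i _ => h1 _).trans ?_
    simp
  have hf1 : ∀ x, f x ≤ 1 := by
    intro x
    refine (hfle x).trans ?_
    rw [inv_mul_le_iff₀ hn, mul_one]
    exact_mod_cast Finset.card_filter_le _ _
  have hsD : 0 < √(√D) := by positivity
  -- This c makes the Gaussian term the constant (π/2)²/2 ≤ 2, while the linear gain is e0/(2L) over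
  -- the fourth root of D.
  have key := measure_le_half_mean_le hf hg hgb hf0 hf1 (c := (L * √(√D))⁻¹) (by positivity)
  rw [hmean] at key
  refine (measure_mono fun x hx => ?_).trans (key.trans (ENNReal.ofReal_le_ofReal
    (Real.exp_le_exp.2 ?_)))
  · have hx' : ((S.filter fun i => |⟪u i, x⟫| ≤ κ).card : ℝ) < min (1 / 2) (e0 / 2) * S.card := hx
    change f x ≤ e0 / 2
    refine (hfle x).trans ?_
    rw [inv_mul_le_iff₀ hn]
    refine hx'.le.trans ?_
    rw [mul_comm]
    gcongr
    exact min_le_right _ _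
  · have e1 : (L * √(√D))⁻¹ * (Real.pi / 2) * (L * √(√D)) = Real.pi / 2 := by
      field_simp
    have e2 : (L * √(√D))⁻¹ * (e0 / 2) = e0 / (2 * L) / √(√D) := by
      field_simp
    rw [e1, e2]
    have := Real.pi_lt_four
    nlinarith [Real.pi_pos]

/-! ### The thinning chain and its moments -/

section Thinning

open Classical in
/-- The members of `S` whose set contains `x`. -/
noncomputable def thin {ι α : Type*} (A : ι → Set α) (S : Finset ι) (x : α) : Finset ι :=
  S.filter fun i => x ∈ A i

variable {ι α : Type*}

lemma mem_thin {A : ι → Set α} {S : Finset ι} {x : α} {i : ι} :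
    i ∈ thin A S x ↔ i ∈ S ∧ x ∈ A i := by simp [thin]

variable [MeasurableSpace α]

lemma measurableSet_thin_eq [Fintype ι] {A : ι → Set α} (hA : ∀ i, MeasurableSet (A i)) (S S' : Finset ι) :
    MeasurableSet {x | thin A S x = S'} := by
  classical
  have e : {x | thin A S x = S'} = ⋂ i, {x | (i ∈ S ∧ x ∈ A i) ↔ i ∈ S'} := by
    ext x
    simp [Finset.ext_iff, mem_thin]
  rw [e]
  refine MeasurableSet.iInter fun i => ?_
  by_cases h1 : i ∈ S <;> by_cases h2 : i ∈ S' <;> simp only [h1, h2, true_and, false_and, iff_true,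
    iff_false]
  · exact hA i
  · exact (hA i).compl
  · exact MeasurableSet.const _
  · exact MeasurableSet.const _

/-- The transition probability from `S` to `S'` under a random thinning. -/
noncomputable def thinKernel (A : ι → Set α) (μ : Measure α) (S S' : Finset ι) : ℝ :=
  μ.real {x | thin A S x = S'}

variable (A : ι → Set α) (μ : Measure α)

lemma thinKernel_nonneg (S S' : Finset ι) : 0 ≤ thinKernel A μ S S' := measureReal_nonneg

variable [Fintype ι] {A}

lemma sum_thinKernel_mul [IsProbabilityMeasure μ] (hA : ∀ i, MeasurableSet (A i)) (S : Finset ι) (f : Finset ι → ℝ) :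
    ∑ S', thinKernel A μ S S' * f S' = ∫ x, f (thin A S x) ∂μ := by
  classical
  have e : (fun x => f (thin A S x)) =
      fun x => ∑ S', Set.indicator {x | thin A S x = S'} (fun _ => f S') x := by
    funext x
    rw [Finset.sum_eq_single (thin A S x)]
    · rw [Set.indicator_of_mem]; rfl
    · intro S' _ h
      rw [Set.indicator_of_notMem]
      exact fun h' => h (Eq.symm h')
    · simp
  rw [e, integral_finsetSum]
  · refine Finset.sum_congr rfl fun S' _ => ?_
    rw [integral_indicator_const _ (measurableSet_thin_eq hA S S'), smul_eq_mul, thinKernel]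
  · intro S' _
    exact (integrable_const _).indicator (measurableSet_thin_eq hA S S')

lemma sum_thinKernel [IsProbabilityMeasure μ] (hA : ∀ i, MeasurableSet (A i)) (S : Finset ι) :
    ∑ S', thinKernel A μ S S' = 1 := by
  simpa using sum_thinKernel_mul μ hA S fun _ => 1

lemma sum_thinKernel_card [IsProbabilityMeasure μ] (hA : ∀ i, MeasurableSet (A i)) {p : ℝ} (hp : ∀ i, μ.real (A i) = p)
    (S : Finset ι) : ∑ S', thinKernel A μ S S' * (S'.card : ℝ) = p * S.card := by
  classical
  rw [sum_thinKernel_mul μ hA S fun S' => (S'.card : ℝ)]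
  have e : (fun x => ((thin A S x).card : ℝ)) =
      fun x => ∑ i ∈ S, Set.indicator (A i) (fun _ => (1 : ℝ)) x := by
    funext x
    rw [thin, Finset.card_filter]
    push_cast
    exact Finset.sum_congr rfl fun i _ => by simp [Set.indicator_apply]
  rw [e, integral_finsetSum _ fun i _ => (integrable_const _).indicator (hA i)]
  simp [integral_indicator_const _ (hA _), hp, mul_comm]

lemma sum_thinKernel_pair [IsProbabilityMeasure μ] (hA : ∀ i, MeasurableSet (A i)) (S : Finset ι) (c : ι → ι → ℝ) :
    ∑ S', thinKernel A μ S S' * (∑ i ∈ S', ∑ j ∈ S', c i j) =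
      ∑ i ∈ S, ∑ j ∈ S, c i j * μ.real (A i ∩ A j) := by
  classical
  rw [sum_thinKernel_mul μ hA S fun S' => ∑ i ∈ S', ∑ j ∈ S', c i j]
  have e : (fun x => ∑ i ∈ thin A S x, ∑ j ∈ thin A S x, c i j) =
      fun x => ∑ i ∈ S, ∑ j ∈ S, Set.indicator (A i ∩ A j) (fun _ => c i j) x := by
    funext x
    rw [thin, Finset.sum_filter]
    refine Finset.sum_congr rfl fun i _ => ?_
    by_cases hi : x ∈ A i
    · rw [if_pos hi, Finset.sum_filter]
      exact Finset.sum_congr rfl fun j _ => by simp [Set.indicator_apply, hi]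
    · rw [if_neg hi]
      exact (Finset.sum_eq_zero fun j _ => by simp [hi]).symm
  rw [e, integral_finsetSum]
  · refine Finset.sum_congr rfl fun i _ => ?_
    rw [integral_finsetSum _ fun j _ => (integrable_const _).indicator ((hA i).inter (hA j))]
    refine Finset.sum_congr rfl fun j _ => ?_
    rw [integral_indicator_const _ ((hA i).inter (hA j)), smul_eq_mul, mul_comm]
  · intro i _
    exact integrable_finsetSum _ fun j _ => (integrable_const _).indicator ((hA i).inter (hA j))

variable (A)

open Classical in
/-- The law of the set of survivors after `t` independent thinnings of the full set. -/
noncomputable def thinLaw : ℕ → Finset ι → ℝ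
  | 0, S => if S = Finset.univ then 1 else 0
  | t + 1, S' => ∑ S, thinLaw t S * thinKernel A μ S S'

lemma thinLaw_nonneg (t : ℕ) (S : Finset ι) : 0 ≤ thinLaw A μ t S := by
  induction t generalizing S with
  | zero => rw [thinLaw]; split_ifs <;> norm_num
  | succ t ih => exact Finset.sum_nonneg fun S _ => mul_nonneg (ih S) measureReal_nonneg

lemma sum_thinLaw_succ_mul (t : ℕ) (f : Finset ι → ℝ) :
    ∑ S', thinLaw A μ (t + 1) S' * f S' =
      ∑ S, thinLaw A μ t S * ∑ S', thinKernel A μ S S' * f S' := by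
  simp only [thinLaw, Finset.sum_mul, Finset.mul_sum]
  rw [Finset.sum_comm]
  simp only [mul_assoc]

variable {A}

lemma sum_thinLaw [IsProbabilityMeasure μ] (hA : ∀ i, MeasurableSet (A i)) (t : ℕ) : ∑ S, thinLaw A μ t S = 1 := by
  induction t with
  | zero => simp [thinLaw]
  | succ t ih =>
    have := sum_thinLaw_succ_mul A μ t fun _ => 1
    simp only [mul_one, sum_thinKernel μ hA] at this
    rw [this, ih]

lemma sum_thinLaw_card [IsProbabilityMeasure μ] (hA : ∀ i, MeasurableSet (A i)) {p : ℝ} (hp : ∀ i, μ.real (A i) = p)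
    (t : ℕ) : ∑ S, thinLaw A μ t S * (S.card : ℝ) = Fintype.card ι * p ^ t := by
  induction t with
  | zero => simp [thinLaw, Finset.card_univ]
  | succ t ih =>
    rw [sum_thinLaw_succ_mul A μ t fun S => (S.card : ℝ)]
    simp only [sum_thinKernel_card μ hA hp]
    calc _ = p * ∑ S, thinLaw A μ t S * (S.card : ℝ) := by
          rw [Finset.mul_sum]; exact Finset.sum_congr rfl fun S _ => by ring
      _ = _ := by rw [ih]; ring

/-- The induction needs arbitrary weights c, since one thinning step replaces c by c times the pair
survival probability. -/
lemma sum_thinLaw_pair [IsProbabilityMeasure μ] (hA : ∀ i, MeasurableSet (A i)) (t : ℕ) (c : ι → ι → ℝ) :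
    ∑ S, thinLaw A μ t S * (∑ i ∈ S, ∑ j ∈ S, c i j) =
      ∑ i, ∑ j, c i j * μ.real (A i ∩ A j) ^ t := by
  induction t generalizing c with
  | zero => simp [thinLaw]
  | succ t ih =>
    rw [sum_thinLaw_succ_mul A μ t fun S => ∑ i ∈ S, ∑ j ∈ S, c i j]
    simp only [sum_thinKernel_pair μ hA]
    rw [ih]
    exact Finset.sum_congr rfl fun i _ => Finset.sum_congr rfl fun j _ => by ring

variable (A)

/-! ### The killed chain and its inverse moment -/

open Classical in
/-- The thinning chain killed when it leaves the good sets or loses more than a proportion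
`1 - η` of its members in one step. -/
noncomputable def killedLaw (good : ℕ → Finset ι → Prop) (η : ℝ) : ℕ → Finset ι → ℝ
  | 0, S => if S = Finset.univ then 1 else 0
  | t + 1, S' => ∑ S, if good t S ∧ η * S.card ≤ S'.card then
      killedLaw good η t S * thinKernel A μ S S' else 0

variable {good : ℕ → Finset ι → Prop} {η : ℝ}

lemma killedLaw_nonneg (t : ℕ) (S : Finset ι) : 0 ≤ killedLaw A μ good η t S := by
  induction t generalizing S with
  | zero => rw [killedLaw]; split_ifs <;> norm_num
  | succ t ih =>
    refine Finset.sum_nonneg fun S _ => ?_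
    split_ifs
    · exact mul_nonneg (ih S) measureReal_nonneg
    · exact le_rfl

lemma killedLaw_le_thinLaw (t : ℕ) (S : Finset ι) :
    killedLaw A μ good η t S ≤ thinLaw A μ t S := by
  induction t generalizing S with
  | zero => rw [killedLaw, thinLaw]
  | succ t ih =>
    refine Finset.sum_le_sum fun S' _ => ?_
    split_ifs
    · exact mul_le_mul_of_nonneg_right (ih S') measureReal_nonneg
    · exact mul_nonneg (thinLaw_nonneg A μ t S') measureReal_nonneg

/-- As 1/0 = 0, the inverse moment does not see the empty set, so its absence from the killed chain
must be proved separately. A good nonempty set that keeps a fraction η > 0 stays nonempty. -/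
lemma nonempty_of_killedLaw_ne_zero [Nonempty ι] (hη : 0 < η)
    (hgood : ∀ t S, good t S → S.Nonempty) {t : ℕ} {S : Finset ι}
    (h : killedLaw A μ good η t S ≠ 0) : S.Nonempty := by
  cases t with
  | zero =>
    rw [killedLaw] at h
    have : S = Finset.univ := by by_contra h'; simp [h'] at h
    rw [this]; exact Finset.univ_nonempty
  | succ t =>
    rw [killedLaw] at h
    obtain ⟨S', -, hS'⟩ := Finset.exists_ne_zero_of_sum_ne_zero h
    have hc : good t S' ∧ η * S'.card ≤ S.card := by
      by_contra h'; rw [if_neg h'] at hS'; exact hS' rfl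
    have : (0 : ℝ) < S'.card := by exact_mod_cast (hgood t S' hc.1).card_pos
    have : (0 : ℝ) < S.card := lt_of_lt_of_le (by positivity) hc.2
    exact Finset.card_pos.1 (by exact_mod_cast this)

open Classical in
lemma sum_killedLaw_succ_mul (t : ℕ) (f : Finset ι → ℝ) :
    ∑ S', killedLaw A μ good η (t + 1) S' * f S' =
      ∑ S, killedLaw A μ good η t S * (if good t S then
        ∑ S', thinKernel A μ S S' * (if η * S.card ≤ S'.card then f S' else 0) else 0) := by
  simp only [killedLaw, Finset.sum_mul]
  rw [Finset.sum_comm]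
  refine Finset.sum_congr rfl fun S _ => ?_
  by_cases h : good t S
  · simp only [h, true_and, if_true, Finset.mul_sum]
    refine Finset.sum_congr rfl fun S' _ => ?_
    split_ifs <;> ring
  · simp [h]

variable {A}

/-- One step of the inverse first moment of the survivor count. -/
lemma sum_thinKernel_inv_le [IsProbabilityMeasure μ] (hA : ∀ i, MeasurableSet (A i)) {p : ℝ} (hp0 : 0 < p) (hp1 : p ≤ 1)
    (hp : ∀ i, μ.real (A i) = p) (hη : 0 < η) (hη' : η ≤ 1 / 2) {S : Finset ι} (hS : S.Nonempty)
    {V : ℝ}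
    (hV : ∑ i ∈ S, ∑ j ∈ S, (μ.real (A i ∩ A j) - p ^ 2) ≤ V * p ^ 2 * (S.card : ℝ) ^ 2) :
    ∑ S', thinKernel A μ S S' * (if η * S.card ≤ S'.card then p * S.card / S'.card else 0) ≤
      1 + V / η := by
  classical
  have hn : 0 < (S.card : ℝ) := by exact_mod_cast hS.card_pos
  have hpn : 0 < p * S.card := by positivity
  -- With Y = |S'|/(p|S|), the identity 1/Y = 2 - Y + (Y-1)²/Y and Y ≥ η bound 1/Y by a quadratic
  -- polynomial in Y, whose mean involves only the first two moments.
  have hpt : ∀ S' : Finset ι, (if η * S.card ≤ S'.card then p * S.card / S'.card else 0 : ℝ) ≤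
      2 + η⁻¹ - (1 + 2 * η⁻¹) * (p * S.card)⁻¹ * S'.card
        + η⁻¹ * ((p * S.card) ^ 2)⁻¹ * ∑ i ∈ S', ∑ j ∈ S', (1 : ℝ) := by
    intro S'
    have e : 2 + η⁻¹ - (1 + 2 * η⁻¹) * (p * S.card)⁻¹ * S'.card
        + η⁻¹ * ((p * S.card) ^ 2)⁻¹ * ∑ i ∈ S', ∑ j ∈ S', (1 : ℝ) =
        2 - S'.card / (p * S.card) + η⁻¹ * (S'.card / (p * S.card) - 1) ^ 2 := by
      simp only [Finset.sum_const, nsmul_eq_mul, mul_one]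
      field_simp
      ring
    rw [e]
    have hi : 2 ≤ η⁻¹ := by
      rw [le_inv_comm₀ two_pos hη]; linarith
    split_ifs with h
    · set Y := (S'.card : ℝ) / (p * S.card) with hY
      have hYη : η ≤ Y := by
        rw [hY, le_div_iff₀ hpn]
        refine le_trans ?_ h
        have : p * S.card ≤ S.card := by nlinarith
        gcongr
      have hY0 : 0 < Y := hη.trans_le hYη
      have e2 : p * S.card / (S'.card : ℝ) = Y⁻¹ := by rw [hY, inv_div]
      have e3 : Y⁻¹ = 2 - Y + Y⁻¹ * (Y - 1) ^ 2 := by field_simp; ring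
      rw [e2, e3]
      gcongr
    -- On killed transitions the majorant must still be nonnegative: as 1/η ≥ 2 it is at least 2Y² -
    -- 5Y + 4, whose discriminant is negative.
    · nlinarith [sq_nonneg ((S'.card : ℝ) / (p * S.card) - 1),
        sq_nonneg ((S'.card : ℝ) / (p * S.card) - 5 / 4)]
  refine (Finset.sum_le_sum fun S' _ => mul_le_mul_of_nonneg_left (hpt S')
    (thinKernel_nonneg A μ S S')).trans ?_
  have h1 := sum_thinKernel μ hA S
  have h2 := sum_thinKernel_card μ hA hp S
  have h3 := sum_thinKernel_pair μ hA S fun _ _ => 1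
  simp only [one_mul] at h3
  have e : ∑ S', thinKernel A μ S S' * (2 + η⁻¹ - (1 + 2 * η⁻¹) * (p * S.card)⁻¹ * S'.card
        + η⁻¹ * ((p * S.card) ^ 2)⁻¹ * ∑ i ∈ S', ∑ j ∈ S', (1 : ℝ)) =
      (2 + η⁻¹) * (∑ S', thinKernel A μ S S') - (1 + 2 * η⁻¹) * (p * S.card)⁻¹ *
        (∑ S', thinKernel A μ S S' * (S'.card : ℝ)) + η⁻¹ * ((p * S.card) ^ 2)⁻¹ *
        ∑ S', thinKernel A μ S S' * (∑ i ∈ S', ∑ j ∈ S', (1 : ℝ)) := by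
    rw [Finset.mul_sum, Finset.mul_sum, Finset.mul_sum, ← Finset.sum_sub_distrib,
      ← Finset.sum_add_distrib]
    exact Finset.sum_congr rfl fun S' _ => by ring
  rw [e, h1, h2, h3]
  have h4 : ∑ i ∈ S, ∑ j ∈ S, μ.real (A i ∩ A j) ≤ (1 + V) * (p * S.card) ^ 2 := by
    have : ∑ i ∈ S, ∑ j ∈ S, (μ.real (A i ∩ A j) - p ^ 2) =
        ∑ i ∈ S, ∑ j ∈ S, μ.real (A i ∩ A j) - (p * S.card) ^ 2 := by
      simp only [Finset.sum_sub_distrib, Finset.sum_const, nsmul_eq_mul]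
      ring
    rw [this] at hV
    linarith
  calc _ ≤ (2 + η⁻¹) * 1 - (1 + 2 * η⁻¹) * (p * S.card)⁻¹ * (p * S.card) +
        η⁻¹ * ((p * S.card) ^ 2)⁻¹ * ((1 + V) * (p * S.card) ^ 2) := by gcongr
    _ = _ := by field_simp; ring

lemma killedLaw_inv_moment_succ_le [IsProbabilityMeasure μ] (hA : ∀ i, MeasurableSet (A i)) {p : ℝ} (hp0 : 0 < p)
    (hp1 : p ≤ 1) (hp : ∀ i, μ.real (A i) = p) (hη : 0 < η) (hη' : η ≤ 1 / 2)
    (hgood : ∀ t S, good t S → S.Nonempty) {t : ℕ} {V : ℝ} (hV0 : 0 ≤ V)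
    (hV : ∀ S, good t S →
      ∑ i ∈ S, ∑ j ∈ S, (μ.real (A i ∩ A j) - p ^ 2) ≤ V * p ^ 2 * (S.card : ℝ) ^ 2) :
    ∑ S, killedLaw A μ good η (t + 1) S * (Fintype.card ι * p ^ (t + 1) / S.card) ≤
      (1 + V / η) * ∑ S, killedLaw A μ good η t S * (Fintype.card ι * p ^ t / S.card) := by
  classical
  rw [sum_killedLaw_succ_mul A μ t fun S => (Fintype.card ι * p ^ (t + 1) / S.card : ℝ),
    Finset.mul_sum]
  refine Finset.sum_le_sum fun S _ => ?_
  have h0 := killedLaw_nonneg A μ (good := good) (η := η) t S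
  rw [mul_left_comm]
  refine mul_le_mul_of_nonneg_left ?_ h0
  have hV1 : 0 ≤ 1 + V / η := by positivity
  split_ifs with h
  · have hS := hgood t S h
    have hn : 0 < (S.card : ℝ) := by exact_mod_cast hS.card_pos
    have h1 := sum_thinKernel_inv_le μ hA hp0 hp1 hp hη hη' hS (hV S h)
    have e : ∑ S', thinKernel A μ S S' * (if η * S.card ≤ S'.card then
          (Fintype.card ι * p ^ (t + 1) / S'.card : ℝ) else 0) =
        (Fintype.card ι * p ^ t / S.card) * ∑ S', thinKernel A μ S S' *
          (if η * S.card ≤ S'.card then p * S.card / S'.card else 0) := by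
      rw [Finset.mul_sum]
      refine Finset.sum_congr rfl fun S' _ => ?_
      split_ifs
      · rw [pow_succ]
        field_simp
      · ring
    rw [e, mul_comm]
    gcongr
  · positivity

lemma killedLaw_inv_moment_le [IsProbabilityMeasure μ] [Nonempty ι] (hA : ∀ i, MeasurableSet (A i)) {p : ℝ} (hp0 : 0 < p)
    (hp1 : p ≤ 1) (hp : ∀ i, μ.real (A i) = p) (hη : 0 < η) (hη' : η ≤ 1 / 2)
    (hgood : ∀ t S, good t S → S.Nonempty) {V : ℕ → ℝ} (hV0 : ∀ t, 0 ≤ V t)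
    (hV : ∀ t S, good t S →
      ∑ i ∈ S, ∑ j ∈ S, (μ.real (A i ∩ A j) - p ^ 2) ≤ V t * p ^ 2 * (S.card : ℝ) ^ 2) (t : ℕ) :
    ∑ S, killedLaw A μ good η t S * (Fintype.card ι * p ^ t / S.card) ≤
      ∏ s ∈ Finset.range t, (1 + V s / η) := by
  induction t with
  | zero => simp [killedLaw, Finset.card_univ]
  | succ t ih =>
    rw [Finset.prod_range_succ, mul_comm (∏ s ∈ Finset.range t, (1 + V s / η))]
    refine (killedLaw_inv_moment_succ_le μ hA hp0 hp1 hp hη hη' hgood (hV0 t) (hV t)).trans ?_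
    have := hV0 t
    gcongr

open Classical in
/-- The mass that the killed chain loses. -/
lemma killedLaw_mass_ge [IsProbabilityMeasure μ] (hA : ∀ i, MeasurableSet (A i)) {J B : ℕ → ℝ}
    (hJ0 : ∀ t, 0 ≤ J t)
    (hJ : ∀ t S, good t S →
      ∑ S', thinKernel A μ S S' * (if η * S.card ≤ (S'.card : ℝ) then 0 else 1) ≤ J t)
    (hB : ∀ t, ∑ S, killedLaw A μ good η t S * (if good t S then 0 else 1) ≤ B t) (t : ℕ) :
    1 - ∑ s ∈ Finset.range t, (B s + J s) ≤ ∑ S, killedLaw A μ good η t S := by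
  induction t with
  | zero => simp [killedLaw]
  | succ t ih =>
    have h1 := sum_killedLaw_succ_mul A μ (good := good) (η := η) t fun _ => 1
    simp only [mul_one] at h1
    rw [h1, Finset.sum_range_succ]
    have h2 : ∑ S, killedLaw A μ good η t S ≤ 1 := by
      rw [← sum_thinLaw μ hA t]
      exact Finset.sum_le_sum fun S _ => killedLaw_le_thinLaw A μ t S
    have h3 : ∑ S, killedLaw A μ good η t S * (1 - (if good t S then 0 else 1) - J t) ≤
        ∑ S, killedLaw A μ good η t S * (if good t S then
        ∑ S', thinKernel A μ S S' * (if η * S.card ≤ (S'.card : ℝ) then 1 else 0) else 0) := by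
      refine Finset.sum_le_sum fun S _ => mul_le_mul_of_nonneg_left ?_
        (killedLaw_nonneg A μ t S)
      split_ifs with h
      · have h4 := hJ t S h
        have h5 := sum_thinKernel μ hA S
        have h6 : ∑ S', thinKernel A μ S S' * (if η * S.card ≤ (S'.card : ℝ) then 0 else 1) +
            ∑ S', thinKernel A μ S S' * (if η * S.card ≤ (S'.card : ℝ) then 1 else 0) = 1 := by
          rw [← Finset.sum_add_distrib]
          refine Eq.trans ?_ h5
          exact Finset.sum_congr rfl fun S' _ => by split_ifs <;> ring
        linarith
      · linarith [hJ0 t]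
    have h7 : ∑ S, killedLaw A μ good η t S * (1 - (if good t S then 0 else 1) - J t) =
        (1 - J t) * (∑ S, killedLaw A μ good η t S) -
          ∑ S, killedLaw A μ good η t S * (if good t S then 0 else 1) := by
      rw [Finset.mul_sum, ← Finset.sum_sub_distrib]
      exact Finset.sum_congr rfl fun S _ => by ring
    have h8 := hB t
    have h9 : J t * ∑ S, killedLaw A μ good η t S ≤ J t * 1 :=
      mul_le_mul_of_nonneg_left h2 (hJ0 t)
    linarith

end Thinning

/-! ### Lower tail of an abstract thinning chain -/

section Tail

variable {ι α : Type*} [MeasurableSpace α] [Fintype ι] {A : ι → Set α} (μ : Measure α)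

open Classical in
/-- Mean square overlaps of the survivors are small outside an event controlled by the
expected number of pairs with a large overlap. -/
lemma thinLaw_bad_overlap_le [IsProbabilityMeasure μ] [Nonempty ι]
    (hA : ∀ i, MeasurableSet (A i)) {p : ℝ} (hp0 : 0 < p) {o : ι → ι → ℝ}
    (ho : ∀ i j, |o i j| ≤ 1) {ω d : ℝ} (hω : 0 < ω) (hd : 0 < d) (t : ℕ) :
    ∑ S, thinLaw A μ t S * (if ω * (Fintype.card ι * p ^ t) ≤ S.card ∧
      ¬ ∑ i ∈ S, ∑ j ∈ S, o i j ^ 2 ≤ 2 * d * (S.card : ℝ) ^ 2 then 1 else 0) ≤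
    (d * ω ^ 2)⁻¹ * ∑ i, ∑ j, (if d < o i j ^ 2 then
      (μ.real (A i ∩ A j) / p ^ 2) ^ t / (Fintype.card ι : ℝ) ^ 2 else 0) := by
  set c : ι → ι → ℝ := fun i j => if d < o i j ^ 2 then 1 else 0 with hc
  set n : ℝ := (Fintype.card ι : ℝ) with hn
  have hn0 : 0 < n := by rw [hn]; exact_mod_cast Fintype.card_pos
  -- As o² ≤ d + 1_{o² > d}, a mean square overlap above 2d forces more than d|S|² pairs with o² >
  -- d. The lower bound on |S| turns this into a deterministic threshold, ready for Markov.
  have hpt : ∀ S : Finset ι, (if ω * (n * p ^ t) ≤ S.card ∧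
      ¬ ∑ i ∈ S, ∑ j ∈ S, o i j ^ 2 ≤ 2 * d * (S.card : ℝ) ^ 2 then 1 else 0 : ℝ) ≤
      (d * ω ^ 2 * (n * p ^ t) ^ 2)⁻¹ * ∑ i ∈ S, ∑ j ∈ S, c i j := by
    intro S
    split_ifs with h
    · obtain ⟨h1, h2⟩ := h
      have h3 : ∑ i ∈ S, ∑ j ∈ S, o i j ^ 2 ≤ ∑ i ∈ S, ∑ j ∈ S, (d + c i j) := by
        refine Finset.sum_le_sum fun i _ => Finset.sum_le_sum fun j _ => ?_
        simp only [hc]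
        split_ifs with h
        · have := (sq_le_one_iff_abs_le_one (o i j)).2 (ho i j); linarith
        · linarith
      have h4 : ∑ i ∈ S, ∑ j ∈ S, (d + c i j) =
          d * (S.card : ℝ) ^ 2 + ∑ i ∈ S, ∑ j ∈ S, c i j := by
        simp only [Finset.sum_add_distrib, Finset.sum_const, nsmul_eq_mul]
        ring
      have h5 : (ω * (n * p ^ t)) ^ 2 ≤ (S.card : ℝ) ^ 2 :=
        pow_le_pow_left₀ (by positivity) h1 2
      rw [le_inv_mul_iff₀ (by positivity), mul_one]
      nlinarith
    · refine mul_nonneg (by positivity) (Finset.sum_nonneg fun i _ => Finset.sum_nonneg fun j _ => ?_)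
      simp only [hc]
      split_ifs <;> norm_num
  refine (Finset.sum_le_sum fun S _ => mul_le_mul_of_nonneg_left (hpt S)
    (thinLaw_nonneg A μ t S)).trans ?_
  have h6 := sum_thinLaw_pair μ hA t c
  have e : ∑ S, thinLaw A μ t S * ((d * ω ^ 2 * (n * p ^ t) ^ 2)⁻¹ * ∑ i ∈ S, ∑ j ∈ S, c i j) =
      (d * ω ^ 2 * (n * p ^ t) ^ 2)⁻¹ * ∑ S, thinLaw A μ t S * ∑ i ∈ S, ∑ j ∈ S, c i j := by
    rw [Finset.mul_sum]
    exact Finset.sum_congr rfl fun S _ => by ring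
  rw [e, h6]
  refine le_of_eq ?_
  rw [Finset.mul_sum, Finset.mul_sum]
  refine Finset.sum_congr rfl fun i _ => ?_
  rw [Finset.mul_sum, Finset.mul_sum]
  refine Finset.sum_congr rfl fun j _ => ?_
  simp only [hc]
  split_ifs
  · rw [div_pow]
    field_simp
    ring
  · ring

open Classical in
/-- The lower tail of the number of survivors. -/
theorem thinLaw_lower_tail [IsProbabilityMeasure μ] [Nonempty ι]
    (hA : ∀ i, MeasurableSet (A i)) {p η C : ℝ} (hp0 : 0 < p) (hp1 : p ≤ 1)
    (hp : ∀ i, μ.real (A i) = p) (hη : 0 < η) (hη' : η ≤ 1 / 2) (hC : 0 ≤ C) {o : ι → ι → ℝ}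
    (hQ : ∀ i j, μ.real (A i ∩ A j) - p ^ 2 ≤ C * p ^ 2 * o i j ^ 2)
    {ω D r J : ℕ → ℝ} (hω : ∀ t, 0 < ω t) (hD : ∀ t, 0 ≤ D t) (hJ0 : ∀ t, 0 ≤ J t)
    (hr : ∀ t, ∑ S, thinLaw A μ t S * (if ω t * (Fintype.card ι * p ^ t) ≤ S.card ∧
      ¬ ∑ i ∈ S, ∑ j ∈ S, o i j ^ 2 ≤ D t * (S.card : ℝ) ^ 2 then 1 else 0) ≤ r t)
    (hJ : ∀ t S, S.Nonempty → ∑ i ∈ S, ∑ j ∈ S, o i j ^ 2 ≤ D t * (S.card : ℝ) ^ 2 →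
      μ.real {x | ((thin A S x).card : ℝ) < η * S.card} ≤ J t) (T : ℕ) :
    ∑ S, thinLaw A μ T S * (if ω T * (Fintype.card ι * p ^ T) ≤ S.card then 0 else 1) ≤
      ∑ t ∈ Finset.range (T + 1),
        (ω t * ∏ s ∈ Finset.range t, (1 + C * D s / η) + r t + J t) := by
  set n : ℝ := (Fintype.card ι : ℝ) with hn
  have hn0 : 0 < n := by rw [hn]; exact_mod_cast Fintype.card_pos
  set good : ℕ → Finset ι → Prop := fun t S => ω t * (n * p ^ t) ≤ S.card ∧
    ∑ i ∈ S, ∑ j ∈ S, o i j ^ 2 ≤ D t * (S.card : ℝ) ^ 2 with hgooddef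
  have hgood : ∀ t S, good t S → S.Nonempty := by
    intro t S h
    have : (0 : ℝ) < S.card := lt_of_lt_of_le (by have := hω t; positivity) h.1
    exact Finset.card_pos.1 (by exact_mod_cast this)
  have hV : ∀ t S, good t S → ∑ i ∈ S, ∑ j ∈ S, (μ.real (A i ∩ A j) - p ^ 2) ≤
      (C * D t) * p ^ 2 * (S.card : ℝ) ^ 2 := by
    intro t S h
    refine (Finset.sum_le_sum fun i _ => Finset.sum_le_sum fun j _ => hQ i j).trans ?_
    simp only [← Finset.mul_sum]
    calc _ ≤ C * p ^ 2 * (D t * (S.card : ℝ) ^ 2) := by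
          have := h.2
          gcongr
      _ = _ := by ring
  have hmom := killedLaw_inv_moment_le μ hA hp0 hp1 hp hη hη' hgood
    (fun t => mul_nonneg hC (hD t)) hV
  -- A set fails to be good either by being small, which is Markov for the inverse moment of the
  -- killed chain, or by being large with large overlaps, which is charged to the unkilled law.
  have hB : ∀ t, ∑ S, killedLaw A μ good η t S * (if good t S then 0 else 1) ≤
      ω t * ∏ s ∈ Finset.range t, (1 + C * D s / η) + r t := by
    intro t
    have h1 : ∀ S, killedLaw A μ good η t S * (if good t S then 0 else 1) ≤
        ω t * (killedLaw A μ good η t S * (n * p ^ t / S.card)) +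
        thinLaw A μ t S * (if ω t * (n * p ^ t) ≤ S.card ∧
          ¬ ∑ i ∈ S, ∑ j ∈ S, o i j ^ 2 ≤ D t * (S.card : ℝ) ^ 2 then 1 else 0) := by
      intro S
      have k0 := killedLaw_nonneg A μ (good := good) (η := η) t S
      have kl := killedLaw_le_thinLaw A μ (good := good) (η := η) t S
      have t0 := thinLaw_nonneg A μ t S
      have w0 := hω t
      have a0 : 0 ≤ ω t * (killedLaw A μ good η t S * (n * p ^ t / S.card)) := by positivity
      by_cases hW : ω t * (n * p ^ t) ≤ S.card
      · by_cases hO : ∑ i ∈ S, ∑ j ∈ S, o i j ^ 2 ≤ D t * (S.card : ℝ) ^ 2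
        · have : good t S := ⟨hW, hO⟩
          simp only [this, if_true, mul_zero, hO, not_true, and_false, if_false, add_zero]
          exact a0
        · have : ¬ good t S := fun h => hO h.2
          rw [if_neg this, if_pos ⟨hW, hO⟩]
          linarith
      · have : ¬ good t S := fun h => hW h.1
        rw [if_neg this, if_neg fun h => hW h.1, mul_one, mul_zero, add_zero]
        rcases k0.eq_or_lt with h0 | h0
        · rw [← h0]; simp
        · have hS := nonempty_of_killedLaw_ne_zero A μ hη hgood h0.ne'
          have hc : (0 : ℝ) < S.card := by exact_mod_cast hS.card_pos
          have h2 : 1 ≤ ω t * (n * p ^ t) / S.card := by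
            rw [one_le_div hc]; exact (not_le.1 hW).le
          calc _ = killedLaw A μ good η t S * 1 := (mul_one _).symm
            _ ≤ killedLaw A μ good η t S * (ω t * (n * p ^ t) / S.card) := by gcongr
            _ = _ := by ring
    refine (Finset.sum_le_sum fun S _ => h1 S).trans ?_
    rw [Finset.sum_add_distrib, ← Finset.mul_sum]
    have := hω t
    have := hmom t
    have := hr t
    gcongr
  have hJ' : ∀ t S, good t S →
      ∑ S', thinKernel A μ S S' * (if η * S.card ≤ (S'.card : ℝ) then 0 else 1) ≤ J t := by
    intro t S h
    refine le_trans (le_of_eq ?_) (hJ t S (hgood t S h) h.2)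
    rw [sum_thinKernel_mul μ hA S fun S' => if η * S.card ≤ (S'.card : ℝ) then (0 : ℝ) else 1]
    have hm : MeasurableSet {x | ((thin A S x).card : ℝ) < η * S.card} := by
      have e : {x | ((thin A S x).card : ℝ) < η * S.card} =
          ⋃ S' : Finset ι, ⋃ (_ : (S'.card : ℝ) < η * S.card), {x | thin A S x = S'} := by
        ext x; simp
      rw [e]
      exact MeasurableSet.iUnion fun S' => MeasurableSet.iUnion fun _ =>
        measurableSet_thin_eq hA S S'
    have hi := integral_indicator_const (μ := μ) (1 : ℝ) hm
    rw [smul_eq_mul, mul_one] at hi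
    rw [← hi]
    refine integral_congr_ae (Eventually.of_forall fun x => ?_)
    simp only [Set.indicator_apply, Set.mem_ofPred_eq, ← not_le, ite_not]
  have hmass := killedLaw_mass_ge μ hA hJ0 hJ' (fun t => by convert hB t) T
  -- Killed mass sitting on good sets at time T is true mass sitting on large sets.
  have h3 : ∑ S, killedLaw A μ good η T S - ∑ S, killedLaw A μ good η T S *
      (if good T S then 0 else 1) ≤ ∑ S, thinLaw A μ T S -
        ∑ S, thinLaw A μ T S * (if ω T * (n * p ^ T) ≤ S.card then 0 else 1) := by
    rw [← Finset.sum_sub_distrib, ← Finset.sum_sub_distrib]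
    refine Finset.sum_le_sum fun S _ => ?_
    have kl := killedLaw_le_thinLaw A μ (good := good) (η := η) T S
    have t0 := thinLaw_nonneg A μ T S
    by_cases hg : good T S
    · rw [if_pos hg, if_pos hg.1]; linarith
    · rw [if_neg hg]; split_ifs <;> linarith
  rw [sum_thinLaw μ hA T] at h3
  have hBT := hB T
  -- The steps before T cost B + J each. Being good at time T costs one further B, and the unneeded
  -- J at T is simply added.
  rw [Finset.sum_range_succ]
  have := hJ0 T
  linarith

end Tail

/-! ### Entropy estimates for pairs with large overlap -/

section Counting

/-- A single term of the binomial expansion of (β + (1 - β))^N = 1, at β = k/N. -/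
lemma choose_le_exp_binEntropy {N k : ℕ} (hN : 0 < N) (hk : k ≤ N) :
    (N.choose k : ℝ) ≤ Real.exp (N * Real.binEntropy (k / N)) := by
  have hN' : (0 : ℝ) < N := by exact_mod_cast hN
  rcases Nat.eq_zero_or_pos k with rfl | hk0
  · simp
  rcases hk.eq_or_lt with rfl | hkN
  · rw [div_self hN'.ne']; simp
  set β : ℝ := k / N with hβ
  have hβ0 : 0 < β := by
    have : (0 : ℝ) < k := by exact_mod_cast hk0
    positivity
  have hβ1 : β < 1 := by rw [hβ, div_lt_one hN']; exact_mod_cast hkN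
  have h1 : β ^ k * (1 - β) ^ (N - k) * N.choose k ≤ 1 := by
    have := add_pow β (1 - β) N
    rw [add_sub_cancel, one_pow] at this
    have h1β : 0 < 1 - β := by linarith
    exact le_trans (Finset.single_le_sum
      (f := fun m => β ^ m * (1 - β) ^ (N - m) * (N.choose m : ℝ)) (fun m _ => by positivity)
      (Finset.mem_range.2 (by omega : k < N + 1))) this.ge
  have h2 : β ^ k * (1 - β) ^ (N - k) = Real.exp (-(N * Real.binEntropy β)) := by
    have e1 : β ^ k = Real.exp (k * Real.log β) := by
      rw [Real.exp_nat_mul, Real.exp_log hβ0]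
    have e2 : (1 - β) ^ (N - k) = Real.exp ((N - k : ℕ) * Real.log (1 - β)) := by
      rw [Real.exp_nat_mul, Real.exp_log (by linarith)]
    rw [e1, e2, ← Real.exp_add, Real.binEntropy, Real.log_inv, Real.log_inv, Nat.cast_sub hk]
    congr 1
    have : (k : ℝ) = N * β := by rw [hβ]; field_simp
    rw [this]; ring
  rw [h2, Real.exp_neg, inv_mul_le_iff₀ (Real.exp_pos _), mul_one] at h1
  exact h1

/-- The set of coordinates where two sign patterns agree. -/
def agree {N : ℕ} (s s' : Fin N → Bool) : Finset (Fin N) := Finset.univ.filter fun l => s l = s' l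

/-- For fixed s, a pattern is determined by the set of coordinates where it agrees with s, so the
sum runs over subsets of the coordinates. -/
lemma sum_agree {N : ℕ} (s : Fin N → Bool) (G : ℕ → ℝ) :
    ∑ s', G (agree s s').card = ∑ k ∈ Finset.range (N + 1), (N.choose k : ℝ) * G k := by
  have h1 : ∑ s', G (agree s s').card = ∑ T : Finset (Fin N), G T.card := by
    refine Fintype.sum_bijective (agree s) ⟨fun a b hab => ?_, fun T => ?_⟩ _ _ fun _ => rfl
    · funext l
      have := Finset.ext_iff.1 hab l
      simp only [agree, Finset.mem_filter, Finset.mem_univ, true_and] at this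
      revert this
      cases s l <;> cases a l <;> cases b l <;> simp
    · refine ⟨fun l => if l ∈ T then s l else !s l, ?_⟩
      ext l
      by_cases h : l ∈ T <;> simp [agree, h]
  rw [h1, ← Finset.powerset_univ, Finset.sum_powerset_apply_card]
  simp

/-- Because q ≥ p², the power is largest at t = αN. One exponent F with the final density thus
serves all earlier times. -/
lemma q_pow_choose_le {κ α : ℝ} (hκ : 0 < κ) {N k t : ℕ} (hN : 0 < N) (hk : k ≤ N)
    (ht : (t : ℝ) ≤ α * N) :
    (N.choose k : ℝ) * (q κ (k / N) / p κ ^ 2) ^ t ≤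
      2 ^ N * Real.exp (N * (F κ α (k / N) - F κ α (1 / 2))) := by
  have hN' : (0 : ℝ) < N := by exact_mod_cast hN
  have hp := p_pos hκ
  have hβ0 : (0 : ℝ) ≤ k / N := by positivity
  have hβ1 : (k / N : ℝ) ≤ 1 := by rw [div_le_one hN']; exact_mod_cast hk
  have hq := q_pos hκ hβ0 hβ1
  have hq2 := sq_le_q hκ hβ0 hβ1
  have hlog : 0 ≤ Real.log (q κ (k / N) / p κ ^ 2) :=
    Real.log_nonneg (by rw [one_le_div (by positivity)]; exact hq2)
  have h1 : (q κ (k / N) / p κ ^ 2) ^ t ≤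
      Real.exp (α * N * Real.log (q κ (k / N) / p κ ^ 2)) := by
    rw [← Real.exp_log (show 0 < q κ (k / N) / p κ ^ 2 by positivity), ← Real.exp_nat_mul,
      Real.exp_log (by positivity)]
    gcongr
  have h2 : (2 : ℝ) ^ N = Real.exp (N * Real.log 2) := by
    rw [Real.exp_nat_mul, Real.exp_log two_pos]
  calc _ ≤ Real.exp (N * Real.binEntropy (k / N)) *
        Real.exp (α * N * Real.log (q κ (k / N) / p κ ^ 2)) :=
        mul_le_mul (choose_le_exp_binEntropy hN hk) h1 (by positivity) (Real.exp_pos _).le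
    _ = _ := by
        rw [h2, ← Real.exp_add, ← Real.exp_add, F_half hκ, F, Real.log_div hq.ne' (by positivity),
          Real.log_pow]
        congr 1
        push_cast
        ring

-- There are N + 1 possible agreements. Each contributes at most ξ after normalisation by 4^N, and
-- every row has the same sum.
open Classical in
lemma sum_large_overlap_le {κ α : ℝ} (hκ : 0 < κ) {N t : ℕ} (hN : 0 < N)
    (ht : (t : ℝ) ≤ α * N) {d ξ : ℝ}
    (hξ : ∀ β : ℝ, 0 ≤ β → β ≤ 1 → d < (2 * β - 1) ^ 2 →
      Real.exp (N * (F κ α β - F κ α (1 / 2))) ≤ ξ) (hξ0 : 0 ≤ ξ) :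
    ∑ s : Fin N → Bool, ∑ s' : Fin N → Bool,
      (if d < (2 * ((agree s s').card / N : ℝ) - 1) ^ 2 then
        (q κ ((agree s s').card / N) / p κ ^ 2) ^ t / (Fintype.card (Fin N → Bool) : ℝ) ^ 2
        else 0) ≤ (N + 1) * ξ := by
  have hN' : (0 : ℝ) < N := by exact_mod_cast hN
  have hcard : (Fintype.card (Fin N → Bool) : ℝ) = 2 ^ N := by simp
  have hrow : ∀ s : Fin N → Bool, ∑ s' : Fin N → Bool,
      (if d < (2 * ((agree s s').card / N : ℝ) - 1) ^ 2 then
        (q κ ((agree s s').card / N) / p κ ^ 2) ^ t / (Fintype.card (Fin N → Bool) : ℝ) ^ 2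
        else 0) ≤ (N + 1) * ξ / 2 ^ N := by
    intro s
    rw [sum_agree s fun k => if d < (2 * (k / N : ℝ) - 1) ^ 2 then
        (q κ (k / N) / p κ ^ 2) ^ t / (Fintype.card (Fin N → Bool) : ℝ) ^ 2 else 0]
    have h1 : ∀ k ∈ Finset.range (N + 1), (N.choose k : ℝ) *
        (if d < (2 * (k / N : ℝ) - 1) ^ 2 then
        (q κ (k / N) / p κ ^ 2) ^ t / (Fintype.card (Fin N → Bool) : ℝ) ^ 2 else 0) ≤
        ξ / 2 ^ N := by
      intro k hk
      have hkN : k ≤ N := by have := Finset.mem_range.1 hk; omega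
      split_ifs with h
      · have h2 := q_pow_choose_le hκ hN hkN ht
        have h3 := hξ (k / N) (by positivity) (by rw [div_le_one hN']; exact_mod_cast hkN) h
        rw [hcard, ← mul_div_assoc, div_le_div_iff₀ (by positivity) (by positivity)]
        have h4 : (N.choose k : ℝ) * (q κ (k / N) / p κ ^ 2) ^ t ≤ 2 ^ N * ξ :=
          h2.trans (by gcongr)
        calc _ ≤ 2 ^ N * ξ * 2 ^ N := by gcongr
          _ = _ := by ring
      · rw [mul_zero]; positivity
    refine (Finset.sum_le_sum h1).trans (le_of_eq ?_)
    rw [Finset.sum_const, Finset.card_range, nsmul_eq_mul]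
    push_cast; ring
  refine (Finset.sum_le_sum fun s _ => hrow s).trans (le_of_eq ?_)
  rw [Finset.sum_const, Finset.card_univ, nsmul_eq_mul, hcard]
  field_simp

end Counting

/-! ### The cube as a thinning chain -/

section Cube

variable {N : ℕ}

/-- The vertex of the cube with a given sign pattern. -/
noncomputable def signVec (s : Fin N → Bool) : EuclideanSpace ℝ (Fin N) :=
  WithLp.toLp 2 fun l => if s l then 1 else -1

/-- The normalized vertex of the cube. -/
noncomputable def unitSign (s : Fin N → Bool) : EuclideanSpace ℝ (Fin N) :=
  (√(N : ℝ))⁻¹ • signVec s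

/-- The vectors `x` whose slab contains a given vertex. -/
def dualSlab (κ : ℝ) (s : Fin N → Bool) : Set (EuclideanSpace ℝ (Fin N)) :=
  {x | |⟪unitSign s, x⟫| ≤ κ}

lemma inner_signVec (s s' : Fin N → Bool) :
    ⟪signVec s, signVec s'⟫ = 2 * ((agree s s').card : ℝ) - N := by
  have h : ∀ l, (if s l then (1 : ℝ) else -1) * (if s' l then 1 else -1) =
      2 * (if s l = s' l then 1 else 0) - 1 := by
    intro l
    cases s l <;> cases s' l <;> norm_num
  have e : ⟪signVec s, signVec s'⟫ =
      ∑ l, (if s l then (1 : ℝ) else -1) * (if s' l then 1 else -1) := by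
    rw [PiLp.inner_apply]
    exact Finset.sum_congr rfl fun l _ => by simp [signVec, mul_comm]
  rw [e, Finset.sum_congr rfl fun l _ => h l, Finset.sum_sub_distrib, ← Finset.mul_sum, agree,
    Finset.card_filter]
  simp

lemma inner_unitSign (hN : 0 < N) (s s' : Fin N → Bool) :
    ⟪unitSign s, unitSign s'⟫ = 2 * ((agree s s').card / N : ℝ) - 1 := by
  have hN' : (0 : ℝ) < N := by exact_mod_cast hN
  rw [unitSign, unitSign, real_inner_smul_left, real_inner_smul_right, inner_signVec,
    ← mul_assoc, ← mul_inv, Real.mul_self_sqrt hN'.le]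
  field_simp

lemma norm_unitSign (hN : 0 < N) (s : Fin N → Bool) : ‖unitSign s‖ = 1 := by
  have hN' : (0 : ℝ) < N := by exact_mod_cast hN
  have h : (agree s s).card = N := by simp [agree]
  have h2 := inner_unitSign hN s s
  rw [h, div_self hN'.ne', real_inner_self_eq_norm_sq] at h2
  rw [← sq_eq_sq₀ (norm_nonneg _) zero_le_one]
  linarith

lemma measurableSet_dualSlab (κ : ℝ) (s : Fin N → Bool) : MeasurableSet (dualSlab κ s) :=
  measurableSet_abs_inner_le _ κ

lemma stdGaussian_dualSlab (κ : ℝ) (hN : 0 < N) (s : Fin N → Bool) :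
    (stdGaussian (EuclideanSpace ℝ (Fin N))).real (dualSlab κ s) = p κ :=
  (p_eq_stdGaussian κ (norm_unitSign hN s)).symm

lemma stdGaussian_dualSlab_inter (κ : ℝ) (hN : 0 < N) (s s' : Fin N → Bool) :
    (stdGaussian (EuclideanSpace ℝ (Fin N))).real (dualSlab κ s ∩ dualSlab κ s') =
      q κ ((agree s s').card / N) :=
  (q_eq_stdGaussian κ (norm_unitSign hN s) (norm_unitSign hN s') (inner_unitSign hN s s')).symm

lemma agree_div_mem (hN : 0 < N) (s s' : Fin N → Bool) :
    (0 : ℝ) ≤ (agree s s').card / N ∧ ((agree s s').card / N : ℝ) ≤ 1 := by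
  have hN' : (0 : ℝ) < N := by exact_mod_cast hN
  refine ⟨by positivity, ?_⟩
  rw [div_le_one hN']
  have := Finset.card_le_univ (agree s s')
  rw [Fintype.card_fin] at this
  exact_mod_cast this

open Classical in
/-- The lower tail of the number of solutions, with free parameters. -/
theorem cube_lower_tail {κ α C η b : ℝ} (hκ : 0 < κ) (hC : 0 < C)
    (hCq : ∀ β, 0 ≤ β → β ≤ 1 → q κ β - p κ ^ 2 ≤ C * (2 * β - 1) ^ 2)
    (hη : 0 < η) (hη' : η ≤ 1 / 2)
    (hslab : ∀ (S : Finset (Fin N → Bool)) (u : (Fin N → Bool) → EuclideanSpace ℝ (Fin N)) (D : ℝ),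
      S.Nonempty → (∀ i ∈ S, ‖u i‖ = 1) → 0 < D →
      ∑ i ∈ S, ∑ j ∈ S, ⟪u i, u j⟫ ^ 2 ≤ D * (S.card : ℝ) ^ 2 →
      stdGaussian (EuclideanSpace ℝ (Fin N))
        {x | ((S.filter fun i => |⟪u i, x⟫| ≤ κ).card : ℝ) < η * S.card} ≤
        ENNReal.ofReal (Real.exp (2 - b / √(√D))))
    (hN : 0 < N) {ω d : ℕ → ℝ} (hω : ∀ t, 0 < ω t) (hd : ∀ t, 0 < d t) {ξ : ℕ → ℝ} {T : ℕ}
    (hT : (T : ℝ) ≤ α * N) (hξ0 : ∀ t, 0 ≤ ξ t)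
    (hξ : ∀ t ≤ T, ∀ β : ℝ, 0 ≤ β → β ≤ 1 → d t < (2 * β - 1) ^ 2 →
      Real.exp (N * (F κ α β - F κ α (1 / 2))) ≤ ξ t) :
    ∑ S, thinLaw (dualSlab κ) (stdGaussian (EuclideanSpace ℝ (Fin N))) T S *
        (if ω T * (2 ^ N * p κ ^ T) ≤ S.card then 0 else 1) ≤
      ∑ t ∈ Finset.range (T + 1),
        (ω t * ∏ s ∈ Finset.range t, (1 + C / p κ ^ 2 * (2 * d s) / η) +
          (d t * ω t ^ 2)⁻¹ * ((N + 1) * ξ t) + Real.exp (2 - b / √(√(2 * d t)))) := by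
  have hp := p_pos hκ
  set μ := stdGaussian (EuclideanSpace ℝ (Fin N)) with hμ
  have hA : ∀ s : Fin N → Bool, MeasurableSet (dualSlab κ s) := measurableSet_dualSlab κ
  set o : (Fin N → Bool) → (Fin N → Bool) → ℝ := fun s s' => ⟪unitSign s, unitSign s'⟫ with ho
  have ho1 : ∀ s s', |o s s'| ≤ 1 := by
    intro s s'
    have := abs_real_inner_le_norm (unitSign s) (unitSign s')
    rwa [norm_unitSign hN, norm_unitSign hN, one_mul] at this
  have hcard : (Fintype.card (Fin N → Bool) : ℝ) = 2 ^ N := by simp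
  have key := thinLaw_lower_tail μ hA hp (p_lt_one hκ).le (stdGaussian_dualSlab κ hN) hη hη'
    (C := C / p κ ^ 2) (by positivity) (o := o) ?_ hω (D := fun t => 2 * d t)
    (fun t => by have := hd t; positivity) (J := fun t => Real.exp (2 - b / √(√(2 * d t))))
    (fun t => (Real.exp_pos _).le) (fun t => le_rfl) ?_ T
  · rw [hcard] at key
    refine key.trans (Finset.sum_le_sum fun t ht => ?_)
    have htT : t ≤ T := by have := Finset.mem_range.1 ht; omega
    have h1 := thinLaw_bad_overlap_le μ hA hp ho1 (hω t) (hd t) t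
    have h2 := sum_large_overlap_le hκ hN (t := t) (d := d t)
      (le_trans (by exact_mod_cast htT) hT) (hξ t htT) (hξ0 t)
    rw [hcard] at h1 h2
    have h3 : ∑ s, ∑ s', (if d t < o s s' ^ 2 then
        (μ.real (dualSlab κ s ∩ dualSlab κ s') / p κ ^ 2) ^ t / ((2 : ℝ) ^ N) ^ 2 else 0) ≤
        (N + 1) * ξ t := by
      refine le_trans (le_of_eq ?_) h2
      refine Finset.sum_congr rfl fun s _ => Finset.sum_congr rfl fun s' _ => ?_
      rw [hμ, stdGaussian_dualSlab_inter κ hN, ho]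
      simp only [inner_unitSign hN]
    have h4 := h1.trans (mul_le_mul_of_nonneg_left h3
      (by have := hd t; have := hω t; positivity))
    linarith
  · intro s s'
    obtain ⟨a1, a2⟩ := agree_div_mem hN s s'
    rw [hμ, stdGaussian_dualSlab_inter κ hN, div_mul_cancel₀ _ (by positivity), ho]
    simp only [inner_unitSign hN]
    exact hCq _ a1 a2
  · intro t S hS hSD
    have := hslab S unitSign (2 * d t) hS (fun s _ => norm_unitSign hN s)
      (by have := hd t; positivity) hSD
    have h2 := ENNReal.toReal_mono ENNReal.ofReal_ne_top this
    rw [ENNReal.toReal_ofReal (Real.exp_pos _).le] at h2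
    refine le_trans (le_of_eq ?_) h2
    rw [Measure.real]
    congr 2

end Cube

/-! ### Choice of rates -/

section Rates

/-- The sequence m_s = m₀(1+K)^s satisfies m_{s+1} - m_s = K m_s, so the exponents telescope. This
is why thresholds are taken geometric in time. -/
lemma prod_le_exp_geometric {a m₀ K : ℝ} (ha : 0 ≤ a) (hm : 0 ≤ m₀) (hK : 0 ≤ K) (t : ℕ) :
    ∏ s ∈ Finset.range t, (1 + a * K * (m₀ * (1 + K) ^ s)) ≤
      Real.exp (a * (m₀ * (1 + K) ^ t - m₀)) := by
  induction t with
  | zero => simp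
  | succ t ih =>
    rw [Finset.prod_range_succ]
    have h1 : 1 + a * K * (m₀ * (1 + K) ^ t) ≤ Real.exp (a * K * (m₀ * (1 + K) ^ t)) := by
      rw [add_comm]; exact Real.add_one_le_exp _
    calc _ ≤ Real.exp (a * (m₀ * (1 + K) ^ t - m₀)) * Real.exp (a * K * (m₀ * (1 + K) ^ t)) := by
          gcongr
      _ = _ := by rw [← Real.exp_add]; congr 1; ring

lemma sqrt_sqrt_le {x y : ℝ} (hy : 0 ≤ y) (h : x ≤ y ^ 4) : √(√x) ≤ y := by
  rw [Real.sqrt_le_left hy, Real.sqrt_le_left (by positivity)]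
  calc x ≤ y ^ 4 := h
    _ = _ := by ring

lemma eventually_mul_log_le (A : ℝ) {c : ℝ} (hc : 0 < c) :
    ∀ᶠ N : ℕ in atTop, A * Real.log N ≤ c * N := by
  have h := (Real.isLittleO_log_id_atTop.bound (show 0 < c / (|A| + 1) by positivity))
  filter_upwards [tendsto_natCast_atTop_atTop.eventually h, eventually_ge_atTop 1] with N hN h1
  simp only [id, Real.norm_eq_abs, Nat.abs_cast] at hN
  calc A * Real.log N ≤ |A * Real.log N| := le_abs_self _
    _ = |A| * |Real.log N| := abs_mul _ _
    _ ≤ (|A| + 1) * (c / (|A| + 1) * N) := by gcongr; linarith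
    _ = _ := by field_simp

lemma eventually_mul_log_pow_le {A : ℝ} (hA : 0 ≤ A) {c : ℝ} (hc : 0 < c) (n : ℕ) :
    ∀ᶠ N : ℕ in atTop, A * Real.log N ^ n ≤ c * N := by
  have h := ((Real.isLittleO_pow_log_id_atTop (n := n)).bound (show 0 < c / (A + 1) by positivity))
  filter_upwards [tendsto_natCast_atTop_atTop.eventually h] with N hN
  simp only [id, Real.norm_eq_abs, Nat.abs_cast] at hN
  calc A * Real.log N ^ n ≤ (A + 1) * (c / (A + 1) * N) :=
        mul_le_mul (by linarith) ((le_abs_self _).trans hN) (pow_nonneg (Real.log_natCast_nonneg N) n)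
          (by positivity)
    _ = _ := by field_simp

/-- With l = log N, the prefactor costs at most N · e^{2ml} · e^{2l}. The near part e^{-6ml} of ξ
leaves e^{-4ml} with m ≥ 4, and the far part e^{-c'N} beats any power of N. -/
lemma large_overlap_rate_le {N l m lam c' M : ℝ} (hN : 2 ≤ N) (hNl : N = Real.exp l)
    (hl : 1 ≤ l) (hlam : 0 < lam) (h1 : 1 ≤ 4 * lam * l) (hm4 : 4 ≤ m) (hmM : m ≤ M)
    (h3 : (2 * M + 6) * l ≤ c' * N) :
    (lam * m * l / N * Real.exp (-(m * l)) ^ 2)⁻¹ *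
      ((N + 1) * (Real.exp (-(6 * m * l)) + Real.exp (-(c' * N)))) ≤ 2 * Real.exp (-(2 * l)) := by
  set ξ := Real.exp (-(6 * m * l)) + Real.exp (-(c' * N)) with hξ
  have hξ0 : 0 < ξ := by positivity
  have hd0 : 0 < lam * m * l / N := by positivity
  have h2 : N⁻¹ ≤ lam * m * l / N := by
    rw [inv_eq_one_div]
    refine div_le_div_of_nonneg_right (h1.trans ?_) (by linarith)
    have : 4 * (lam * l) ≤ m * (lam * l) := by gcongr
    linarith
  have h3' : (lam * m * l / N * Real.exp (-(m * l)) ^ 2)⁻¹ ≤ N * Real.exp (2 * m * l) := by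
    rw [inv_le_comm₀ (by positivity) (by positivity), mul_inv, ← Real.exp_neg, ← Real.exp_nat_mul]
    refine mul_le_mul h2 (le_of_eq ?_) (Real.exp_pos _).le hd0.le
    congr 1
    push_cast
    ring
  have h4 : N + 1 ≤ Real.exp (2 * l) := by
    rw [two_mul, Real.exp_add, ← hNl]
    nlinarith
  have hml : 4 * l ≤ m * l := by gcongr
  have hMl : m * l ≤ M * l := by gcongr
  have h5 : ξ * Real.exp (2 * m * l) ≤ 2 * Real.exp (-(6 * l)) := by
    rw [hξ, add_mul, ← Real.exp_add, ← Real.exp_add, two_mul (Real.exp _)]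
    exact add_le_add (Real.exp_le_exp.2 (by linarith)) (Real.exp_le_exp.2 (by linarith))
  calc _ ≤ (N * Real.exp (2 * m * l)) * (Real.exp (2 * l) * ξ) := by gcongr
    _ = N * Real.exp (2 * l) * (ξ * Real.exp (2 * m * l)) := by ring
    _ ≤ N * Real.exp (2 * l) * (2 * Real.exp (-(6 * l))) := by gcongr
    _ = 2 * Real.exp (-(3 * l)) := by
        have : Real.exp (-(3 * l)) = N * Real.exp (2 * l) * Real.exp (-(6 * l)) := by
          rw [hNl, ← Real.exp_add, ← Real.exp_add]; congr 1; ring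
        rw [this]; ring
    _ ≤ _ := by gcongr; linarith

/-- As d is of order (log N)/N, its fourth root is far below 1/log N. The assumption on l⁵ is what
makes b over the fourth root of 2d at least 4l. -/
lemma slab_rate_le {N l d b A : ℝ} (hN : 0 < N) (hl : 1 ≤ l) (hb : 0 < b) (hd0 : 0 < d)
    (hd : d ≤ A * l / N) (h4 : 512 * A * l ^ 5 ≤ b ^ 4 * N) :
    Real.exp (2 - b / √(√(2 * d))) ≤ Real.exp (-(2 * l)) := by
  rw [Real.exp_le_exp]
  have h0 : 0 < √(√(2 * d)) := by positivity
  have h1 : √(√(2 * d)) ≤ b / (4 * l) := by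
    refine sqrt_sqrt_le (by positivity) ?_
    have h3 : 2 * (A * l / N) ≤ (b / (4 * l)) ^ 4 := by
      rw [div_pow, mul_div_assoc', div_le_div_iff₀ (by positivity) (by positivity)]
      refine le_trans (le_of_eq ?_) h4
      ring
    linarith
  have h2 : 4 * l ≤ b / √(√(2 * d)) := by
    rw [le_div_iff₀ h0]
    rw [le_div_iff₀ (by positivity)] at h1
    linarith
  linarith

/-- K is tuned so that the inverse moment at time t is at most exp((m_t - 4)l/2), with m_t = 4(1 +
K/N)^t. It uses only half of the exponent in the threshold exp(-m_t l). -/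
lemma inverse_moment_rate_le {N l C η lam K : ℝ} (hN : 0 < N) (hl : 0 ≤ l) (hη : 0 < η)
    (hK : K = 4 * C * lam / η) (hK0 : 0 ≤ K) (t : ℕ) :
    Real.exp (-(4 * (1 + K / N) ^ t * l)) *
      ∏ s ∈ Finset.range t, (1 + C * (2 * (lam * (4 * (1 + K / N) ^ s) * l / N)) / η) ≤
      Real.exp (-(2 * l)) := by
  have h1 := prod_le_exp_geometric (a := l / 2) (m₀ := 4) (K := K / N) (by positivity)
    (by norm_num) (by positivity) t
  have h2 : ∏ s ∈ Finset.range t, (1 + C * (2 * (lam * (4 * (1 + K / N) ^ s) * l / N)) / η) =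
      ∏ s ∈ Finset.range t, (1 + l / 2 * (K / N) * (4 * (1 + K / N) ^ s)) := by
    refine Finset.prod_congr rfl fun s _ => ?_
    congr 1
    generalize (1 + K / N) ^ s = y
    rw [hK]
    field_simp
    ring
  have hm : 1 ≤ (1 + K / N) ^ t := one_le_pow₀ (by have : 0 ≤ K / N := by positivity
                                                   linarith)
  rw [h2]
  calc _ ≤ Real.exp (-(4 * (1 + K / N) ^ t * l)) *
        Real.exp (l / 2 * (4 * (1 + K / N) ^ t - 4)) := by gcongr
    _ = Real.exp (-(4 * (1 + K / N) ^ t * l) + l / 2 * (4 * (1 + K / N) ^ t - 4)) := by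
        rw [← Real.exp_add]
    _ ≤ _ := by
        rw [Real.exp_le_exp]
        have : l * 1 ≤ l * (1 + K / N) ^ t := by gcongr
        linarith

end Rates

open Classical in
/-- With probability tending to one, the number of solutions is at least a polynomial fraction
of its mean. -/
theorem exists_cube_lower_tail {κ : ℝ} (hκ : 0 < κ) (hF : CriticalPointAssumption κ) :
    ∃ M : ℝ, 0 ≤ M ∧ ∀ α, 0 < α → α < alphaC κ → ∀ᶠ N : ℕ in atTop, ∀ T : ℕ, (T : ℝ) ≤ α * N →
      ∑ S : Finset (Fin N → Bool),
        thinLaw (dualSlab κ) (stdGaussian (EuclideanSpace ℝ (Fin N))) T S *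
        (if Real.exp (-(M * Real.log N)) * (2 ^ N * p κ ^ T) ≤ S.card then 0 else 1) ≤
      4 * (α * N + 1) / (N : ℝ) ^ 2 := by
  obtain ⟨C, hC, hCq⟩ := exists_q_sub_sq_le_global hκ
  obtain ⟨η, b, hη, hη', hb, hslab⟩ := exists_slab_lower hκ
  obtain ⟨c, δ, hc, hδ0, hδ1, hloc⟩ := exists_F_local hκ
  have hp := p_pos hκ
  -- Makes c N d_t = 6 m_t log N, the exponent required for overlaps in the quadratic regime.
  set lam : ℝ := 6 / c with hlam
  have hlam0 : 0 < lam := by positivity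
  set K : ℝ := 4 * (C / p κ ^ 2) * lam / η with hK
  have hK0 : 0 < K := by positivity
  -- Bounds 4(1 + K/N)^t for every t ≤ `alphaC κ` · N, hence does not involve α.
  set M : ℝ := 4 * Real.exp (K * alphaC κ) with hM
  have hM0 : 0 < M := by positivity
  refine ⟨M, hM0.le, fun α hα0 hα => ?_⟩
  have hloc' := hloc α hα0.le hα
  obtain ⟨c', hc', hfar⟩ := exists_F_far hκ hF hα0 hα hc hδ0 hloc'
  have hlogtop : Tendsto (fun N : ℕ => Real.log N) atTop atTop :=
    Real.tendsto_log_atTop.comp tendsto_natCast_atTop_atTop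
  filter_upwards [eventually_ge_atTop 2, hlogtop.eventually_ge_atTop 1,
    hlogtop.eventually_ge_atTop (1 / (4 * lam)), eventually_mul_log_le (2 * M + 6) hc',
    eventually_mul_log_pow_le (A := 512 * lam * M) (by positivity)
      (show 0 < b ^ 4 by positivity) 5] with N hN2 hl1 hl2 hl3 hl4 T hT
  set l := Real.log N with hl
  have hN : 0 < N := by omega
  have hN' : (2 : ℝ) ≤ N := by exact_mod_cast hN2
  have hNl : (N : ℝ) = Real.exp l := (Real.exp_log (by linarith)).symm
  -- At time t the size threshold is N^{-m_t} times the mean, and the overlap level is d_t = λ m_t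
  -- (log N)/N. A smaller allowed size requires a larger overlap level, and conversely the product
  -- of the steps 1 + O(d_s) dictates how fast m_t must grow.
  set m : ℕ → ℝ := fun t => 4 * (1 + K / N) ^ t with hm
  have hm4 : ∀ t, 4 ≤ m t := by
    intro t
    have : (1 : ℝ) ≤ (1 + K / N) ^ t := one_le_pow₀ (by have : 0 ≤ K / N := by positivity
                                                        linarith)
    simp only [hm]; linarith
  have hmM : ∀ t ≤ T, m t ≤ M := by
    intro t ht
    have h1 : (1 + K / N) ^ t ≤ Real.exp (K / N) ^ t := by
      gcongr; rw [add_comm]; exact Real.add_one_le_exp _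
    have h2 : (t : ℝ) ≤ alphaC κ * N := by
      have : (t : ℝ) ≤ T := by exact_mod_cast ht
      nlinarith
    rw [← Real.exp_nat_mul] at h1
    have h3 : (t : ℝ) * (K / N) ≤ K * alphaC κ := by
      rw [mul_div_assoc', div_le_iff₀ (by positivity)]
      nlinarith
    simp only [hm, hM]
    have := Real.exp_le_exp.2 h3
    linarith
  set d : ℕ → ℝ := fun t => lam * m t * l / N with hd
  have hd0 : ∀ t, 0 < d t := by
    intro t
    have := hm4 t
    simp only [hd]
    have : 0 < m t := by linarith
    positivity
  set ξ : ℕ → ℝ := fun t => Real.exp (-(6 * m t * l)) + Real.exp (-(c' * N)) with hξ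
  have key := cube_lower_tail (α := α) hκ hC hCq hη hη' (fun S u D => hslab N S u D) hN
    (ω := fun t => Real.exp (-(m t * l))) (d := d) (ξ := ξ) (T := T)
    (fun t => Real.exp_pos _) hd0 hT (fun t => by simp only [hξ]; positivity) ?_
  · refine le_trans (Finset.sum_le_sum fun S _ => mul_le_mul_of_nonneg_left ?_
      (thinLaw_nonneg _ _ _ _)) (key.trans ?_)
    · have h1 : Real.exp (-(M * l)) ≤ Real.exp (-(m T * l)) := by
        have := hmM T le_rfl
        gcongr
      have h2 : Real.exp (-(M * l)) * (2 ^ N * p κ ^ T) ≤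
          Real.exp (-(m T * l)) * (2 ^ N * p κ ^ T) := by gcongr
      by_cases h3 : Real.exp (-(m T * l)) * (2 ^ N * p κ ^ T) ≤ S.card
      · rw [if_pos h3, if_pos (h2.trans h3)]
      · rw [if_neg h3]
        split_ifs <;> norm_num
    · have hterm : ∀ t ∈ Finset.range (T + 1), (Real.exp (-(m t * l)) *
          ∏ s ∈ Finset.range t, (1 + C / p κ ^ 2 * (2 * d s) / η) +
          (d t * Real.exp (-(m t * l)) ^ 2)⁻¹ * ((N + 1) * ξ t) +
          Real.exp (2 - b / √(√(2 * d t)))) ≤ 4 * Real.exp (-(2 * l)) := by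
        intro t ht
        have htT : t ≤ T := by have := Finset.mem_range.1 ht; omega
        have hmt := hm4 t
        have hmt' := hmM t htT
        have b1 := inverse_moment_rate_le (N := N) (l := l) (C := C / p κ ^ 2) (by linarith)
          (by linarith) hη hK hK0.le t
        have b2 := large_overlap_rate_le (c' := c') hN' hNl hl1 hlam0
          (by rw [div_le_iff₀ (by positivity)] at hl2; linarith) hmt hmt' hl3
        have b3 := slab_rate_le (A := lam * M) (N := N) (by linarith) hl1 hb (hd0 t)
          (by simp only [hd]; gcongr) (by linarith)
        linarith
      refine (Finset.sum_le_sum hterm).trans ?_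
      rw [Finset.sum_const, Finset.card_range, nsmul_eq_mul]
      have h1 : Real.exp (-(2 * l)) = ((N : ℝ) ^ 2)⁻¹ := by
        rw [hNl, Real.exp_neg, ← Real.exp_nat_mul]; norm_num
      rw [h1, div_eq_mul_inv]
      push_cast
      calc _ = 4 * (T + 1) * ((N : ℝ) ^ 2)⁻¹ := by ring
        _ ≤ _ := by gcongr
  · intro t ht β hβ0 hβ1 hdβ
    simp only [hξ]
    -- Overlaps up to δ are paid by the quadratic bound, the others by the gap c'. The latter
    -- depends on α, which only affects how large N has to be.
    by_cases h : |2 * β - 1| ≤ δ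
    · have h1 := hloc' β h
      refine le_trans (Real.exp_le_exp.2 ?_) (le_add_of_nonneg_right (Real.exp_pos _).le)
      have h2 : c * (N * d t) = 6 * m t * l := by
        simp only [hd, hlam]; field_simp
      have h3 : (N : ℝ) * (F κ α β - F κ α (1 / 2)) ≤ N * (-c * (2 * β - 1) ^ 2) := by gcongr
      have h4 : c * (N * d t) ≤ c * (N * (2 * β - 1) ^ 2) := by gcongr
      linarith
    · have h1 := hfar β hβ0 hβ1 (not_le.1 h).le
      refine le_trans (Real.exp_le_exp.2 ?_) (le_add_of_nonneg_left (Real.exp_pos _).le)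
      have h3 : (N : ℝ) * (F κ α β - F κ α (1 / 2)) ≤ N * (-c') := by gcongr
      linarith

/-! ### Survivors of independent random points follow the thinning chain -/

section Survivors

open Classical in
/-- The indices whose sets contain the first `t` points. -/
noncomputable def survivors {ι α : Type*} [Fintype ι] (A : ι → Set α) (x : ℕ → α) (t : ℕ) :
    Finset ι := Finset.univ.filter fun i => ∀ j < t, x j ∈ A i

variable {ι α Ω : Type*} [Fintype ι] {A : ι → Set α}

lemma mem_survivors {x : ℕ → α} {t : ℕ} {i : ι} :
    i ∈ survivors A x t ↔ ∀ j < t, x j ∈ A i := by simp [survivors]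

lemma survivors_zero (x : ℕ → α) : survivors A x 0 = Finset.univ := by
  ext i; simp [mem_survivors]

lemma survivors_succ (x : ℕ → α) (t : ℕ) :
    survivors A x (t + 1) = thin A (survivors A x t) (x t) := by
  ext i
  rw [mem_thin, mem_survivors, mem_survivors]
  exact Nat.forall_lt_succ_right

lemma survivors_congr {x y : ℕ → α} (h : ∀ j, x j = y j) (t : ℕ) :
    survivors A x t = survivors A y t := by
  rw [funext h]

variable [MeasurableSpace α] [MeasurableSpace Ω] {μ : Measure α} {P : Measure Ω}

lemma measurableSet_survivors_eq (hA : ∀ i, MeasurableSet (A i)) {Y : ℕ → Ω → α}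
    (hY : ∀ i, Measurable (Y i)) (t : ℕ) (S : Finset ι) :
    MeasurableSet {ω | survivors A (fun i => Y i ω) t = S} := by
  classical
  have e : {ω | survivors A (fun i => Y i ω) t = S} =
      ⋂ i, {ω | (∀ j < t, Y j ω ∈ A i) ↔ i ∈ S} := by
    ext ω
    simp [Finset.ext_iff, mem_survivors]
  rw [e]
  refine MeasurableSet.iInter fun i => ?_
  have h1 : MeasurableSet {ω | ∀ j < t, Y j ω ∈ A i} := by
    have : {ω | ∀ j < t, Y j ω ∈ A i} = ⋂ j, ⋂ (_ : j < t), Y j ⁻¹' A i := by ext ω; simp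
    rw [this]
    exact MeasurableSet.iInter fun j => MeasurableSet.iInter fun _ => hY j (hA i)
  by_cases h2 : i ∈ S <;> simp only [h2, iff_true, iff_false]
  · exact h1
  · exact h1.compl

/-- The survivors at time t are a function of the points with index below t, hence independent of
the point with index t. This is the Markov property. -/
lemma measure_survivors_inter [IsProbabilityMeasure P] (hA : ∀ i, MeasurableSet (A i))
    {Y : ℕ → Ω → α} (hY : ∀ i, Measurable (Y i)) (hind : iIndepFun Y P) (t : ℕ) (S : Finset ι)
    {B : Set α} (hB : MeasurableSet B) :
    P ({ω | survivors A (fun i => Y i ω) t = S} ∩ Y t ⁻¹' B) =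
      P {ω | survivors A (fun i => Y i ω) t = S} * P (Y t ⁻¹' B) := by
  classical
  have h := hind.indepFun_finset (Finset.range t) {t} (by simp) hY
  have e1 : {ω | survivors A (fun i => Y i ω) t = S} =
      (fun ω (j : Finset.range t) => Y j ω) ⁻¹'
        {y | ∀ i, (∀ j : Finset.range t, y j ∈ A i) ↔ i ∈ S} := by
    ext ω
    simp [Finset.ext_iff, mem_survivors]
  have e2 : Y t ⁻¹' B = (fun ω (j : ({t} : Finset ℕ)) => Y j ω) ⁻¹'
      {y | y ⟨t, Finset.mem_singleton_self t⟩ ∈ B} := rfl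
  rw [e1, e2]
  refine h.measure_inter_preimage_eq_mul _ _ ?_ (measurable_pi_apply _ hB)
  have e3 : {y : Finset.range t → α | ∀ i, (∀ j : Finset.range t, y j ∈ A i) ↔ i ∈ S} =
      ⋂ i, {y | (∀ j : Finset.range t, y j ∈ A i) ↔ i ∈ S} := by ext y; simp
  rw [e3]
  refine MeasurableSet.iInter fun i => ?_
  have h1 : MeasurableSet {y : Finset.range t → α | ∀ j, y j ∈ A i} := by
    have : {y : Finset.range t → α | ∀ j, y j ∈ A i} = ⋂ j, (fun y => y j) ⁻¹' A i := by
      ext y; simp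
    rw [this]
    exact MeasurableSet.iInter fun j => measurable_pi_apply j (hA i)
  by_cases h2 : i ∈ S <;> simp only [h2, iff_true, iff_false]
  · exact h1
  · exact h1.compl

lemma measureReal_survivors_eq_of_measurable [IsProbabilityMeasure P]
    (hA : ∀ i, MeasurableSet (A i)) {Y : ℕ → Ω → α} (hY : ∀ i, Measurable (Y i))
    (hlaw : ∀ i, P.map (Y i) = μ) (hind : iIndepFun Y P) (t : ℕ) (S : Finset ι) :
    P.real {ω | survivors A (fun i => Y i ω) t = S} = thinLaw A μ t S := by
  classical
  induction t generalizing S with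
  | zero =>
    simp only [survivors_zero, thinLaw]
    by_cases h : S = Finset.univ
    · simp [h]
    · simp [h, Ne.symm h]
  | succ t ih =>
    have e : {ω | survivors A (fun i => Y i ω) (t + 1) = S} =
        ⋃ S', ({ω | survivors A (fun i => Y i ω) t = S'} ∩ Y t ⁻¹' {x | thin A S' x = S}) := by
      ext ω
      simp [survivors_succ]
    rw [e, measureReal_iUnion_fintype, thinLaw]
    · refine Finset.sum_congr rfl fun S' _ => ?_
      rw [← ih S', thinKernel, measureReal_def, measureReal_def, measureReal_def,
        measure_survivors_inter hA hY hind t S' (measurableSet_thin_eq hA S' S),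
        ENNReal.toReal_mul, ← hlaw t, Measure.map_apply (hY t) (measurableSet_thin_eq hA S' S)]
    · intro S' S'' hne
      refine Set.disjoint_left.2 fun ω h1 h2 => hne ?_
      exact h1.1.symm.trans h2.1
    · exact fun S' => (measurableSet_survivors_eq hA hY t S').inter
        (hY t (measurableSet_thin_eq hA S' S))

variable {X : ℕ → Ω → α}

/-- The set of survivors of independent random points has the law of the thinning chain. -/
lemma measureReal_survivors_eq [IsProbabilityMeasure P] (hA : ∀ i, MeasurableSet (A i))
    (hX : ∀ i, HasLaw (X i) μ P) (hind : iIndepFun X P) (t : ℕ) (S : Finset ι) :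
    P.real {ω | survivors A (fun i => X i ω) t = S} = thinLaw A μ t S := by
  -- `HasLaw` gives only almost everywhere measurability, so all points are replaced by measurable
  -- modifications at once.
  have hae := fun i => (hX i).aemeasurable.ae_eq_mk
  rw [← measureReal_survivors_eq_of_measurable hA (fun i => (hX i).aemeasurable.measurable_mk)
    (fun i => by rw [← Measure.map_congr (hae i), (hX i).map_eq]) (hind.congr hae) t S]
  refine measureReal_congr ?_
  filter_upwards [ae_all_iff.2 hae] with ω hω
  refine propext ?_
  change survivors A _ t = S ↔ survivors A _ t = S
  rw [survivors_congr hω]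

lemma integral_survivors [IsProbabilityMeasure P] (hA : ∀ i, MeasurableSet (A i))
    (hX : ∀ i, HasLaw (X i) μ P) (hind : iIndepFun X P) (t : ℕ) (f : Finset ι → ℝ) :
    ∫ ω, f (survivors A (fun i => X i ω) t) ∂P = ∑ S, thinLaw A μ t S * f S := by
  classical
  have hae := fun i => (hX i).aemeasurable.ae_eq_mk
  set Y : ℕ → Ω → α := fun i => (hX i).aemeasurable.mk with hYdef
  have hY : ∀ i, Measurable (Y i) := fun i => (hX i).aemeasurable.measurable_mk
  have e : (fun ω => f (survivors A (fun i => X i ω) t)) =ᵐ[P] fun ω =>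
      ∑ S, Set.indicator {ω | survivors A (fun i => Y i ω) t = S} (fun _ => f S) ω := by
    filter_upwards [ae_all_iff.2 hae] with ω hω
    rw [survivors_congr hω, Finset.sum_eq_single (survivors A (fun i => Y i ω) t)]
    · rw [Set.indicator_of_mem]; rfl
    · intro S' _ h
      rw [Set.indicator_of_notMem]
      exact fun h' => h (Eq.symm h')
    · simp
  rw [integral_congr_ae e, integral_finsetSum _ fun S _ =>
    (integrable_const _).indicator (measurableSet_survivors_eq hA hY t S)]
  refine Finset.sum_congr rfl fun S _ => ?_
  rw [integral_indicator_const _ (measurableSet_survivors_eq hA hY t S), smul_eq_mul,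
    measureReal_survivors_eq_of_measurable hA hY
      (fun i => by rw [← Measure.map_congr (hae i), (hX i).map_eq]) (hind.congr hae)]

-- An inequality suffices and needs no measurability of the event: it is covered by finitely many
-- events on which the survivor set is prescribed.
open Classical in
lemma measure_survivors_le [IsProbabilityMeasure P] (hA : ∀ i, MeasurableSet (A i))
    (hX : ∀ i, HasLaw (X i) μ P) (hind : iIndepFun X P) (t : ℕ) (g : Finset ι → Prop) :
    P {ω | g (survivors A (fun i => X i ω) t)} ≤
      ENNReal.ofReal (∑ S, thinLaw A μ t S * if g S then 1 else 0) := by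
  have h1 : {ω | g (survivors A (fun i => X i ω) t)} ⊆
      ⋃ S ∈ Finset.univ.filter g, {ω | survivors A (fun i => X i ω) t = S} := by
    intro ω hω
    simp only [Set.mem_iUnion, Finset.mem_filter, Finset.mem_univ, true_and]
    exact ⟨_, hω, rfl⟩
  refine (measure_mono h1).trans ((measure_biUnion_finset_le _ _).trans (le_of_eq ?_))
  rw [ENNReal.ofReal_sum_of_nonneg fun S _ => mul_nonneg (thinLaw_nonneg A μ t S)
    (by split_ifs <;> norm_num), Finset.sum_filter]
  refine Finset.sum_congr rfl fun S _ => ?_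
  split_ifs
  · rw [mul_one, ← measureReal_survivors_eq hA hX hind, ofReal_measureReal]
  · simp

end Survivors

/-! ### From survivors to solutions and deviation events -/

section Solutions

variable {N : ℕ}

lemma signVec_injective : Function.Injective (signVec (N := N)) := by
  intro s s' h
  funext l
  have h1 := congrArg (fun v : EuclideanSpace ℝ (Fin N) => v l) h
  simp only [signVec] at h1
  revert h1
  cases s l <;> cases s' l <;> norm_num

lemma signVec_mem_cube (s : Fin N → Bool) : signVec s ∈ cube N := by
  intro j
  simp only [signVec]
  cases s j <;> simp

lemma exists_signVec {σ : EuclideanSpace ℝ (Fin N)} (h : σ ∈ cube N) : ∃ s, signVec s = σ := by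
  classical
  refine ⟨fun l => decide (σ l = 1), ?_⟩
  ext l
  rcases h l with h | h
  · simp only [signVec, h]; norm_num
  · simp [signVec, h]

lemma mem_dualSlab_iff (hN : 0 < N) {κ : ℝ} {s : Fin N → Bool} {x : EuclideanSpace ℝ (Fin N)} :
    x ∈ dualSlab κ s ↔ |⟪x, signVec s⟫| ≤ κ * √(N : ℝ) := by
  have hN' : (0 : ℝ) < √(N : ℝ) := Real.sqrt_pos.2 (by exact_mod_cast hN)
  change |⟪unitSign s, x⟫| ≤ κ ↔ _
  rw [unitSign, real_inner_smul_left, real_inner_comm, abs_mul, abs_of_pos (inv_pos.2 hN'),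
    inv_mul_le_iff₀ hN', mul_comm]

lemma ncard_solutions (hN : 0 < N) (κ : ℝ) (x : ℕ → EuclideanSpace ℝ (Fin N)) (t : ℕ) :
    (solutions κ x t).ncard = (survivors (dualSlab κ) x t).card := by
  have e : solutions κ x t = signVec '' (survivors (dualSlab κ) x t : Set (Fin N → Bool)) := by
    ext σ
    constructor
    · rintro ⟨h1, h2⟩
      obtain ⟨s, rfl⟩ := exists_signVec h1
      refine ⟨s, ?_, rfl⟩
      rw [Finset.mem_coe, mem_survivors]
      exact fun j hj => (mem_dualSlab_iff hN).2 (h2 j hj).2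
    · rintro ⟨s, hs, rfl⟩
      rw [Finset.mem_coe, mem_survivors] at hs
      exact ⟨signVec_mem_cube s, fun j hj => ⟨signVec_mem_cube s, (mem_dualSlab_iff hN).1 (hs j hj)⟩⟩
  rw [e, Set.ncard_image_of_injective _ signVec_injective, Set.ncard_coe_finset]

variable {Ω : Type*} [MeasurableSpace Ω] {P : Measure Ω} [IsProbabilityMeasure P]
  {X : ℕ → Ω → EuclideanSpace ℝ (Fin N)}

lemma expectedCard_eq (hN : 0 < N) (κ : ℝ)
    (hX : ∀ i, HasLaw (X i) (stdGaussian (EuclideanSpace ℝ (Fin N))) P) (hind : iIndepFun X P)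
    (t : ℕ) : expectedCard κ P X t = 2 ^ N * p κ ^ t := by
  simp only [expectedCard, ncard_solutions hN]
  rw [integral_survivors (measurableSet_dualSlab κ) hX hind t fun S => (S.card : ℝ),
    sum_thinLaw_card _ (measurableSet_dualSlab κ) (stdGaussian_dualSlab κ hN)]
  simp

open Classical in
/-- A deviation event splits into a lower tail and an upper tail. -/
lemma measure_deviationEvent_le (hN : 0 < N) {κ : ℝ} (hκ : 0 < κ)
    (hX : ∀ i, HasLaw (X i) (stdGaussian (EuclideanSpace ℝ (Fin N))) P) (hind : iIndepFun X P)
    (t : ℕ) {r r' : ℝ} (hr : r' < r) :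
    P (deviationEvent κ P X t r) ≤ ENNReal.ofReal (∑ S : Finset (Fin N → Bool),
        thinLaw (dualSlab κ) (stdGaussian (EuclideanSpace ℝ (Fin N))) t S *
        (if Real.exp (-r') * (2 ^ N * p κ ^ t) ≤ S.card then 0 else 1) + Real.exp (-r)) := by
  have hp := p_pos hκ
  set E : ℝ := 2 ^ N * p κ ^ t with hE
  have hE0 : 0 < E := by positivity
  have h1 : deviationEvent κ P X t r ⊆
      {ω | ¬ Real.exp (-r') * E ≤ (survivors (dualSlab κ) (fun i => X i ω) t).card} ∪
      {ω | Real.exp r * E ≤ (survivors (dualSlab κ) (fun i => X i ω) t).card} := by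
    intro ω hω
    set S := survivors (dualSlab κ) (fun i => X i ω) t with hS
    change (¬ Real.exp (-r') * E ≤ S.card) ∨ Real.exp r * E ≤ S.card
    have hexp : Real.exp (-r) < Real.exp (-r') := Real.exp_lt_exp.2 (by linarith)
    have hω' : solutions κ (fun i => X i ω) t = ∅ ∨ r ≤ |Real.log ((S.card : ℝ) / E)| := by
      have := hω
      rw [deviationEvent, expectedCard_eq hN κ hX hind, Set.mem_ofPred_eq, ncard_solutions hN] at this
      exact this
    -- `Real.log 0 = 0` makes the logarithm useless for the empty set. That case belongs to the
    -- lower tail, since 0 < exp(-r')E.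
    rcases Nat.eq_zero_or_pos S.card with h0 | h0
    · left
      rw [h0, not_le]
      push_cast
      positivity
    · have hc : (0 : ℝ) < S.card := by exact_mod_cast h0
      rcases hω' with h | h
      · have h2 := ncard_solutions hN κ (fun i => X i ω) t
        rw [h, Set.ncard_empty] at h2
        exact absurd h2 h0.ne
      · rcases le_abs.1 h with h | h
        · right
          rw [Real.le_log_iff_exp_le (by positivity), le_div_iff₀ hE0] at h
          exact h
        · left
          have h2 : Real.log ((S.card : ℝ) / E) ≤ -r := by linarith
          rw [Real.log_le_iff_le_exp (by positivity), div_le_iff₀ hE0] at h2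
          rw [not_le]
          refine h2.trans_lt ?_
          gcongr
  have hA := measurableSet_dualSlab (N := N) κ
  have h2 := measure_survivors_le hA hX hind t fun S => ¬ Real.exp (-r') * E ≤ (S.card : ℝ)
  have h3 := measure_survivors_le hA hX hind t fun S => Real.exp r * E ≤ (S.card : ℝ)
  refine (measure_mono h1).trans ((measure_union_le _ _).trans ?_)
  rw [ENNReal.ofReal_add (Finset.sum_nonneg fun S _ => mul_nonneg (thinLaw_nonneg _ _ _ _)
    (by split_ifs <;> norm_num)) (Real.exp_pos _).le]
  refine add_le_add (h2.trans (le_of_eq ?_)) (h3.trans (ENNReal.ofReal_le_ofReal ?_))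
  · congr 1
    refine Finset.sum_congr rfl fun S _ => ?_
    by_cases h : Real.exp (-r') * E ≤ (S.card : ℝ)
    · rw [if_pos h, if_neg (not_not.2 h)]
    · rw [if_neg h, if_pos h]
  · have h4 := sum_thinLaw_card (stdGaussian (EuclideanSpace ℝ (Fin N))) hA
      (stdGaussian_dualSlab κ hN) t
    -- Markov for the upper tail: the mean is exactly E.
    have h5 : ∑ S : Finset (Fin N → Bool),
        thinLaw (dualSlab κ) (stdGaussian (EuclideanSpace ℝ (Fin N))) t S *
        (if Real.exp r * E ≤ S.card then 1 else 0) ≤ ∑ S : Finset (Fin N → Bool),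
        thinLaw (dualSlab κ) (stdGaussian (EuclideanSpace ℝ (Fin N))) t S *
        (S.card / (Real.exp r * E)) := by
      refine Finset.sum_le_sum fun S _ => mul_le_mul_of_nonneg_left ?_ (thinLaw_nonneg _ _ _ _)
      split_ifs with h
      · rw [one_le_div (by positivity)]; exact h
      · positivity
    refine h5.trans (le_of_eq ?_)
    simp only [← mul_div_assoc]
    rw [← Finset.sum_div, h4]
    have : (Fintype.card (Fin N → Bool) : ℝ) = 2 ^ N := by simp
    rw [this, ← hE, Real.exp_neg]
    field_simp

end Solutions

end SymPerceptron

/-! ### The theorem -/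

theorem theorem3p1 (κ : ℝ) (hκ : 0 < κ)
    (hF : SymPerceptron.CriticalPointAssumption κ) (ε : ℝ) (hε : 0 < ε) :
    ∃ M : ℝ, ∀ α : ℝ, α < SymPerceptron.alphaC κ →
      ∀ (Ω : ℕ → Type*) [∀ N, MeasurableSpace (Ω N)] (P : ∀ N, Measure (Ω N))
        [∀ N, IsProbabilityMeasure (P N)]
        (X : ∀ N, ℕ → Ω N → EuclideanSpace ℝ (Fin N)),
        (∀ N i, HasLaw (X N i) (stdGaussian (EuclideanSpace ℝ (Fin N))) (P N)) →
        (∀ N, iIndepFun (X N) (P N)) →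
        limsup (fun N : ℕ => ⨆ (t : ℕ) (_ : (t : ℝ) ≤ α * N),
            P N (SymPerceptron.deviationEvent κ (P N) (X N) t (M * Real.log N))) atTop
          ≤ ENNReal.ofReal ε := by
  obtain ⟨M, hM0, hM⟩ := SymPerceptron.exists_cube_lower_tail hκ hF
  -- The extra 1 makes the upper tail at most 1/N and leaves a strict gap above the lower tail
  -- exponent M.
  refine ⟨M + 1, fun α hα Ω _ P _ X hX hind => ?_⟩
  have hc := SymPerceptron.alphaC_pos hκ
  -- The density α may be zero or negative, while the lower tail estimate needs a positive one.
  -- Raising it only enlarges the range of t.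
  set a := max α (SymPerceptron.alphaC κ / 2) with ha
  have ha0 : 0 < a := lt_max_of_lt_right (by linarith)
  have hac : a < SymPerceptron.alphaC κ := max_lt hα (by linarith)
  have hlim : ∀ᶠ N : ℕ in atTop, 4 * (a + 1) / (N : ℝ) + 1 / N ≤ ε := by
    have h1 := tendsto_const_div_atTop_nhds_zero_nat (4 * (a + 1))
    have h2 := tendsto_const_div_atTop_nhds_zero_nat (1 : ℝ)
    have h3 := h1.add h2
    rw [add_zero] at h3
    exact h3.eventually (eventually_le_nhds hε)
  refine limsup_le_of_le (h := ?_)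
  filter_upwards [hM a ha0 hac, hlim, eventually_ge_atTop 2] with N hN hN' hN2
  have hNR : (2 : ℝ) ≤ N := by exact_mod_cast hN2
  have hl : 0 < Real.log N := Real.log_pos (by linarith)
  refine iSup₂_le fun t ht => ?_
  have hta : (t : ℝ) ≤ a * N := ht.trans (by gcongr; exact le_max_left _ _)
  refine (SymPerceptron.measure_deviationEvent_le (by omega) hκ (hX N) (hind N) t
    (r' := M * Real.log N) (by linarith)).trans (ENNReal.ofReal_le_ofReal (le_trans ?_ hN'))
  refine add_le_add ((hN t hta).trans ?_) ?_
  · rw [div_le_div_iff₀ (by positivity) (by positivity)]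
    nlinarith [mul_nonneg (by linarith : (0:ℝ) ≤ N) (by linarith : (0:ℝ) ≤ N - 1)]
  · have h1 : Real.exp (-((M + 1) * Real.log N)) ≤ Real.exp (-Real.log N) := by
      rw [Real.exp_le_exp]
      nlinarith
    rwa [Real.exp_neg (Real.log _), Real.exp_log (by linarith), ← one_div] at h1
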